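/- A \emph{partial field} is a set $P$ with distinguished elements $0,1$, a multiplication, and a partially defined addition such that: $P\setminus\{0\}$ is an abelian group under multiplication with identity $1$, and $0\cdot p=0$ for all $p$; $p+0=p$; every $p$ has a unique additive inverse $-p$; addition is commutative; for $p\neq 0$, $p(q+r)$ is defined if and only if $pq+pr$ is defined, and then they are equal; and the associative law holds: whenever a finite multiset $S$ can be summed to a value $r$ along some binary tree with all intermediate sums defined (an \emph{association} of $S$), then for every splitting of $S$ into two non-empty parts having associations with values $u$ and $w$, the sum $u+w$ is defined and equals $r$. A finite sum $p_1+\cdots+p_n$ is \emph{defined}, with value $r$, if for some $z_1,\dots,z_k\in P$ the multiset $\{p_1,\dots,p_n,z_1,-z_1,\dots,z_k,-z_k\}$ has an association with value $r$. Determinants are defined by the usual sum over permutations. A matrix over $P$ is a \emph{$P$-matrix} if the determinants of all its square submatrices are defined; its \emph{rank} is the largest order of a square submatrix with nonzero determinant. A finite matroid $M$ with ground set $E$ is \emph{representable over $P$} if there are $r\ge 0$ and a $P$-matrix $A$ of rank $r$, with $r$ rows and with columns indexed by $E$, such that the bases of $M$ are exactly the sets $B\subseteq E$ with $|B|=r$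 for which the $r\times r$ submatrix of $A$ with column set $B$ has nonzero determinant. Every field is a partial field (with its total addition). For a nonzero commutative ring $R$ and a set $S$ of units of $R$, the partial field $\mathbb P(R,S)$ has underlying set $\langle S\cup\{-1\}\rangle\cup\{0\}$, where $\langle\cdot\rangle$ denotes the generated multiplicative group, and the operations of $R$, a sum being defined if and only if it lies in this set. For partial fields $P_1,P_2$, the partial field $P_1\otimes P_2$ has underlying set $\{(p_1,p_2)\in P_1\times P_2 : p_1\neq 0 \Leftrightarrow p_2\neq 0\}$, with componentwise operations, a sum being defined if and only if both component sums are defined and either both or neither of them is $0$. \textbf{Theorem (Whittle).} Let $M$ be a finite matroid. The following are equivalent: \begin{enumerate} \item $M$ is representable over $\mathrm{GF}(3)\otimes\mathrm{GF}(5)$; \item $M$ is representable over the dyadic partial field $\mathbb P(\mathbb Q,\{2\})$; \item $M$ is representable over every field whose characteristic is not $2$. \end{enumerate} -/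

import Mathlib

universe u v w

/-- `Association padd S r`: there is a vertex-labelled binary tree whose leaves are labelled with
the elements of the multiset `S`, in which every non-leaf node is labelled with the (defined) sum
of the labels of its two children, and whose root has label `r`. Here `r ∈ padd p q` means that
`p + q` is defined and equal to `r`. -/
inductive Association {P : Type u} (padd : P → P → Part P) : Multiset P → P → Prop
  | leaf (p : P) : Association padd {p} p
  | node {S T : Multiset P} {u w r : P} : Association padd S u → Association padd T w →
      r ∈ padd u w → Association padd (S + T) r

/-- A partial field: `P` without `0` is an abelian group under multiplication, `0` is absorbing,
and `padd` is a partial addition. A pre-association of a multiset is a splitting of it into two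
parts together with associations of the parts, with root labels `u` and `w`; it is compatible
with an association with root label `r` if `u + w` is defined and equal to `r`.
Distributivity (`p * (q + r)` is defined if and only if `p * q + p * r` is) is required for `p ≠ 0`;
for `p = 0` the sum `0 + 0` is always defined, while `q + r` need not be. -/
class PartialField (P : Type u) extends CommGroupWithZero P, Neg P where
  /-- The partial addition. -/
  padd : P → P → Part P
  padd_zero : ∀ p : P, padd p 0 = Part.some p
  zero_mem_padd_iff : ∀ p q : P, 0 ∈ padd p q ↔ q = -p
  padd_comm : ∀ p q : P, padd p q = padd q p
  mul_padd : ∀ p q r : P, p ≠ 0 → (padd q r).map (fun x => p * x) = padd (p * q) (p * r)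
  associative_law : ∀ (S : Multiset P) (r : P), Association padd S r →
    ∀ (S₁ S₂ : Multiset P) (u w : P), S₁ + S₂ = S →
      Association padd S₁ u → Association padd S₂ w → r ∈ padd u w

namespace PartialField

/-! ### Fields as partial fields -/

theorem association_field_sum {F : Type u} [AddCommMonoid F] {S : Multiset F} {r : F}
    (h : Association (fun p q : F => Part.some (p + q)) S r) : S.sum = r := by
  induction h with
  | leaf p => simp
  | node _ _ hr hu hw =>
    rw [Multiset.sum_add, hu, hw]
    exact (Part.mem_some_iff.1 hr).symm

/-- Every field is a partial field, with the total addition. -/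
instance instOfField (F : Type u) [Field F] : PartialField F where
  padd p q := Part.some (p + q)
  padd_zero p := by simp
  zero_mem_padd_iff p q := by
    rw [Part.mem_some_iff, eq_comm, eq_neg_iff_add_eq_zero, add_comm]
  padd_comm p q := by rw [add_comm]
  mul_padd p q r _ := by simp [mul_add]
  associative_law S r h S₁ S₂ u w hS h₁ h₂ := by
    rw [Part.mem_some_iff, ← association_field_sum h, ← hS, Multiset.sum_add,
      association_field_sum h₁, association_field_sum h₂]

/-! ### The partial field of a ring and a set of units -/

/-- The underlying set `⟨S ∪ {-1}⟩ ∪ {0}` of the partial field of a ring `R` and a set `S` of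
units of `R`. -/
def ringCarrier (R : Type u) [CommRing R] (S : Set Rˣ) : Set R :=
  {x | x = 0 ∨ ∃ g ∈ Subgroup.closure (S ∪ {-1}), (g : R) = x}

/-- The partial field of a (nonzero commutative) ring `R` and a set `S` of units of `R`, as a
type. -/
@[ext]
structure OfRing (R : Type u) [CommRing R] (S : Set Rˣ) : Type u where
  val : R
  mem : val ∈ ringCarrier R S

section OfRing

variable {R : Type u} [CommRing R] {S : Set Rˣ}

theorem ringCarrier_mul {x y : R} (hx : x ∈ ringCarrier R S) (hy : y ∈ ringCarrier R S) :
    x * y ∈ ringCarrier R S := by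
  rcases hx with rfl | ⟨g, hg, rfl⟩
  · exact Or.inl (zero_mul _)
  rcases hy with rfl | ⟨k, hk, rfl⟩
  · exact Or.inl (mul_zero _)
  · exact Or.inr ⟨g * k, mul_mem hg hk, by simp⟩

theorem ringCarrier_one : (1 : R) ∈ ringCarrier R S :=
  Or.inr ⟨1, one_mem _, by simp⟩

theorem ringCarrier_inverse {x : R} (hx : x ∈ ringCarrier R S) :
    Ring.inverse x ∈ ringCarrier R S := by
  rcases hx with rfl | ⟨g, hg, rfl⟩
  · exact Or.inl (Ring.inverse_zero R)
  · exact Or.inr ⟨g⁻¹, inv_mem hg, by simp⟩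

theorem ringCarrier_neg {x : R} (hx : x ∈ ringCarrier R S) : -x ∈ ringCarrier R S := by
  rcases hx with rfl | ⟨g, hg, rfl⟩
  · exact Or.inl neg_zero
  · exact Or.inr ⟨-1 * g, mul_mem (Subgroup.subset_closure (Or.inr rfl)) hg, by simp⟩

/-- Multiplication in `OfRing R S` is the restriction of that of `R`. -/
noncomputable instance [Nontrivial R] : CommGroupWithZero (OfRing R S) where
  mul x y := ⟨x.val * y.val, ringCarrier_mul x.mem y.mem⟩
  one := ⟨1, ringCarrier_one⟩
  zero := ⟨0, Or.inl rfl⟩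
  inv x := ⟨Ring.inverse x.val, ringCarrier_inverse x.mem⟩
  mul_assoc x y z := OfRing.ext (mul_assoc x.val y.val z.val)
  mul_comm x y := OfRing.ext (mul_comm x.val y.val)
  one_mul x := OfRing.ext (one_mul x.val)
  mul_one x := OfRing.ext (mul_one x.val)
  zero_mul x := OfRing.ext (zero_mul x.val)
  mul_zero x := OfRing.ext (mul_zero x.val)
  exists_pair_ne := ⟨⟨0, Or.inl rfl⟩, ⟨1, ringCarrier_one⟩,
    fun h => zero_ne_one (α := R) (congrArg OfRing.val h)⟩
  inv_zero := OfRing.ext (Ring.inverse_zero R)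
  mul_inv_cancel x hx := by
    refine OfRing.ext ?_
    obtain ⟨x, hx' | ⟨g, hg, rfl⟩⟩ := x
    · exact absurd (OfRing.ext hx') hx
    · exact Ring.mul_inverse_cancel _ g.isUnit

theorem association_ofRing_sum {padd : OfRing R S → OfRing R S → Part (OfRing R S)}
    (hp : ∀ p q r, r ∈ padd p q → r.val = p.val + q.val) {T : Multiset (OfRing R S)} {r : OfRing R S}
    (h : Association padd T r) : (T.map OfRing.val).sum = r.val := by
  induction h with
  | leaf p => exact Multiset.sum_singleton _
  | node _ _ hr hu hw =>
    rw [Multiset.map_add, Multiset.sum_add, hu, hw]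
    exact (hp _ _ _ hr).symm

theorem mem_ofRing_padd {p q r : OfRing R S} :
    r ∈ (⟨p.val + q.val ∈ ringCarrier R S, fun h => ⟨p.val + q.val, h⟩⟩ : Part (OfRing R S)) ↔
      r.val = p.val + q.val :=
  ⟨fun ⟨_, h⟩ => (congrArg OfRing.val h).symm,
    fun h => ⟨show p.val + q.val ∈ ringCarrier R S from h ▸ r.mem, OfRing.ext h.symm⟩⟩

/-- Addition in `OfRing R S` is the restriction of that of `R`: `p + q` is defined if and only if
the sum in `R` lies in `⟨S ∪ {-1}⟩ ∪ {0}`. -/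
noncomputable instance [Nontrivial R] : PartialField (OfRing R S) where
  neg x := ⟨-x.val, ringCarrier_neg x.mem⟩
  padd p q := ⟨p.val + q.val ∈ ringCarrier R S, fun h => ⟨p.val + q.val, h⟩⟩
  padd_zero p := Part.eq_some_iff.2 (mem_ofRing_padd.2 (add_zero p.val).symm)
  zero_mem_padd_iff p q := by
    rw [mem_ofRing_padd]
    change (0 : R) = p.val + q.val ↔ _
    rw [eq_comm, add_comm, ← eq_neg_iff_add_eq_zero]
    exact ⟨fun h => OfRing.ext h, fun h => congrArg OfRing.val h⟩
  padd_comm p q := by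
    ext r
    rw [mem_ofRing_padd, mem_ofRing_padd, add_comm]
  mul_padd p q r hp := by
    ext s
    rw [Part.mem_map_iff, mem_ofRing_padd]
    change _ ↔ s.val = p.val * q.val + p.val * r.val
    constructor
    · rintro ⟨t, ht, rfl⟩
      rw [mem_ofRing_padd] at ht
      change p.val * t.val = _
      rw [ht, mul_add]
    · intro h
      have hps : p * (p⁻¹ * s) = s := by rw [← mul_assoc, mul_inv_cancel₀ hp, one_mul]
      refine ⟨p⁻¹ * s, mem_ofRing_padd.2 ?_, hps⟩
      have hpp : (p⁻¹).val * p.val = 1 := congrArg OfRing.val (inv_mul_cancel₀ hp)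
      change (p⁻¹).val * s.val = _
      rw [h, ← mul_add, ← mul_assoc, hpp, one_mul]
  associative_law T r h T₁ T₂ u w hT h₁ h₂ := by
    have key := fun p q r : OfRing R S => (mem_ofRing_padd (p := p) (q := q) (r := r)).1
    rw [mem_ofRing_padd, ← association_ofRing_sum key h, ← hT, Multiset.map_add,
      Multiset.sum_add, association_ofRing_sum key h₁, association_ofRing_sum key h₂]

end OfRing

/-! ### The direct product of two partial fields -/

/-- The direct product `P ⊗ Q` of two partial fields, as a type. -/
@[ext]
structure DirectProduct (P : Type u) (Q : Type v) [PartialField P] [PartialField Q] :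
    Type (max u v) where
  fst : P
  snd : Q
  nonzero_iff : fst ≠ 0 ↔ snd ≠ 0

section DirectProduct

variable {P : Type u} {Q : Type v} [PartialField P] [PartialField Q]

theorem DirectProduct.eq_zero_iff (x : DirectProduct P Q) : x.fst = 0 ↔ x.snd = 0 :=
  not_iff_not.1 x.nonzero_iff

/-- Multiplication in the direct product is componentwise. -/
instance : CommGroupWithZero (DirectProduct P Q) where
  mul x y := ⟨x.fst * y.fst, x.snd * y.snd, by
    simp only [ne_eq, mul_eq_zero, x.eq_zero_iff, y.eq_zero_iff]⟩
  one := ⟨1, 1, by simp⟩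
  zero := ⟨0, 0, by simp⟩
  inv x := ⟨x.fst⁻¹, x.snd⁻¹, by simp only [ne_eq, inv_eq_zero, x.eq_zero_iff]⟩
  mul_assoc x y z := (DirectProduct.ext (mul_assoc _ _ _) (mul_assoc _ _ _))
  mul_comm x y := (DirectProduct.ext (mul_comm _ _) (mul_comm _ _))
  one_mul x := (DirectProduct.ext (one_mul _) (one_mul _))
  mul_one x := (DirectProduct.ext (mul_one _) (mul_one _))
  zero_mul x := (DirectProduct.ext (zero_mul _) (zero_mul _))
  mul_zero x := (DirectProduct.ext (mul_zero _) (mul_zero _))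
  exists_pair_ne := ⟨⟨0, 0, by simp⟩, ⟨1, 1, by simp⟩,
    fun h => zero_ne_one (α := P) (congrArg (fun x => x.fst) h)⟩
  inv_zero := (DirectProduct.ext inv_zero inv_zero)
  mul_inv_cancel x hx := by
    have h₁ : x.fst ≠ 0 := fun h => hx (DirectProduct.ext h (x.eq_zero_iff.1 h))
    exact (DirectProduct.ext (mul_inv_cancel₀ h₁) (mul_inv_cancel₀ (x.nonzero_iff.1 h₁)))

theorem neg_eq_zero_iff' (p : P) : -p = 0 ↔ p = 0 := by
  rw [eq_comm, ← zero_mem_padd_iff, padd_zero, Part.mem_some_iff, eq_comm]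

/-- Addition in the direct product is componentwise: the sum is defined if and only if both
component sums are defined, and either both or none of them are zero. -/
def DirectProduct.add (p q : DirectProduct P Q) : Part (DirectProduct P Q) where
  Dom := ∃ (h₁ : (padd p.fst q.fst).Dom) (h₂ : (padd p.snd q.snd).Dom),
    (padd p.fst q.fst).get h₁ ≠ 0 ↔ (padd p.snd q.snd).get h₂ ≠ 0
  get h := ⟨(padd p.fst q.fst).get h.1, (padd p.snd q.snd).get h.2.1, h.2.2⟩

theorem DirectProduct.mem_add {p q r : DirectProduct P Q} :
    r ∈ DirectProduct.add p q ↔ r.fst ∈ padd p.fst q.fst ∧ r.snd ∈ padd p.snd q.snd := by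
  constructor
  · rintro ⟨h, rfl⟩
    exact ⟨Part.get_mem _, Part.get_mem _⟩
  · rintro ⟨⟨h₁, e₁⟩, ⟨h₂, e₂⟩⟩
    refine ⟨⟨h₁, h₂, ?_⟩, (DirectProduct.ext e₁ e₂)⟩
    rw [e₁, e₂]
    exact r.nonzero_iff

theorem DirectProduct.association_fst {T : Multiset (DirectProduct P Q)} {r : DirectProduct P Q}
    (h : Association DirectProduct.add T r) :
    Association padd (T.map fun x => x.fst) r.fst := by
  induction h with
  | leaf p => exact Association.leaf _
  | node _ _ hr hu hw =>
    rw [Multiset.map_add]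
    exact Association.node hu hw (DirectProduct.mem_add.1 hr).1

theorem DirectProduct.association_snd {T : Multiset (DirectProduct P Q)} {r : DirectProduct P Q}
    (h : Association DirectProduct.add T r) :
    Association padd (T.map fun x => x.snd) r.snd := by
  induction h with
  | leaf p => exact Association.leaf _
  | node _ _ hr hu hw =>
    rw [Multiset.map_add]
    exact Association.node hu hw (DirectProduct.mem_add.1 hr).2

theorem mem_mul_padd {p q r s : P} (hp : p ≠ 0) :
    s ∈ padd (p * q) (p * r) ↔ p⁻¹ * s ∈ padd q r := by
  rw [← mul_padd p q r hp, Part.mem_map_iff]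
  constructor
  · rintro ⟨t, ht, rfl⟩
    rwa [inv_mul_cancel_left₀ hp]
  · intro h
    exact ⟨_, h, mul_inv_cancel_left₀ hp s⟩

/-- The direct product of two partial fields is a partial field. -/
instance : PartialField (DirectProduct P Q) where
  neg x := ⟨-x.fst, -x.snd, by simp only [ne_eq, neg_eq_zero_iff', x.eq_zero_iff]⟩
  padd := DirectProduct.add
  padd_zero p := by
    refine Part.eq_some_iff.2 (DirectProduct.mem_add.2 ⟨?_, ?_⟩)
    · change p.fst ∈ padd p.fst 0
      simp [padd_zero]
    · change p.snd ∈ padd p.snd 0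
      simp [padd_zero]
  zero_mem_padd_iff p q := by
    rw [DirectProduct.mem_add]
    change (0 : P) ∈ padd p.fst q.fst ∧ (0 : Q) ∈ padd p.snd q.snd ↔ _
    rw [zero_mem_padd_iff, zero_mem_padd_iff]
    exact ⟨fun h => (DirectProduct.ext h.1 h.2), fun h => by subst h; exact ⟨rfl, rfl⟩⟩
  padd_comm p q := by
    ext r
    rw [DirectProduct.mem_add, DirectProduct.mem_add, padd_comm p.fst, padd_comm p.snd]
  mul_padd p q r hp := by
    have h₁ : p.fst ≠ 0 := fun h => hp ((DirectProduct.ext h (p.eq_zero_iff.1 h)))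
    have h₂ : p.snd ≠ 0 := p.nonzero_iff.1 h₁
    ext s
    rw [Part.mem_map_iff, DirectProduct.mem_add]
    change _ ↔ s.fst ∈ padd (p.fst * q.fst) (p.fst * r.fst) ∧
      s.snd ∈ padd (p.snd * q.snd) (p.snd * r.snd)
    rw [mem_mul_padd h₁, mem_mul_padd h₂]
    constructor
    · rintro ⟨t, ht, rfl⟩
      have e : p⁻¹ * (p * t) = t := inv_mul_cancel_left₀ hp t
      rw [← e] at ht
      exact DirectProduct.mem_add.1 ht
    · intro h
      exact ⟨p⁻¹ * s, DirectProduct.mem_add.2 h, mul_inv_cancel_left₀ hp s⟩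
  associative_law T r h T₁ T₂ u w hT h₁ h₂ := by
    subst hT
    refine DirectProduct.mem_add.2 ⟨?_, ?_⟩
    · exact associative_law _ _ (DirectProduct.association_fst h) _ _ _ _
        (Multiset.map_add _ _ _).symm
        (DirectProduct.association_fst h₁) (DirectProduct.association_fst h₂)
    · exact associative_law _ _ (DirectProduct.association_snd h) _ _ _ _
        (Multiset.map_add _ _ _).symm
        (DirectProduct.association_snd h₁) (DirectProduct.association_snd h₂)

end DirectProduct

/-! ### Sums and determinants -/

/-- `SumsTo S r`: the sum of the elements of the finite multiset `S` is defined and equal to `r`,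
that is, `S ∪ {z₁, -z₁, …, zₖ, -zₖ}` has an association with root label `r` for some
`z₁, …, zₖ`. -/
def SumsTo {P : Type u} [PartialField P] (S : Multiset P) (r : P) : Prop :=
  ∃ Z : Multiset P, Association padd (S + (Z + Z.map fun z => -z)) r

/-- `p` for an even sign and `-p` for an odd one. -/
def signed {P : Type u} [PartialField P] (ε : ℤˣ) (p : P) : P :=
  if ε = 1 then p else -p

/-- `HasDet A d`: the determinant of the square matrix `A`, as the sum over all permutations, is
defined and equal to `d`. -/
def HasDet {P : Type u} [PartialField P] {n : ℕ} (A : Matrix (Fin n) (Fin n) P) (d : P) : Prop :=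
  SumsTo ((Finset.univ : Finset (Equiv.Perm (Fin n))).val.map
    fun σ => signed (Equiv.Perm.sign σ) (∏ i, A i (σ i))) d

/-- The determinant of `A` is defined and nonzero. -/
def HasNonzeroDet {P : Type u} [PartialField P] {n : ℕ} (A : Matrix (Fin n) (Fin n) P) : Prop :=
  ∃ d : P, d ≠ 0 ∧ HasDet A d

/-- A matrix with entries in a partial field `P` is a `P`-matrix if the determinant of every square
submatrix is defined. (The rows and columns of the submatrix may be listed in any order; this only
changes the determinant by a sign.) -/
def IsPMatrix {P : Type u} [PartialField P] {X : Type v} {Y : Type w} (A : Matrix X Y P) : Prop :=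
  ∀ (n : ℕ) (f : Fin n ↪ X) (g : Fin n ↪ Y), ∃ d : P, HasDet (A.submatrix f g) d

/-- The rank of a matrix (with finitely many rows): the largest order of a square submatrix with
nonzero determinant. -/
noncomputable def rank {P : Type u} [PartialField P] {X : Type v} {Y : Type w}
    (A : Matrix X Y P) : ℕ :=
  sSup {k : ℕ | ∃ (f : Fin k ↪ X) (g : Fin k ↪ Y), HasNonzeroDet (A.submatrix f g)}

/-! ### Representable matroids -/

/-- The sets `B` of columns with `|B| = r` for which the submatrix with all rows and with columns
`B` has nonzero determinant. -/
def bases {P : Type u} [PartialField P] {r : ℕ} {E : Type v} (A : Matrix (Fin r) E P) :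
    Set (Set E) :=
  {B | ∃ g : Fin r ↪ E, Set.range g = B ∧ HasNonzeroDet (A.submatrix id g)}

/-- A matroid `M` with ground set `E` is representable over `P` if there is an `r × E`
`P`-matrix `A` of rank `r` such that `M = M[A]`, i.e. the bases of `M` are those of `A`. -/
def IsRepresentable (P : Type u) [PartialField P] {α : Type v} (M : Matroid α) : Prop :=
  ∃ (r : ℕ) (A : Matrix (Fin r) M.E P), IsPMatrix A ∧ rank A = r ∧
    ∀ B : Set M.E, M.IsBase (Subtype.val '' B) ↔ B ∈ bases A

end PartialField

/-- The dyadic partial field: the partial field of the ring `ℚ` and the set `{2}`. -/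
abbrev DyadicPartialField : Type :=
  PartialField.OfRing ℚ {Units.mk0 (2 : ℚ) two_ne_zero}

instance fact_prime_five' : Fact (Nat.Prime 5) := ⟨by norm_num⟩

/-! The implication 1 → 2 carries the weight. It is an instance of the Lift Theorem of Pendavingh
and van Zwam, `IsLifting.liftable`. The nonzero elements of GF(3) ⊗ GF(5) are ±1, ±2, ±4, ±1/2, and
every one of them is the residue of some ±2^n. The question is whether the entries of a matrix can
be lifted so that all minors stay 0 or ±2^n. Lifts live in (GF(3) × GF(5)) × ℚ, where a number
carries its residue, so that reduction is a ring homomorphism. What makes the lift possible is that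
the fundamental elements (p ≠ 0 with p and 1 - p in the partial field), which are the cross ratios
of 2 × 2 minors, are 1, 2, 1/2, -1 both upstairs and downstairs.

The Lift Theorem is proved by induction on the number of rows and columns, through the bipartite
graph of nonzero entries. A disconnected matrix splits into blocks, and a single row or column is
lifted entrywise. Otherwise there is a 4-cycle, possibly after a pivot. If it is the whole graph,
its cross ratio has a lift. If not, some vertex has degree at least 3, a spanning tree has three
leaves, and two of them, say columns u and v, can be removed together without disconnecting the
rest. The matrices without u and without v have lifts by induction. On the common part these agree
up to scaling, since lifts of fundamental elements are unique (`IsLifting.scalingEquivOn`); after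
rescaling they glue (`IsLifting.glue`). Pivoting reduces the minors of the glued matrix to 2 × 2
minors in columns u and v, and then to rows joined by a chain of at most two steps, where finitely
many differences have to be checked (`IsLifting.short_sub`).

For 2 → 3, denominators are powers of 2, so dyadic minors can be evaluated in any field in which 2 ≠
0. For 3 → 1, representations over GF(3) and GF(5) are put in standard form with respect to one
base. Every minor then equals a maximal minor, so its vanishing depends on the matroid only, and the
two matrices can be paired entrywise.

Determinants over a partial field are defined through associations. `IsRealization.hasDet_iff` and
`IsRealization.sumsTo_of_sum_eq` turn them into ring determinants: for the partial fields at hand, a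
sum is defined as soon as its value in the ambient ring belongs to the partial field. -/

section

open Matrix

/-! ### Matrices all of whose minors lie in a given set -/

/-- `D` consists of `0` and the elements of a group of units containing `-1`. -/
structure IsUnitCarrier {R : Type*} [CommRing R] (D : Set R) : Prop where
  zero_mem : (0 : R) ∈ D
  one_mem : (1 : R) ∈ D
  neg_mem : ∀ {x}, x ∈ D → -x ∈ D
  mul_mem : ∀ {x y}, x ∈ D → y ∈ D → x * y ∈ D
  exists_inv : ∀ {x}, x ∈ D → x ≠ 0 → ∃ y ∈ D, x * y = 1

section Minors

variable {R : Type*} [CommRing R] {X Y : Type*} {D : Set R}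

/-- All minors of `A` with rows in `s` and columns in `t` lie in `D`. -/
def MinorsIn (D : Set R) (s : Set X) (t : Set Y) (A : Matrix X Y R) : Prop :=
  ∀ (n : ℕ) (f : Fin n → X) (g : Fin n → Y), (∀ i, f i ∈ s) → (∀ i, g i ∈ t) →
    (A.submatrix f g).det ∈ D

theorem IsUnitCarrier.prod_mem (hD : IsUnitCarrier D) {ι : Type*} (I : Finset ι) {f : ι → R}
    (h : ∀ i ∈ I, f i ∈ D) : ∏ i ∈ I, f i ∈ D := by
  classical
  induction I using Finset.induction_on with
  | empty => simpa using hD.one_mem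
  | insert a I ha ih =>
    rw [Finset.prod_insert ha]
    exact hD.mul_mem (h _ (Finset.mem_insert_self _ _))
      (ih fun i hi => h i (Finset.mem_insert_of_mem hi))

theorem IsUnitCarrier.neg_mem_iff (hD : IsUnitCarrier D) {x : R} : -x ∈ D ↔ x ∈ D :=
  ⟨fun h => by simpa using hD.neg_mem h, hD.neg_mem⟩

theorem IsUnitCarrier.mul_mem_iff (hD : IsUnitCarrier D) [Nontrivial R] {x y : R} (hx : x ∈ D)
    (hx0 : x ≠ 0) : x * y ∈ D ↔ y ∈ D := by
  refine ⟨fun h => ?_, hD.mul_mem hx⟩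
  obtain ⟨z, hz, hxz⟩ := hD.exists_inv hx hx0
  have : z * (x * y) = y := by rw [← mul_assoc, mul_comm z, hxz, one_mul]
  rw [← this]
  exact hD.mul_mem hz h

theorem IsUnitCarrier.mul_ne_zero (hD : IsUnitCarrier D) {x y : R} (hx : x ∈ D)
    (hx0 : x ≠ 0) (hy0 : y ≠ 0) : x * y ≠ 0 := by
  obtain ⟨z, hz, hxz⟩ := hD.exists_inv hx hx0
  intro h
  apply hy0
  have : z * (x * y) = y := by rw [← mul_assoc, mul_comm z, hxz, one_mul]
  rw [← this, h, mul_zero]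

theorem IsUnitCarrier.sign_mul_mem_iff (hD : IsUnitCarrier D) (ε : ℤˣ) {x : R} :
    ((ε : ℤ) : R) * x ∈ D ↔ x ∈ D := by
  rcases Int.units_eq_one_or ε with rfl | rfl
  · simp
  · simp [hD.neg_mem_iff]

theorem IsUnitCarrier.neg_one_pow_mul_mem (hD : IsUnitCarrier D) (n : ℕ) {x : R} (hx : x ∈ D) :
    (-1) ^ n * x ∈ D := by
  rcases neg_one_pow_eq_or R n with h | h
  · simpa [h] using hx
  · simpa [h] using hD.neg_mem hx

theorem MinorsIn.mono {s s' : Set X} {t t' : Set Y} {A : Matrix X Y R} (h : MinorsIn D s t A)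
    (hs : s' ⊆ s) (ht : t' ⊆ t) : MinorsIn D s' t' A :=
  fun n f g hf hg => h n f g (fun i => hs (hf i)) fun i => ht (hg i)

theorem MinorsIn.congr {s : Set X} {t : Set Y} {A B : Matrix X Y R} (h : MinorsIn D s t A)
    (hAB : ∀ x ∈ s, ∀ y ∈ t, A x y = B x y) : MinorsIn D s t B := by
  intro n f g hf hg
  have : B.submatrix f g = A.submatrix f g := by
    ext i j
    exact (hAB _ (hf i) _ (hg j)).symm
  rw [this]
  exact h n f g hf hg

theorem MinorsIn.transpose {s : Set X} {t : Set Y} {A : Matrix X Y R} (h : MinorsIn D s t A) :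
    MinorsIn D t s Aᵀ := by
  intro n f g hf hg
  rw [← det_transpose]
  exact h n g f hg hf

theorem MinorsIn.entry {s : Set X} {t : Set Y} {A : Matrix X Y R} (h : MinorsIn D s t A)
    {x : X} (hx : x ∈ s) {y : Y} (hy : y ∈ t) : A x y ∈ D := by
  have := h 1 (fun _ => x) (fun _ => y) (fun _ => hx) (fun _ => hy)
  simpa using this

theorem MinorsIn.two {s : Set X} {t : Set Y} {A : Matrix X Y R} (h : MinorsIn D s t A)
    {x z : X} (hx : x ∈ s) (hz : z ∈ s) {y w : Y} (hy : y ∈ t) (hw : w ∈ t) :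
    A x y * A z w - A x w * A z y ∈ D := by
  have := h 2 ![x, z] ![y, w] (by simp [Fin.forall_fin_two, hx, hz])
    (by simp [Fin.forall_fin_two, hy, hw])
  rw [det_fin_two] at this
  simpa using this

theorem MinorsIn.scale (hD : IsUnitCarrier D) {s : Set X} {t : Set Y} {A : Matrix X Y R}
    (h : MinorsIn D s t A) {r : X → R} {c : Y → R} (hr : ∀ x, r x ∈ D) (hc : ∀ y, c y ∈ D) :
    MinorsIn D s t (fun x y => r x * A x y * c y) := by
  intro n f g hf hg
  have : (Matrix.submatrix (fun x y => r x * A x y * c y) f g) =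
      diagonal (fun i => r (f i)) * A.submatrix f g * diagonal (fun i => c (g i)) := by
    ext i j
    rw [mul_diagonal, diagonal_mul]
    rfl
  rw [this, det_mul, det_mul, det_diagonal, det_diagonal]
  exact hD.mul_mem (hD.mul_mem (hD.prod_mem _ fun i _ => hr _) (h n f g hf hg))
    (hD.prod_mem _ fun i _ => hc _)

/-- Minors are indexed by arbitrary maps instead of injections, which keeps `MinorsIn` stable under
composition; this lemma disposes of the repetitions. -/
theorem det_submatrix_eq_zero_of_not_injective {n : ℕ} (A : Matrix X Y R) (f : Fin n → X)
    (g : Fin n → Y) (h : ¬ (Function.Injective f ∧ Function.Injective g)) :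
    (A.submatrix f g).det = 0 := by
  rw [not_and_or] at h
  rcases h with h | h <;> rw [Function.Injective] at h <;> push Not at h <;>
    obtain ⟨i, j, hij, hne⟩ := h
  · exact det_zero_of_row_eq hne (by ext k; simp [hij])
  · exact det_zero_of_column_eq hne (by intro k; simp [hij])

/-- Adding a column with at most one nonzero entry. -/
theorem MinorsIn.insert_unit_column (hD : IsUnitCarrier D) {s : Set X} {t : Set Y}
    {A : Matrix X Y R} (h : MinorsIn D s t A) (x₀ : X) (y₀ : Y)
    (h₀ : ∀ x ∈ s, x ≠ x₀ → A x y₀ = 0) (h₁ : A x₀ y₀ ∈ D) :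
    MinorsIn D s (insert y₀ t) A := by
  intro n
  induction n with
  | zero => intro f g _ _; simpa using hD.one_mem
  | succ n ih =>
    intro f g hf hg
    by_cases hinj : Function.Injective f ∧ Function.Injective g
    swap
    · rw [det_submatrix_eq_zero_of_not_injective A f g hinj]
      exact hD.zero_mem
    by_cases hgt : ∀ i, g i ∈ t
    · exact h _ f g hf hgt
    push Not at hgt
    obtain ⟨j, hj⟩ := hgt
    have hj' : g j = y₀ := (hg j).resolve_right hj
    -- In the expansion along y₀ only the term of row x₀ can survive, and its cofactor is a smaller
    -- minor.
    rw [det_succ_column _ j]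
    by_cases hx : ∃ i, f i = x₀
    · obtain ⟨i, hi⟩ := hx
      rw [Finset.sum_eq_single i]
      · rw [mul_assoc]
        refine hD.neg_one_pow_mul_mem _ (hD.mul_mem ?_ ?_)
        · simpa [hj', hi] using h₁
        · exact ih (f ∘ i.succAbove) (g ∘ j.succAbove) (fun _ => hf _) (fun _ => hg _)
      · intro k _ hk
        have : f k ≠ x₀ := fun hk' => hk (hinj.1 (hk'.trans hi.symm))
        simp [hj', h₀ _ (hf k) this]
      · simp
    · push Not at hx
      rw [Finset.sum_eq_zero]
      · exact hD.zero_mem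
      · intro k _
        simp [hj', h₀ _ (hf k) (hx k)]

theorem MinorsIn.insert_unit_row (hD : IsUnitCarrier D) {s : Set X} {t : Set Y}
    {A : Matrix X Y R} (h : MinorsIn D s t A) (x₀ : X) (y₀ : Y)
    (h₀ : ∀ y ∈ t, y ≠ y₀ → A x₀ y = 0) (h₁ : A x₀ y₀ ∈ D) :
    MinorsIn D (insert x₀ s) t A :=
  (h.transpose.insert_unit_column hD y₀ x₀ h₀ h₁).transpose

/-- Subtracting multiples of row 0 clears column 0 below the corner without changing the
determinant. -/
theorem det_schur_complement {n : ℕ} (M : Matrix (Fin (n + 1)) (Fin (n + 1)) R) (c : R)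
    (hc : M 0 0 * c = 1) :
    det (Matrix.of fun i j : Fin n => M i.succ j.succ - M i.succ 0 * c * M 0 j.succ) =
      c * det M := by
  have h1 : det M = det (Matrix.of fun i j : Fin (n + 1) =>
      M i j + (if i = 0 then 0 else - M i 0 * c) * M 0 j) := by
    refine (det_eq_of_forall_row_eq_smul_add_const
      (fun i => if i = 0 then 0 else - M i 0 * c) 0 (by simp) ?_).symm
    intro i j
    simp
  rw [h1, det_succ_column_zero, Finset.sum_eq_single 0]
  · simp only [Fin.val_zero, pow_zero, of_apply, if_true, zero_mul, add_zero, one_mul]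
    rw [← mul_assoc, mul_comm c, hc, one_mul]
    congr 1
    ext i j
    simp
    ring
  · intro i _ hi
    have : M i 0 + (-M i 0 * c) * M 0 0 = 0 := by linear_combination -M i 0 * hc
    simp only [of_apply, hi, if_false, this, mul_zero, zero_mul]
  · simp

open Classical in
/-- Pivoting on the entry `A x y`, where `c` is its inverse. -/
noncomputable def pivot (A : Matrix X Y R) (x : X) (y : Y) (c : R) : Matrix X Y R :=
  Matrix.of fun i j =>
    if i = x then (if j = y then c else c * A x j)
    else (if j = y then -(A i y * c) else A i j - A i y * c * A x j)

theorem pivot_apply_of_ne (A : Matrix X Y R) {x i : X} {y j : Y} (c : R) (hi : i ≠ x)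
    (hj : j ≠ y) : pivot A x y c i j = A i j - A i y * c * A x j := by
  simp [pivot, hi, hj]

theorem pivot_apply_row (A : Matrix X Y R) {x : X} {y j : Y} (c : R)
    (hj : j ≠ y) : pivot A x y c x j = c * A x j := by
  simp [pivot, hj]

theorem pivot_apply_col (A : Matrix X Y R) {x i : X} {y : Y} (c : R)
    (hi : i ≠ x) : pivot A x y c i y = -(A i y * c) := by
  simp [pivot, hi]

theorem pivot_apply_self (A : Matrix X Y R) {x : X} {y : Y} (c : R) :
    pivot A x y c x y = c := by
  simp [pivot]

theorem pivot_map {K : Type*} [CommRing K] (π : R →+* K) (A : Matrix X Y R) (x : X) (y : Y)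
    (c : R) : (pivot A x y c).map π = pivot (A.map π) x y (π c) := by
  ext i j
  simp only [pivot, map_apply, of_apply]
  split_ifs <;> simp

/-- After the pivot the entry in position (x, y) is c, with inverse `A x y`; the second pivot undoes
the exchange of x and y. -/
theorem pivot_pivot (A : Matrix X Y R) (x : X) (y : Y) (c : R) (hc : A x y * c = 1) :
    pivot (pivot A x y c) x y (A x y) = A := by
  ext i j
  by_cases hi : i = x <;> by_cases hj : j = y
  · subst hi hj; simp [pivot_apply_self]
  · subst hi
    rw [pivot_apply_row _ _ hj, pivot_apply_row _ _ hj, ← mul_assoc, hc, one_mul]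
  · subst hj
    rw [pivot_apply_col _ _ hi, pivot_apply_col _ _ hi]
    linear_combination A i j * hc
  · rw [pivot_apply_of_ne _ _ hi hj, pivot_apply_of_ne _ _ hi hj, pivot_apply_col _ _ hi,
      pivot_apply_row _ _ hj]
    linear_combination A i y * c * A x j * hc

theorem MinorsIn.pivot (hD : IsUnitCarrier D) {s : Set X} {t : Set Y} {A : Matrix X Y R}
    (h : MinorsIn D s t A) {x : X} (hx : x ∈ s) {y : Y} (hy : y ∈ t) {c : R} (hcD : c ∈ D)
    (hc : A x y * c = 1) : MinorsIn D s t (pivot A x y c) := by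
  classical
  -- A is bordered by a unit column at x and by the negative of a unit row at y. Its minors are
  -- still in D, and those through (x, y) yield all minors of the pivoted matrix.
  let E : Matrix (Option X) (Option Y) R := Matrix.of fun i j =>
    match i, j with
    | some i, some j => A i j
    | some i, none => if i = x then 1 else 0
    | none, some j => if j = y then -1 else 0
    | none, none => 0
  have h1 : MinorsIn D (some '' s) (some '' t) E := by
    intro n f g hf hg
    choose f' hf' hff using hf
    choose g' hg' hgg using hg
    have : E.submatrix f g = A.submatrix f' g' := by
      ext i j
      simp [E, ← hff, ← hgg]
    rw [this]
    exact h n f' g' hf' hg'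
  have h2 : MinorsIn D (some '' s) (insert none (some '' t)) E := by
    refine h1.insert_unit_column hD (some x) none ?_ ?_
    · rintro _ ⟨i, _, rfl⟩ hi
      have : i ≠ x := fun h => hi (by rw [h])
      simp [E, this]
    · simpa [E] using hD.one_mem
  have h3 : MinorsIn D (insert none (some '' s)) (insert none (some '' t)) E := by
    refine h2.insert_unit_row hD none (some y) ?_ ?_
    · rintro _ (rfl | ⟨j, _, rfl⟩) hj
      · simp [E]
      · have : j ≠ y := fun h => hj (by rw [h])
        simp [E, this]
    · simpa [E] using hD.neg_mem hD.one_mem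
  intro n f g hf hg
  -- Row x and column y of the pivoted matrix come from the border: eliminating with (x, y) as
  -- corner turns row `none` into c times row x, and column `none` into the new column y.
  let ρ : X → Option X := fun i => if i = x then none else some i
  let κ : Y → Option Y := fun j => if j = y then none else some j
  let M := E.submatrix (Fin.cons (some x) (ρ ∘ f) : Fin (n + 1) → Option X)
    (Fin.cons (some y) (κ ∘ g) : Fin (n + 1) → Option Y)
  have key := det_schur_complement M c (by simpa [M, E] using hc)
  have hM : (Matrix.of fun i j : Fin n => M i.succ j.succ - M i.succ 0 * c * M 0 j.succ) =
      (_root_.pivot A x y c).submatrix f g := by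
    ext i j
    by_cases hi : f i = x <;> by_cases hj : g j = y <;>
      simp [M, E, ρ, κ, hi, hj, _root_.pivot]
  rw [← hM, key]
  refine hD.mul_mem hcD (h3 _ _ _ ?_ ?_)
  · intro i
    refine Fin.cases ?_ (fun i => ?_) i
    · exact Or.inr ⟨x, hx, rfl⟩
    · by_cases hi : f i = x
      · simp [ρ, hi]
      · simp [ρ, hi, hf i]
  · intro i
    refine Fin.cases ?_ (fun i => ?_) i
    · exact Or.inr ⟨y, hy, rfl⟩
    · by_cases hi : g i = y
      · simp [κ, hi]
      · simp [κ, hi, hg i]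

/-- A minor through a pivot element lies in `D` if the corresponding smaller minor of the pivoted
matrix does. -/
theorem det_mem_of_pivot (hD : IsUnitCarrier D) {n : ℕ} (A : Matrix X Y R)
    {f : Fin (n + 1) → X} {g : Fin (n + 1) → Y} (hf : Function.Injective f)
    (hg : Function.Injective g) (i j : Fin (n + 1)) {c : R} (hAD : A (f i) (g j) ∈ D)
    (hc : A (f i) (g j) * c = 1)
    (h : ((pivot A (f i) (g j) c).submatrix (f ∘ Equiv.swap 0 i ∘ Fin.succ)
      (g ∘ Equiv.swap 0 j ∘ Fin.succ)).det ∈ D) : (A.submatrix f g).det ∈ D := by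
  let M := (A.submatrix f g).submatrix (Equiv.swap 0 i) (Equiv.swap 0 j)
  have h1 : M.det ∈ D ↔ (A.submatrix f g).det ∈ D := by
    have : M = ((A.submatrix f g).submatrix (Equiv.swap 0 i) id).submatrix id (Equiv.swap 0 j) := by
      simp [M]
    rw [this, det_permute', det_permute, hD.sign_mul_mem_iff, hD.sign_mul_mem_iff]
  have h00 : M 0 0 = A (f i) (g j) := by simp [M]
  have key := det_schur_complement M c (by rw [h00, hc])
  have hM : (Matrix.of fun i j : Fin n => M i.succ j.succ - M i.succ 0 * c * M 0 j.succ) =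
      (pivot A (f i) (g j) c).submatrix (f ∘ Equiv.swap 0 i ∘ Fin.succ)
      (g ∘ Equiv.swap 0 j ∘ Fin.succ) := by
    ext k l
    have hk : f (Equiv.swap 0 i k.succ) ≠ f i := by
      intro hh
      have := hf hh
      rw [← Equiv.swap_apply_left 0 i] at this
      exact Fin.succ_ne_zero k ((Equiv.swap (0 : Fin (n + 1)) i).injective this)
    have hl : g (Equiv.swap 0 j l.succ) ≠ g j := by
      intro hh
      have := hg hh
      rw [← Equiv.swap_apply_left 0 j] at this
      exact Fin.succ_ne_zero l ((Equiv.swap (0 : Fin (n + 1)) j).injective this)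
    simp [M, pivot_apply_of_ne _ _ hk hl]
  rw [← h1]
  have hdet : M.det = A (f i) (g j) * (c * M.det) := by rw [← mul_assoc, hc, one_mul]
  rw [hdet, ← key, hM]
  exact hD.mul_mem hAD h

end Minors

/-! ### Connectivity -/

section Connectivity

variable {R : Type*} [CommRing R] {X Y : Type*} {D : Set R}

/-- The bipartite graph of the nonzero entries of `A` with rows in `s` and columns in `t` is
connected: a nonempty union of connected components is everything. -/
def ConnOn (A : Matrix X Y R) (s : Set X) (t : Set Y) : Prop :=
  ∀ S ⊆ s, ∀ T ⊆ t, (S.Nonempty ∨ T.Nonempty) →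
    (∀ x ∈ s, ∀ y ∈ t, A x y ≠ 0 → (x ∈ S ↔ y ∈ T)) → S = s ∧ T = t

theorem ConnOn.transpose {A : Matrix X Y R} {s : Set X} {t : Set Y} (h : ConnOn A s t) :
    ConnOn Aᵀ t s := fun T hT S hS hne hST =>
  (h S hS T hT hne.symm fun x hx y hy hxy => (hST y hy x hx hxy).symm).symm

theorem ConnOn.congr {R' : Type*} [CommRing R'] {A : Matrix X Y R} {B : Matrix X Y R'} {s : Set X}
    {t : Set Y} (h : ConnOn A s t) (hAB : ∀ x ∈ s, ∀ y ∈ t, A x y ≠ 0 → B x y ≠ 0) :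
    ConnOn B s t := fun S hS T hT hne hST =>
  h S hS T hT hne fun x hx y hy hxy => hST x hx y hy (hAB x hx y hy hxy)

/-- A union of components after the pivot is one before it: entries in row x and column y keep their
zero pattern, and an entry (i, j) elsewhere changes only if i, y, x, j was already a path. -/
theorem ConnOn.pivot {A : Matrix X Y R} {s : Set X} {t : Set Y} (h : ConnOn A s t)
    {x : X} (hx : x ∈ s) {y : Y} (hy : y ∈ t) {c : R} (hc : A x y * c = 1) [Nontrivial R] :
    ConnOn (pivot A x y c) s t := by
  have hA0 : A x y ≠ 0 := by rintro h0; simp [h0] at hc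
  have hc0 : c ≠ 0 := by rintro h0; simp [h0] at hc
  intro S hS T hT hne hST
  have hxy : x ∈ S ↔ y ∈ T := hST x hx y hy (by rwa [pivot_apply_self])
  have hrow : ∀ j ∈ t, A x j ≠ 0 → (x ∈ S ↔ j ∈ T) := by
    intro j hj hAj
    by_cases hjy : j = y
    · rwa [hjy]
    refine hST x hx j hj ?_
    rw [pivot_apply_row _ _ hjy]
    intro h0
    apply hAj
    have : A x y * (c * A x j) = A x j := by rw [← mul_assoc, hc, one_mul]
    rw [← this, h0, mul_zero]
  have hcol : ∀ i ∈ s, A i y ≠ 0 → (i ∈ S ↔ y ∈ T) := by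
    intro i hi hAi
    by_cases hix : i = x
    · rwa [hix]
    refine hST i hi y hy ?_
    rw [pivot_apply_col _ _ hix]
    intro h0
    apply hAi
    have : A i y = -(-(A i y * c) * A x y) := by linear_combination -A i y * hc
    rw [this, h0, zero_mul, neg_zero]
  refine h S hS T hT hne fun i hi j hj hij => ?_
  by_cases hix : i = x
  · subst hix
    exact hrow j hj hij
  by_cases hjy : j = y
  · subst hjy
    exact hcol i hi hij
  by_cases h0 : A i y ≠ 0 ∧ A x j ≠ 0
  · rw [hcol i hi h0.1, ← hxy, hrow j hj h0.2]
  · refine hST i hi j hj ?_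
    rw [pivot_apply_of_ne _ _ hix hjy]
    rw [not_and_or, not_not, not_not] at h0
    rcases h0 with h0 | h0 <;> simpa [h0] using hij

/-- There is a chain of `n + 1` rows in `s` from `x` to `z`, any two consecutive ones of which share
a nonzero column in `t`. -/
inductive Linked (A : Matrix X Y R) (s : Set X) (t : Set Y) : ℕ → X → X → Prop
  | refl (x : X) : x ∈ s → Linked A s t 0 x x
  | step {n : ℕ} {x p z : X} {y : Y} : x ∈ s → y ∈ t → A x y ≠ 0 → A p y ≠ 0 →
      Linked A s t n p z → Linked A s t (n + 1) x z

theorem Linked.left_mem {A : Matrix X Y R} {s : Set X} {t : Set Y} {n : ℕ} {x z : X}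
    (h : Linked A s t n x z) : x ∈ s := by
  cases h <;> assumption

theorem Linked.right_mem {A : Matrix X Y R} {s : Set X} {t : Set Y} {n : ℕ} {x z : X}
    (h : Linked A s t n x z) : z ∈ s := by
  induction h <;> assumption

theorem Linked.eq {A : Matrix X Y R} {s : Set X} {t : Set Y} {x z : X}
    (h : Linked A s t 0 x z) : x = z := by
  cases h; rfl

theorem Linked.exists_step {A : Matrix X Y R} {s : Set X} {t : Set Y} {n : ℕ} {x z : X}
    (h : Linked A s t (n + 1) x z) :
    ∃ p, ∃ y ∈ t, A x y ≠ 0 ∧ A p y ≠ 0 ∧ Linked A s t n p z := by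
  cases h with
  | step _ hy hxy hpy hp => exact ⟨_, _, hy, hxy, hpy, hp⟩

theorem ConnOn.exists_linked {A : Matrix X Y R} {s : Set X} {t : Set Y} (h : ConnOn A s t)
    {x z : X} (hx : x ∈ s) (hz : z ∈ s) : ∃ n, Linked A s t n x z := by
  let S : Set X := {x | ∃ n, Linked A s t n x z}
  let T : Set Y := {y ∈ t | ∃ x ∈ S, A x y ≠ 0}
  have := (h S (fun x ⟨n, hn⟩ => hn.left_mem) T (fun y hy => hy.1) (Or.inl ⟨z, 0, .refl z hz⟩)
    fun i hi j hj hij => ⟨fun hiS => ⟨hj, i, hiS, hij⟩,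
      fun ⟨_, p, ⟨n, hn⟩, hpj⟩ => ⟨n + 1, .step hi hj hij hpj hn⟩⟩).1
  rw [← this] at hx
  exact hx

/-- Rows that vanish in the pivot column are left unchanged by the pivot. -/
theorem Linked.pivot_of_avoids {A : Matrix X Y R} {s : Set X} {t : Set Y} {n : ℕ} {p z x₁ : X}
    {y₁ : Y} (c : R) (hxy : A x₁ y₁ ≠ 0) (h : Linked A s t n p z)
    (hav : ∀ m ≤ n, ∀ q, Linked A s t m q z → A q y₁ = 0) :
    Linked (pivot A x₁ y₁ c) s t n p z := by
  induction h with
  | refl x hx => exact .refl x hx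
  | @step n x p z y hx hy hxy' hpy hp ih =>
    have h1 := hav _ le_rfl _ (Linked.step hx hy hxy' hpy hp)
    have h2 := hav n n.le_succ p hp
    have hx1 : x ≠ x₁ := by rintro rfl; exact hxy h1
    have hp1 : p ≠ x₁ := by rintro rfl; exact hxy h2
    have hy1 : y ≠ y₁ := by rintro rfl; exact hxy' h1
    refine .step hx hy (y := y) ?_ ?_ (ih fun m hm => hav m (hm.trans n.le_succ))
    · rwa [pivot_apply_of_ne _ _ hx1 hy1, h1, zero_mul, zero_mul, sub_zero]
    · rwa [pivot_apply_of_ne _ _ hp1 hy1, h2, zero_mul, zero_mul, sub_zero]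

/-- Pivoting on the first step shortens a shortest chain. -/
theorem Linked.shorten {A : Matrix X Y R} (hD : IsUnitCarrier D) {s : Set X} {t : Set Y}
    (hA : ∀ x ∈ s, ∀ y ∈ t, A x y ∈ D)
    {n : ℕ} {x z : X} (h : Linked A s t (n + 2) x z)
    (hmin : ∀ m < n + 2, ¬ Linked A s t m x z) :
    ∃ x₁ ∈ s, ∃ y₁ ∈ t, A x y₁ ≠ 0 ∧ A x₁ y₁ ≠ 0 ∧ Linked A s t (n + 1) x₁ z ∧
      ∀ c ∈ D, A x₁ y₁ * c = 1 → Linked (pivot A x₁ y₁ c) s t (n + 1) x z := by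
  have hx := h.left_mem
  obtain ⟨x₁, y₁, hy, hxy, hpy, hp⟩ := h.exists_step
  refine ⟨x₁, hp.left_mem, y₁, hy, hxy, hpy, hp, fun c hcD hc => ?_⟩
  have hx₁s := hp.left_mem
  obtain ⟨x₂, y₂, hy₂, hxy₂, hpy₂, hp₂⟩ := hp.exists_step
  have hav : ∀ m ≤ n, ∀ q, Linked A s t m q z → A q y₁ = 0 := by
    intro m hm q hq
    by_contra h0
    exact hmin (m + 1) (by omega) (.step hx hy hxy h0 hq)
  have h2 : A x₂ y₁ = 0 := hav n le_rfl _ hp₂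
  have hxx₁ : x ≠ x₁ := by
    rintro rfl
    exact hmin (n + 1) (by omega) (.step hx hy₂ hxy₂ hpy₂ hp₂)
  have hxy2 : A x y₂ = 0 := by
    by_contra h0
    exact hmin (n + 1) (by omega) (.step hx hy₂ h0 hpy₂ hp₂)
  have hyy : y₂ ≠ y₁ := by
    rintro rfl
    exact hxy hxy2
  have hx₂ : x₂ ≠ x₁ := by
    rintro rfl
    exact hpy h2
  have hc0 : c ≠ 0 := by
    rintro rfl
    refine hpy ?_
    rw [mul_zero] at hc
    rw [← mul_one (A x₁ y₁), ← hc, mul_zero]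
  -- The pivot creates the entry -A x y₁ · c · A x₁ y₂ ≠ 0 at (x, y₂), so x now meets x₂ directly.
  -- By minimality the rows from x₂ onwards vanish in column y₁ and are unaffected.
  refine .step hx hy₂ (p := x₂) ?_ ?_ (hp₂.pivot_of_avoids c hpy hav)
  · rw [pivot_apply_of_ne _ _ hxx₁ hyy, hxy2, zero_sub, neg_ne_zero]
    exact hD.mul_ne_zero (hD.mul_mem (hA _ hx _ hy) hcD) (hD.mul_ne_zero (hA _ hx _ hy) hxy hc0)
      hxy₂
  · rwa [pivot_apply_of_ne _ _ hx₂ hyy, h2, zero_mul, zero_mul, sub_zero]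

end Connectivity

/-! ### Lifts -/

section Lifts

variable {R K : Type*} [CommRing R] [CommRing K]
  {X Y : Type*} {D : Set R} {P : Set K}
  {π : R →+* K}

/-- The nonzero fundamental elements. -/
def Fundamental (D : Set R) (p : R) : Prop := p ∈ D ∧ p ≠ 0 ∧ 1 - p ∈ D

/-- The products of the entries around a shortest path, normalised. -/
def ShortProduct (D : Set R) (p : R) : Prop :=
  Fundamental D p ∨ Fundamental D (-p) ∨
    ∃ a b, Fundamental D a ∧ Fundamental D b ∧ a * b - a + 1 ∈ D ∧ p = a * b

/-- The properties of the homomorphism `π` that make it possible to lift matrices. -/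
structure IsLifting (D : Set R) (P : Set K) (π : R →+* K) : Prop where
  source : IsUnitCarrier D
  target : IsUnitCarrier P
  map_mem : ∀ {x}, x ∈ D → π x ∈ P
  ker : ∀ {x}, x ∈ D → π x = 0 → x = 0
  surj : ∀ p ∈ P, ∃ x ∈ D, π x = p
  fundamental_inj : ∀ {p q}, Fundamental D p → Fundamental D q → π p = π q → p = q
  fundamental_surj : ∀ {p}, Fundamental P p → ∃ q, Fundamental D q ∧ π q = p
  short_sub : ∀ {p q}, ShortProduct D p → ShortProduct D q → π (q - p) ∈ P → q - p ∈ D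

theorem IsLifting.map_ne_zero_iff (h : IsLifting D P π) {x : R} (hx : x ∈ D) :
    π x ≠ 0 ↔ x ≠ 0 :=
  ⟨fun h0 hx0 => h0 (by rw [hx0, map_zero]), fun h0 hx0 => h0 (h.ker hx hx0)⟩

/-- Two lifts agreeing on the columns `t` are proportional in another column. -/
theorem IsLifting.column_proportional [Nontrivial R] (hL : IsLifting D P π) {s : Set X} {t : Set Y} {u : Y}
    (hu : u ∉ t) (n : ℕ) :
    ∀ (B B' : Matrix X Y R) (x z : X), MinorsIn D s (insert u t) B →
      MinorsIn D s (insert u t) B' → (∀ x ∈ s, ∀ y ∈ t, B x y = B' x y) →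
      (∀ x ∈ s, π (B x u) = π (B' x u)) → Linked B s t n x z → B x u ≠ 0 → B z u ≠ 0 →
      B' x u * B z u = B x u * B' z u := by
  have hD := hL.source
  induction n using Nat.strong_induction_on with
  | _ n ih =>
  intro B B' x z hB hB' hBB hπ hlink hxu hzu
  by_cases hmin : ∃ m < n, Linked B s t m x z
  · obtain ⟨m, hm, hlink'⟩ := hmin
    exact ih m hm B B' x z hB hB' hBB hπ hlink' hxu hzu
  push Not at hmin
  have hxs := hlink.left_mem
  have hzs := hlink.right_mem
  have hut : u ∈ insert u t := Set.mem_insert _ _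
  have htt : ∀ y ∈ t, y ∈ insert u t := fun y hy => Set.mem_insert_of_mem _ hy
  have hne : ∀ x ∈ s, B' x u = 0 ↔ B x u = 0 := fun x hx => by
    rw [← not_iff_not, ← ne_eq, ← ne_eq, ← hL.map_ne_zero_iff (hB.entry hx hut),
      ← hL.map_ne_zero_iff (hB'.entry hx hut), hπ x hx]
  match n, ih, hlink, hmin with
  | 0, _, hlink, _ =>
    rw [hlink.eq]
    ring
  | 1, _, hlink, _ =>
    obtain ⟨p, y, hy, hxy, hpy, hp⟩ := hlink.exists_step
    obtain rfl := hp.eq.symm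
    obtain ⟨a, haD, ha⟩ := hD.exists_inv (hB.entry hxs (htt y hy)) hxy
    obtain ⟨b, hbD, hb⟩ := hD.exists_inv (hB.entry hzs hut) hzu
    have hzu' := mt (hne z hzs).1 hzu
    obtain ⟨b', hbD', hb'⟩ := hD.exists_inv (hB'.entry hzs hut) hzu'
    have hb0 : b ≠ 0 := by rintro rfl; simp at hb
    have hb0' : b' ≠ 0 := by rintro rfl; simp at hb'
    have ha0 : a ≠ 0 := by rintro rfl; simp at ha
    have hxyD := hB.entry hxs (htt y hy)
    have hzyD := hB.entry hzs (htt y hy)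
    have hxuD := hB.entry hxs hut
    have hxuD' := hB'.entry hxs hut
    -- This is the cross ratio of the 2 × 2 block in columns y, u; 1 minus it is the minor divided
    -- by the product of the diagonal entries.
    have h1 : Fundamental D (B x u * (B z y * (a * b))) := by
      refine ⟨hD.mul_mem hxuD (hD.mul_mem hzyD (hD.mul_mem haD hbD)),
        hD.mul_ne_zero hxuD hxu (hD.mul_ne_zero hzyD hpy (hD.mul_ne_zero haD ha0 hb0)), ?_⟩
      have h2 := hB.two hxs hzs (htt y hy) hut
      have : 1 - B x u * (B z y * (a * b)) = (a * b) * (B x y * B z u - B x u * B z y) := by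
        linear_combination -ha - a * B x y * hb
      rw [this]
      exact hD.mul_mem (hD.mul_mem haD hbD) h2
    have h1' : Fundamental D (B' x u * (B z y * (a * b'))) := by
      refine ⟨hD.mul_mem hxuD' (hD.mul_mem hzyD (hD.mul_mem haD hbD')),
        hD.mul_ne_zero hxuD' (mt (hne x hxs).1 hxu)
          (hD.mul_ne_zero hzyD hpy (hD.mul_ne_zero haD ha0 hb0')), ?_⟩
      have h2 := hB'.two hxs hzs (htt y hy) hut
      rw [← hBB x hxs y hy, ← hBB z hzs y hy] at h2
      have : 1 - B' x u * (B z y * (a * b')) = (a * b') * (B x y * B' z u - B' x u * B z y) := by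
        linear_combination -ha - a * B x y * hb'
      rw [this]
      exact hD.mul_mem (hD.mul_mem haD hbD') h2
    have hbb : π b = π b' := by
      have e1 : π (B z u) * π b = 1 := by rw [← map_mul, hb, map_one]
      have e2 : π (B z u) * π b' = 1 := by rw [hπ z hzs, ← map_mul, hb', map_one]
      linear_combination π b' * e1 - π b * e2
    -- Both cross ratios have the same image under π, hence they coincide.
    have h3 := hL.fundamental_inj h1 h1' (by simp only [map_mul, hbb, hπ x hxs])
    obtain ⟨d, hdD, hd⟩ := hD.exists_inv hzyD hpy
    have h4 : B x u * b = B' x u * b' := by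
      linear_combination (d * B x y) * h3 - (hd + d * B z y * ha) * (B x u * b - B' x u * b')
    linear_combination (- B z u * B' z u) * h4 + B x u * B' z u * hb - B' x u * B z u * hb'
  | n + 2, ih, hlink, hmin =>
    obtain ⟨x₁, hx₁, y₁, hy₁, hxy, hxy₁, hlink₁, hpiv⟩ :=
      hlink.shorten hD (fun x hx y hy => hB.entry hx (htt y hy)) (fun m hm => hmin m hm)
    -- If x₁ vanishes in column u, pivoting on (x₁, y₁) keeps that column and shortens the chain.
    -- Otherwise the proportionalities from x to x₁ and from x₁ to z compose.
    by_cases hx₁u : B x₁ u = 0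
    · obtain ⟨c, hcD, hc⟩ := hD.exists_inv (hB.entry hx₁ (htt _ hy₁)) hxy₁
      have hc' : B' x₁ y₁ * c = 1 := by rw [← hBB x₁ hx₁ y₁ hy₁, hc]
      have hx₁u' := (hne x₁ hx₁).2 hx₁u
      have huy : u ≠ y₁ := by rintro rfl; exact hu hy₁
      have hxx : x ≠ x₁ := by rintro rfl; exact hxu hx₁u
      have hzx : z ≠ x₁ := by rintro rfl; exact hzu hx₁u
      have key : ∀ x ∈ s, pivot B x₁ y₁ c x u = B x u := by
        intro x _
        by_cases hx : x = x₁
        · rw [hx, pivot_apply_row _ _ huy, hx₁u, mul_zero]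
        · rw [pivot_apply_of_ne _ _ hx huy, hx₁u, mul_zero, sub_zero]
      have key' : ∀ x ∈ s, pivot B' x₁ y₁ c x u = B' x u := by
        intro x _
        by_cases hx : x = x₁
        · rw [hx, pivot_apply_row _ _ huy, hx₁u', mul_zero]
        · rw [pivot_apply_of_ne _ _ hx huy, hx₁u', mul_zero, sub_zero]
      have := ih (n + 1) (by omega) (pivot B x₁ y₁ c) (pivot B' x₁ y₁ c) x z
        (hB.pivot hD hx₁ (htt _ hy₁) hcD hc) (hB'.pivot hD hx₁ (htt _ hy₁) hcD hc') ?_ ?_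
        (hpiv c hcD hc) ?_ ?_
      · rwa [key x hxs, key z hzs, key' x hxs, key' z hzs] at this
      · intro i hi j hj
        simp only [pivot, of_apply, hBB i hi j hj, hBB i hi y₁ hy₁, hBB x₁ hx₁ j hj]
      · intro i hi
        rw [key i hi, key' i hi, hπ i hi]
      · rwa [key x hxs]
      · rwa [key z hzs]
    · have h1 := ih 1 (by omega) B B' x x₁ hB hB' hBB hπ
        (.step hxs hy₁ hxy hxy₁ (.refl x₁ hx₁)) hxu hx₁u
      have h2 := ih (n + 1) (by omega) B B' x₁ z hB hB' hBB hπ hlink₁ hx₁u hzu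
      obtain ⟨c, hcD, hc⟩ := hD.exists_inv (hB.entry hx₁ hut) hx₁u
      linear_combination c * B z u * h1 + c * B x u * h2
        - (B' x u * B z u - B x u * B' z u) * hc

end Lifts

/-! ### Gluing lifts that share all columns but one. -/

section Lifts

variable {R K : Type*} [CommRing R] [CommRing K]
  {X Y : Type*} {D : Set R} {P : Set K}
  {π : R →+* K}

theorem IsLifting.det_mem_of_short (hL : IsLifting D P π) [Nontrivial R] [Nontrivial K]
    {k m p q : R} (hk : k ∈ D) (hk0 : k ≠ 0)
    (hp : ShortProduct D p) (hq : ShortProduct D q) (h : q - p = k * m) (hm : π m ∈ P) : m ∈ D := by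
  rw [← hL.source.mul_mem_iff hk hk0, ← h]
  refine hL.short_sub hp hq ?_
  rw [h, map_mul]
  exact hL.target.mul_mem (hL.map_mem hk) hm

/-- The product is the cross ratio of the block with rows (a, u₀) and (b, u₂), with b' and u₀' the
inverses of b and u₀. -/
theorem shortProduct_of_link_one [Nontrivial R] (hD : IsUnitCarrier D) {a b u₀ u₂ b' u₀' : R}
    (ha : a ∈ D) (ha0 : a ≠ 0) (hb' : b' ∈ D) (hb : b * b' = 1)
    (hu₂ : u₂ ∈ D) (hu₂0 : u₂ ≠ 0) (hu' : u₀' ∈ D) (hu : u₀ * u₀' = 1)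
    (hdet : a * u₂ - u₀ * b ∈ D) : ShortProduct D (a * u₂ * (b' * u₀')) := by
  have hb0 : b' ≠ 0 := by rintro rfl; simp at hb
  have hu0 : u₀' ≠ 0 := by rintro rfl; simp at hu
  refine Or.inl ⟨hD.mul_mem (hD.mul_mem ha hu₂) (hD.mul_mem hb' hu'),
    hD.mul_ne_zero (hD.mul_mem ha hu₂) (hD.mul_ne_zero ha ha0 hu₂0) (hD.mul_ne_zero hb' hb0 hu0), ?_⟩
  have : 1 - a * u₂ * (b' * u₀') = -(b' * u₀' * (a * u₂ - u₀ * b)) := by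
    linear_combination -hb - b * b' * hu
  rw [this]
  exact hD.neg_mem (hD.mul_mem (hD.mul_mem hb' hu') hdet)

/-- The rows in question are (a, 0, u₀), (b, c, u₁), (0, d, u₂). If u₁ ≠ 0, the product factors into
the cross ratios α = a u₁ / (b u₀) and β = c u₂ / (d u₁), and the 3 × 3 determinant divided by b d
u₀ is α β - α + 1. If u₁ = 0, that quotient is 1 plus the product. This accounts for the shape of
`ShortProduct`. -/
theorem shortProduct_of_link_two [Nontrivial R] (hD : IsUnitCarrier D)
    {a b c d u₀ u₁ u₂ b' d' u₀' : R}
    (ha : a ∈ D) (ha0 : a ≠ 0) (hb' : b' ∈ D) (hb : b * b' = 1)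
    (hc : c ∈ D) (hc0 : c ≠ 0) (hd' : d' ∈ D) (hd : d * d' = 1)
    (hu₂ : u₂ ∈ D) (hu₂0 : u₂ ≠ 0) (hu' : u₀' ∈ D) (hu : u₀ * u₀' = 1) (hu₁ : u₁ ∈ D)
    (h01 : a * u₁ - u₀ * b ∈ D) (h12 : c * u₂ - u₁ * d ∈ D)
    (hdet : a * (c * u₂ - u₁ * d) + u₀ * (b * d) ∈ D) :
    ShortProduct D (a * c * u₂ * (b' * d' * u₀')) := by
  have hb0 : b' ≠ 0 := by rintro rfl; simp at hb
  have hu0 : u₀' ≠ 0 := by rintro rfl; simp at hu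
  have hd0 : d' ≠ 0 := by rintro rfl; simp at hd
  have hbdu : b' * d' * u₀' ∈ D := hD.mul_mem (hD.mul_mem hb' hd') hu'
  have hbdu0 : b' * d' * u₀' ≠ 0 :=
    hD.mul_ne_zero (hD.mul_mem hb' hd') (hD.mul_ne_zero hb' hb0 hd0) hu0
  have hacu : a * c * u₂ ∈ D := hD.mul_mem (hD.mul_mem ha hc) hu₂
  have hacu0 : a * c * u₂ ≠ 0 := hD.mul_ne_zero (hD.mul_mem ha hc) (hD.mul_ne_zero ha ha0 hc0) hu₂0
  by_cases hu₁0 : u₁ = 0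
  · subst hu₁0
    refine Or.inr (Or.inl ⟨hD.neg_mem (hD.mul_mem hacu hbdu),
      neg_ne_zero.2 (hD.mul_ne_zero hacu hacu0 hbdu0), ?_⟩)
    have : 1 - -(a * c * u₂ * (b' * d' * u₀')) =
        (b' * d' * u₀') * (a * (c * u₂ - 0 * d) + u₀ * (b * d)) := by
      linear_combination -hb * d * d' * u₀ * u₀' - hd * u₀ * u₀' - hu
    rw [this]
    exact hD.mul_mem hbdu hdet
  · obtain ⟨u₁', hu₁', hu₁1⟩ := hD.exists_inv hu₁ hu₁0
    have hu₁0' : u₁' ≠ 0 := by rintro rfl; simp at hu₁1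
    refine Or.inr (Or.inr ⟨a * u₁ * (b' * u₀'), c * u₂ * (d' * u₁'),
      ⟨hD.mul_mem (hD.mul_mem ha hu₁) (hD.mul_mem hb' hu'),
        hD.mul_ne_zero (hD.mul_mem ha hu₁) (hD.mul_ne_zero ha ha0 hu₁0)
          (hD.mul_ne_zero hb' hb0 hu0), ?_⟩,
      ⟨hD.mul_mem (hD.mul_mem hc hu₂) (hD.mul_mem hd' hu₁'),
        hD.mul_ne_zero (hD.mul_mem hc hu₂) (hD.mul_ne_zero hc hc0 hu₂0)
          (hD.mul_ne_zero hd' hd0 hu₁0'), ?_⟩, ?_, ?_⟩)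
    · have : 1 - a * u₁ * (b' * u₀') = -(b' * u₀' * (a * u₁ - u₀ * b)) := by
        linear_combination -hb - b * b' * hu
      rw [this]
      exact hD.neg_mem (hD.mul_mem (hD.mul_mem hb' hu') h01)
    · have : 1 - c * u₂ * (d' * u₁') = -(d' * u₁' * (c * u₂ - u₁ * d)) := by
        linear_combination -hd - d * d' * hu₁1
      rw [this]
      exact hD.neg_mem (hD.mul_mem (hD.mul_mem hd' hu₁') h12)
    · have : a * u₁ * (b' * u₀') * (c * u₂ * (d' * u₁')) - a * u₁ * (b' * u₀') + 1 =
          (b' * d' * u₀') * (a * (c * u₂ - u₁ * d) + u₀ * (b * d)) := by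
        linear_combination a * b' * u₀' * c * u₂ * d' * hu₁1 + a * u₁ * b' * u₀' * hd
          - hb * d * d' * u₀ * u₀' - hd * u₀ * u₀' - hu
      rw [this]
      exact hD.mul_mem hbdu hdet
    · linear_combination -a * b' * u₀' * c * u₂ * d' * hu₁1

theorem IsUnitCarrier.two_mem_of_eq_zero (hD : IsUnitCarrier D) {a b c d : R} (ha : a ∈ D)
    (hb : b ∈ D) (hc : c ∈ D) (hd : d ∈ D) (h : a = 0 ∨ b = 0 ∨ c = 0 ∨ d = 0) :
    a * d - b * c ∈ D := by
  rcases h with rfl | rfl | rfl | rfl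
  · simpa using hD.neg_mem (hD.mul_mem hb hc)
  · simpa using hD.mul_mem ha hd
  · simpa using hD.mul_mem ha hd
  · simpa using hD.neg_mem (hD.mul_mem hb hc)

theorem MinorsIn.three {s : Set X} {t : Set Y} {A : Matrix X Y R} (h : MinorsIn D s t A)
    {x y z : X} (hx : x ∈ s) (hy : y ∈ s) (hz : z ∈ s) {i j k : Y} (hi : i ∈ t) (hj : j ∈ t)
    (hk : k ∈ t) : A x i * A y j * A z k - A x i * A y k * A z j - A x j * A y i * A z k
      + A x j * A y k * A z i + A x k * A y i * A z j - A x k * A y j * A z i ∈ D := by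
  have := h 3 ![x, y, z] ![i, j, k] (by simp [Fin.forall_fin_succ, hx, hy, hz])
    (by simp [Fin.forall_fin_succ, hi, hj, hk])
  rw [det_fin_three] at this
  simpa using this

/-- A shortest chain of one or two steps yields short products p from column u and q from column v,
and q - p is a unit times the minor, so `short_sub` applies. Longer chains are shortened by pivots
that leave the minor unchanged. -/
theorem IsLifting.two_by_two_mem (hL : IsLifting D P π) [Nontrivial R] [Nontrivial K]
    {s : Set X} {t : Set Y} {u v : Y} (hu : u ∉ t) (hv : v ∉ t) (n : ℕ) :
    ∀ (B : Matrix X Y R) (x z : X), MinorsIn D s (insert u t) B → MinorsIn D s (insert v t) B →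
      MinorsIn P s (insert u (insert v t)) (B.map π) → Linked B s t n x z →
      B x u * B z v - B x v * B z u ∈ D := by
  have hD := hL.source
  induction n using Nat.strong_induction_on with
  | _ n ih =>
  intro B x z hBu hBv hP hlink
  by_cases hmin : ∃ m < n, Linked B s t m x z
  · obtain ⟨m, hm, hlink'⟩ := hmin
    exact ih m hm B x z hBu hBv hP hlink'
  push Not at hmin
  have hxs := hlink.left_mem
  have hzs := hlink.right_mem
  have hut : u ∈ insert u t := Set.mem_insert _ _
  have hvt : v ∈ insert v t := Set.mem_insert _ _
  have htu : ∀ y, y ∈ t → y ∈ insert u t := fun y hy => Set.mem_insert_of_mem _ hy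
  have htv : ∀ y, y ∈ t → y ∈ insert v t := fun y hy => Set.mem_insert_of_mem _ hy
  have hxu := hBu.entry hxs hut
  have hxv := hBv.entry hxs hvt
  have hzu := hBu.entry hzs hut
  have hzv := hBv.entry hzs hvt
  by_cases h0 : B x u = 0 ∨ B x v = 0 ∨ B z u = 0 ∨ B z v = 0
  · exact hD.two_mem_of_eq_zero hxu hxv hzu hzv h0
  push Not at h0
  obtain ⟨hxu0, hxv0, hzu0, hzv0⟩ := h0
  have hπm : π (B x u * B z v - B x v * B z u) ∈ P := by
    have := hP.two hxs hzs (Set.mem_insert u _) (Set.mem_insert_of_mem u (Set.mem_insert v t))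
    simpa using this
  obtain ⟨u', hu', hu1⟩ := hD.exists_inv hxu hxu0
  obtain ⟨v', hv', hv1⟩ := hD.exists_inv hxv hxv0
  have hu0 : u' ≠ 0 := by rintro rfl; simp at hu1
  have hv0 : v' ≠ 0 := by rintro rfl; simp at hv1
  match n, ih, hlink, hmin with
  | 0, _, hlink, _ =>
    rw [hlink.eq, mul_comm, sub_self]
    exact hD.zero_mem
  | 1, _, hlink, _ =>
    obtain ⟨p, y, hy, hxy, hpy, hp⟩ := hlink.exists_step
    obtain rfl := hp.eq.symm
    obtain ⟨b', hb', hb⟩ := hD.exists_inv (hBu.entry hzs (htu y hy)) hpy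
    have hb0 : b' ≠ 0 := by rintro rfl; simp at hb
    have hxyD := hBu.entry hxs (htu y hy)
    have h1 := shortProduct_of_link_one hD hxyD hxy hb' hb hzu hzu0 hu' hu1
      (hBu.two hxs hzs (htu y hy) hut)
    have h2 := shortProduct_of_link_one hD hxyD hxy hb' hb hzv hzv0 hv' hv1
      (hBv.two hxs hzs (htv y hy) hvt)
    refine hL.det_mem_of_short (k := B x y * (b' * (u' * v'))) ?_ ?_ h1 h2 ?_ hπm
    · exact hD.mul_mem hxyD (hD.mul_mem hb' (hD.mul_mem hu' hv'))
    · exact hD.mul_ne_zero hxyD hxy (hD.mul_ne_zero hb' hb0 (hD.mul_ne_zero hu' hu0 hv0))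
    · linear_combination B x y * b' * (u' * B z u * hv1 - v' * B z v * hu1)
  | 2, _, hlink, hmin =>
    obtain ⟨x₁, y₁, hy₁, hxy₁, hx₁y₁, hlink₁⟩ := hlink.exists_step
    have hx₁ := hlink₁.left_mem
    obtain ⟨p, y₂, hy₂, hx₁y₂, hzy₂, hp⟩ := hlink₁.exists_step
    obtain rfl := hp.eq.symm
    have hxy₂ : B x y₂ = 0 := by
      by_contra h0
      exact hmin 1 (by omega) (.step hxs hy₂ h0 hzy₂ (.refl z hzs))
    have hzy₁ : B z y₁ = 0 := by
      by_contra h0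
      exact hmin 1 (by omega) (.step hxs hy₁ hxy₁ h0 (.refl z hzs))
    have ha := hBu.entry hxs (htu _ hy₁)
    have hc := hBu.entry hx₁ (htu _ hy₂)
    obtain ⟨b', hb', hb⟩ := hD.exists_inv (hBu.entry hx₁ (htu _ hy₁)) hx₁y₁
    obtain ⟨d', hd', hd⟩ := hD.exists_inv (hBu.entry hzs (htu _ hy₂)) hzy₂
    have hb0 : b' ≠ 0 := by rintro rfl; simp at hb
    have hd0 : d' ≠ 0 := by rintro rfl; simp at hd
    have h1 := shortProduct_of_link_two hD ha hxy₁ hb' hb hc hx₁y₂ hd' hd hzu hzu0 hu' hu1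
      (hBu.entry hx₁ hut) (hBu.two hxs hx₁ (htu _ hy₁) hut) (hBu.two hx₁ hzs (htu _ hy₂) hut) (by
        have := hBu.three hxs hx₁ hzs (htu _ hy₁) (htu _ hy₂) hut
        rw [hxy₂, hzy₁] at this
        convert this using 1
        ring)
    have h2 := shortProduct_of_link_two hD ha hxy₁ hb' hb hc hx₁y₂ hd' hd hzv hzv0 hv' hv1
      (hBv.entry hx₁ hvt) (hBv.two hxs hx₁ (htv _ hy₁) hvt) (hBv.two hx₁ hzs (htv _ hy₂) hvt) (by
        have := hBv.three hxs hx₁ hzs (htv _ hy₁) (htv _ hy₂) hvt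
        rw [hxy₂, hzy₁] at this
        convert this using 1
        ring)
    refine hL.det_mem_of_short (k := B x y₁ * (B x₁ y₂ * (b' * (d' * (u' * v'))))) ?_ ?_ h1 h2 ?_ hπm
    · exact hD.mul_mem ha (hD.mul_mem hc (hD.mul_mem hb' (hD.mul_mem hd' (hD.mul_mem hu' hv'))))
    · exact hD.mul_ne_zero ha hxy₁ (hD.mul_ne_zero hc hx₁y₂ (hD.mul_ne_zero hb' hb0
        (hD.mul_ne_zero hd' hd0 (hD.mul_ne_zero hu' hu0 hv0))))
    · linear_combination B x y₁ * B x₁ y₂ * b' * d' * (u' * B z u * hv1 - v' * B z v * hu1)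
  | n + 3, ih, hlink, hmin =>
    obtain ⟨x₁, y₁, hy₁, hxy₁, hx₁y₁, hlink₁⟩ := hlink.exists_step
    have hx₁ := hlink₁.left_mem
    have hmin₁ : ∀ m < n + 2, ¬ Linked B s t m x₁ z := fun m hm hl =>
      hmin (m + 1) (by omega) (.step hxs hy₁ hxy₁ hx₁y₁ hl)
    -- The pivot is on the second step of the chain: as its length is at least 3, both x and z
    -- vanish in column y₂, so their rows, and with them the minor, survive.
    obtain ⟨x₂, hx₂, y₂, hy₂, hx₁y₂, hx₂y₂, hlink₂, hpiv⟩ :=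
      hlink₁.shorten hD (fun x hx y hy => hBu.entry hx (htu y hy)) hmin₁
    have hxy₂ : B x y₂ = 0 := by
      by_contra h0
      exact hmin (n + 2) (by omega) (.step hxs hy₂ h0 hx₂y₂ hlink₂)
    have hx₂y₁ : B x₂ y₁ = 0 := by
      by_contra h0
      exact hmin (n + 2) (by omega) (.step hxs hy₁ hxy₁ h0 hlink₂)
    have hzy₂ : B z y₂ = 0 := by
      by_contra h0
      exact hmin 2 (by omega) (.step hxs hy₁ hxy₁ hx₁y₁ (.step hx₁ hy₂ hx₁y₂ h0 (.refl z hzs)))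
    have hxx₂ : x ≠ x₂ := by rintro rfl; exact hx₂y₂ hxy₂
    have hzx₂ : z ≠ x₂ := by rintro rfl; exact hx₂y₂ hzy₂
    have hx₁x₂ : x₁ ≠ x₂ := by rintro rfl; exact hx₁y₁ hx₂y₁
    have hyy : y₁ ≠ y₂ := by rintro rfl; exact hxy₁ hxy₂
    have huy : u ≠ y₂ := by rintro rfl; exact hu hy₂
    have hvy : v ≠ y₂ := by rintro rfl; exact hv hy₂
    obtain ⟨c, hcD, hc⟩ := hD.exists_inv (hBu.entry hx₂ (htu _ hy₂)) hx₂y₂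
    have := ih (n + 2) (by omega) (pivot B x₂ y₂ c) x z (hBu.pivot hD hx₂ (htu _ hy₂) hcD hc)
      (hBv.pivot hD hx₂ (htv _ hy₂) hcD hc) ?_ ?_
    · rwa [pivot_apply_of_ne _ _ hxx₂ huy, pivot_apply_of_ne _ _ hxx₂ hvy,
        pivot_apply_of_ne _ _ hzx₂ huy, pivot_apply_of_ne _ _ hzx₂ hvy, hxy₂, hzy₂,
        zero_mul, zero_mul, zero_mul, sub_zero, sub_zero, sub_zero, sub_zero] at this
    · rw [pivot_map]
      refine hP.pivot hL.target hx₂ (Set.mem_insert_of_mem _ (htv _ hy₂)) (hL.map_mem hcD) ?_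
      rw [map_apply, ← map_mul, hc, map_one]
    · refine .step hxs hy₁ ?_ ?_ (hpiv c hcD hc)
      · rwa [pivot_apply_of_ne _ _ hxx₂ hyy, hxy₂, zero_mul, zero_mul, sub_zero]
      · rwa [pivot_apply_of_ne _ _ hx₁x₂ hyy, hx₂y₁, mul_zero, sub_zero]

/-- Two lifts agreeing on a connected part glue to a lift. -/
theorem IsLifting.glue (hL : IsLifting D P π) [Nontrivial R] [Nontrivial K]
    {s : Set X} {t : Set Y} {u v : Y} (hu : u ∉ t) (hv : v ∉ t) {B : Matrix X Y R}
    (hBu : MinorsIn D s (insert u t) B) (hBv : MinorsIn D s (insert v t) B)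
    (hP : MinorsIn P s (insert u (insert v t)) (B.map π)) (hconn : ConnOn B s t) :
    MinorsIn D s (insert u (insert v t)) B := by
  have hD := hL.source
  intro n
  induction n generalizing B with
  | zero => intro f g _ _; simpa using hD.one_mem
  | succ n ih =>
    intro f g hf hg
    by_cases hinj : Function.Injective f ∧ Function.Injective g
    swap
    · rw [det_submatrix_eq_zero_of_not_injective B f g hinj]
      exact hD.zero_mem
    -- A nonzero entry in a column of t allows a pivot, which lowers the order of the minor and
    -- preserves all hypotheses. Without columns of t the order is at most 2.
    by_cases hgt : ∃ j, g j ∈ t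
    · obtain ⟨j, hj⟩ := hgt
      by_cases hcol : ∀ i, B (f i) (g j) = 0
      · rw [det_eq_zero_of_column_eq_zero j hcol]
        exact hD.zero_mem
      push Not at hcol
      obtain ⟨i, hi⟩ := hcol
      have hmem := hBu.entry (hf i) (Set.mem_insert_of_mem u hj)
      obtain ⟨c, hcD, hc⟩ := hD.exists_inv hmem hi
      refine det_mem_of_pivot hD B hinj.1 hinj.2 i j hmem hc (ih
        (hBu.pivot hD (hf i) (Set.mem_insert_of_mem _ hj) hcD hc)
        (hBv.pivot hD (hf i) (Set.mem_insert_of_mem _ hj) hcD hc) ?_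
        (hconn.pivot (hf i) hj hc) _ _ (fun _ => hf _) (fun _ => hg _))
      rw [pivot_map]
      refine hP.pivot hL.target (hf i) (Set.mem_insert_of_mem _ (Set.mem_insert_of_mem _ hj))
        (hL.map_mem hcD) ?_
      rw [map_apply, ← map_mul, hc, map_one]
    · push Not at hgt
      by_cases hgu : ∀ j, g j = u
      · exact hBu _ f g hf fun j => by rw [hgu j]; exact Set.mem_insert _ _
      by_cases hgv : ∀ j, g j = v
      · exact hBv _ f g hf fun j => by rw [hgv j]; exact Set.mem_insert _ _
      have huv : ∀ j, g j = u ∨ g j = v := fun j => by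
        rcases hg j with h | h | h
        · exact Or.inl h
        · exact Or.inr h
        · exact absurd h (hgt j)
      have hcard : n + 1 ≤ 2 := by
        classical
        have h1 : Finset.univ.image g ⊆ {u, v} := by
          intro y hy
          obtain ⟨j, _, rfl⟩ := Finset.mem_image.1 hy
          simpa using huv j
        have h2 := (Finset.card_le_card h1).trans Finset.card_le_two
        rwa [Finset.card_image_of_injective _ hinj.2, Finset.card_univ, Fintype.card_fin] at h2
      obtain rfl | rfl : n = 0 ∨ n = 1 := by omega
      · exfalso
        rcases huv 0 with h | h
        · exact hgu fun j => by rw [show j = 0 from Fin.ext (by omega), h]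
        · exact hgv fun j => by rw [show j = 0 from Fin.ext (by omega), h]
      · obtain ⟨m, hm⟩ := hconn.exists_linked (hf 0) (hf 1)
        have key := hL.two_by_two_mem hu hv m B (f 0) (f 1) hBu hBv hP hm
        have hne : g 0 ≠ g 1 := fun h => by simpa using hinj.2 h
        rw [det_fin_two]
        simp only [submatrix_apply]
        rcases huv 0 with h0 | h0 <;> rcases huv 1 with h1 | h1
        · exact absurd (h0.trans h1.symm) hne
        · rwa [h0, h1]
        · rw [h0, h1, ← hD.neg_mem_iff]
          convert key using 1
          ring
        · exact absurd (h0.trans h1.symm) hne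

end Lifts

/-! ### Uniqueness of lifts up to scaling, and the basic cases of existence. -/

section Lifts

variable {R K : Type*} [CommRing R] [CommRing K]
  {X Y : Type*} {D : Set R} {P : Set K}
  {π : R →+* K}

/-- `B'` arises from `B` on `S × T` by scaling rows and columns with elements of `D` over `1`. -/
def ScalingEquivOn (D : Set R) (π : R →+* K) (S : Set X) (T : Set Y) (B B' : Matrix X Y R) : Prop :=
  ∃ (r : X → R) (c : Y → R), (∀ x, r x ∈ D ∧ π (r x) = 1) ∧ (∀ y, c y ∈ D ∧ π (c y) = 1) ∧
    ∀ x ∈ S, ∀ y ∈ T, B' x y = r x * B x y * c y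

theorem ScalingEquivOn.transpose {S : Set X} {T : Set Y} {B B' : Matrix X Y R}
    (h : ScalingEquivOn D π S T B B') : ScalingEquivOn D π T S Bᵀ B'ᵀ := by
  obtain ⟨r, c, hr, hc, h⟩ := h
  refine ⟨c, r, hc, hr, fun y hy x hx => ?_⟩
  rw [transpose_apply, transpose_apply, h x hx y hy]
  ring

theorem ConnOn.insert_column {A : Matrix X Y R} {S : Set X} {T : Set Y} (h : ConnOn A S T) {x : X}
    (hx : x ∈ S) {y : Y} (hxy : A x y ≠ 0) : ConnOn A S (insert y T) := by
  intro S' hS' T' hT' hne hST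
  have hxy' : x ∈ S' ↔ y ∈ T' := hST x hx y (Set.mem_insert _ _) hxy
  by_cases hne' : S'.Nonempty ∨ (T' ∩ T).Nonempty
  · obtain ⟨h1, h2⟩ := h S' hS' (T' ∩ T) Set.inter_subset_right hne' fun i hi j hj hij => by
      rw [hST i hi j (Set.mem_insert_of_mem _ hj) hij]
      exact ⟨fun h => ⟨h, hj⟩, fun h => h.1⟩
    refine ⟨h1, hT'.antisymm (Set.insert_subset (hxy'.1 (h1 ▸ hx)) ?_)⟩
    rw [← h2]
    exact Set.inter_subset_left
  · exfalso
    rw [not_or, Set.not_nonempty_iff_eq_empty, Set.not_nonempty_iff_eq_empty] at hne'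
    obtain ⟨rfl, hT⟩ := hne'
    rcases hne with hne | ⟨j, hj⟩
    · exact Set.not_nonempty_empty hne
    · rcases hT' hj with rfl | hjT
      · exact hxy'.2 hj
      · have : j ∈ T' ∩ T := ⟨hj, hjT⟩
        rw [hT] at this
        exact this

/-- After rescaling, the matrices agree on T, so by `column_proportional` one factor fits the whole
new column; it is fixed by the nonzero entry in row x. -/
theorem IsLifting.scalingEquivOn_insert (hL : IsLifting D P π) [Nontrivial R] [Nontrivial K]
    {S : Set X} {T : Set Y} {B B' : Matrix X Y R} {x : X} (hx : x ∈ S) {y : Y} (hy : y ∉ T)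
    (hxy : B x y ≠ 0) (hB : MinorsIn D S (insert y T) B) (hB' : MinorsIn D S (insert y T) B')
    (hπ : ∀ x ∈ S, π (B x y) = π (B' x y)) (hconn : ConnOn B S T)
    (h : ScalingEquivOn D π S T B B') : ScalingEquivOn D π S (insert y T) B B' := by
  classical
  have hD := hL.source
  obtain ⟨r, c, hr, hc, h⟩ := h
  have hu : y ∈ insert y T := Set.mem_insert _ _
  let c₁ := Function.update c y 1
  have hc₁ : ∀ j, c₁ j ∈ D := by
    intro j
    by_cases hj : j = y
    · subst hj; simpa [c₁] using hD.one_mem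
    · simpa [c₁, hj] using (hc j).1
  have hne : ∀ i ∈ S, B' i y = 0 ↔ B i y = 0 := fun i hi => by
    rw [← not_iff_not, ← ne_eq, ← ne_eq, ← hL.map_ne_zero_iff (hB.entry hi hu),
      ← hL.map_ne_zero_iff (hB'.entry hi hu), hπ i hi]
  have hr0 : ∀ i, r i ≠ 0 := fun i h0 => by simpa [h0] using (hr i).2
  let B₁ : Matrix X Y R := fun i j => r i * B i j * c₁ j
  have hB₁ : MinorsIn D S (insert y T) B₁ := hB.scale hD (fun i => (hr i).1) hc₁
  have hB₁y : ∀ i, B₁ i y = r i * B i y := fun i => by simp [B₁, c₁]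
  have hB₁T : ∀ i ∈ S, ∀ j ∈ T, B₁ i j = B' i j := fun i hi j hj => by
    have : j ≠ y := fun h => hy (h ▸ hj)
    simp [B₁, c₁, this, h i hi j hj]
  have hconn₁ : ConnOn B₁ S T := hconn.congr fun i hi j hj hij => by
    rw [hB₁T i hi j hj, h i hi j hj]
    have hcj : c j ≠ 0 := fun h0 => by simpa [h0] using (hc j).2
    rw [mul_assoc]
    refine hD.mul_ne_zero (hr i).1 (hr0 i) ?_
    exact hD.mul_ne_zero (hB.entry hi (Set.mem_insert_of_mem _ hj)) hij hcj
  have hB₁0 : ∀ i, i ∈ S → B i y ≠ 0 → B₁ i y ≠ 0 := fun i hi hi0 => by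
    rw [hB₁y]
    exact hD.mul_ne_zero (hr i).1 (hr0 i) hi0
  obtain ⟨e, heD, he⟩ := hD.exists_inv (hB₁.entry hx hu) (hB₁0 x hx hxy)
  have hπe : π (B' x y * e) = 1 := by
    have h1 : π (B₁ x y) = π (B' x y) := by rw [hB₁y, map_mul, (hr x).2, one_mul, hπ x hx]
    rw [map_mul, ← h1, ← map_mul, he, map_one]
  -- Here e is the inverse of r x · B x y, so the new factor has image 1 under π.
  refine ⟨r, Function.update c y (B' x y * e), hr, fun j => ?_, fun i hi j hj => ?_⟩
  · by_cases hj : j = y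
    · subst hj
      simpa using ⟨hD.mul_mem (hB'.entry hx hu) heD, by simpa using hπe⟩
    · simpa [hj] using hc j
  · rcases hj with rfl | hj
    · rw [Function.update_self]
      by_cases hi0 : B i j = 0
      · rw [(hne i hi).2 hi0, hi0, mul_zero, zero_mul]
      obtain ⟨n, hn⟩ := hconn₁.exists_linked hx hi
      have key := hL.column_proportional hy n B₁ B' x i hB₁ hB' hB₁T
        (fun k hk => by rw [hB₁y, map_mul, (hr k).2, one_mul, hπ k hk]) hn
        (hB₁0 x hx hxy) (hB₁0 i hi hi0)
      rw [hB₁y i] at key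
      linear_combination (-B' i j) * he - e * key
    · have : j ≠ y := fun h => hy (h ▸ hj)
      rw [Function.update_of_ne this]
      exact h i hi j hj

/-- Take a connected subblock of maximal size on which the scalings exist. If it is not everything,
connectedness provides a nonzero entry leaving it, and the block can be enlarged by a row or column.
-/
theorem IsLifting.scalingEquivOn (hL : IsLifting D P π) [Nontrivial R] [Nontrivial K]
    (s : Finset X) (t : Finset Y) {B B' : Matrix X Y R}
    (hB : MinorsIn D (s : Set X) (t : Set Y) B) (hB' : MinorsIn D (s : Set X) (t : Set Y) B')
    (hπ : ∀ x ∈ s, ∀ y ∈ t, π (B x y) = π (B' x y)) (hconn : ConnOn B s t) :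
    ScalingEquivOn D π (s : Set X) (t : Set Y) B B' := by
  classical
  have hD := hL.source
  have triv : ∀ S : Set X, ∀ T : Set Y, (S = ∅ ∨ T = ∅) → ScalingEquivOn D π S T B B' := by
    refine fun S T h => ⟨fun _ => 1, fun _ => 1, fun _ => ⟨hD.one_mem, map_one π⟩,
      fun _ => ⟨hD.one_mem, map_one π⟩, fun x hx y hy => ?_⟩
    rcases h with rfl | rfl
    · exact absurd hx (Set.notMem_empty x)
    · exact absurd hy (Set.notMem_empty y)
  rcases s.eq_empty_or_nonempty with rfl | ⟨x₀, hx₀⟩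
  · exact triv _ _ (Or.inl (by simp))
  let Q : Finset (Finset X × Finset Y) := (s.powerset ×ˢ t.powerset).filter fun q =>
    (q.1.Nonempty ∨ q.2.Nonempty) ∧ ConnOn B (q.1 : Set X) (q.2 : Set Y) ∧
      ScalingEquivOn D π (q.1 : Set X) (q.2 : Set Y) B B'
  have hQ : Q.Nonempty := by
    refine ⟨({x₀}, ∅), ?_⟩
    simp only [Q, Finset.mem_filter, Finset.mem_product, Finset.mem_powerset]
    refine ⟨⟨by simpa using hx₀, by simp⟩, Or.inl (by simp), ?_, triv _ _ (Or.inr (by simp))⟩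
    intro S hS T hT hne _
    have hT' : T = ∅ := by simpa using hT
    subst hT'
    refine ⟨?_, by simp⟩
    have hS1 : S.Nonempty := by simpa using hne
    have hS' : S ⊆ {x₀} := by simpa using hS
    simpa using hS1.subset_singleton_iff.1 hS'
  obtain ⟨⟨S, T⟩, hST, hmax⟩ := Q.exists_max_image (fun q => q.1.card + q.2.card) hQ
  simp only [Q, Finset.mem_filter, Finset.mem_product, Finset.mem_powerset] at hST
  obtain ⟨⟨hSs, hTt⟩, hne, hcST, heST⟩ := hST
  have hSs' : (S : Set X) ⊆ s := Finset.coe_subset.2 hSs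
  have hTt' : (T : Set Y) ⊆ t := Finset.coe_subset.2 hTt
  by_cases hcl : ∀ x ∈ (s : Set X), ∀ y ∈ (t : Set Y), B x y ≠ 0 → (x ∈ (S : Set X) ↔ y ∈ (T : Set Y))
  · obtain ⟨h1, h2⟩ := hconn S hSs' T hTt' (by simpa using hne) hcl
    rwa [h1, h2] at heST
  exfalso
  push Not at hcl
  obtain ⟨x, hx, y, hy, hxy, hcl⟩ := hcl
  rcases hcl with ⟨hxS, hyT⟩ | ⟨hxS, hyT⟩
  · have hyT' : insert y (T : Set Y) ⊆ t := Set.insert_subset hy hTt'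
    have := hmax (S, insert y T) (by
      simp only [Q, Finset.mem_filter, Finset.mem_product, Finset.mem_powerset]
      refine ⟨⟨hSs, Finset.insert_subset hy hTt⟩, Or.inr (by simp), ?_, ?_⟩
      · rw [Finset.coe_insert]
        exact hcST.insert_column hxS hxy
      · rw [Finset.coe_insert]
        exact hL.scalingEquivOn_insert hxS hyT hxy (hB.mono hSs' hyT') (hB'.mono hSs' hyT')
          (fun i hi => hπ i (hSs' hi) y hy) hcST heST)
    rw [Finset.card_insert_of_notMem (by simpa using hyT)] at this
    simp only at this
    omega
  · have hxS' : insert x (S : Set X) ⊆ s := Set.insert_subset hx hSs'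
    have := hmax (insert x S, T) (by
      simp only [Q, Finset.mem_filter, Finset.mem_product, Finset.mem_powerset]
      refine ⟨⟨Finset.insert_subset hx hSs, hTt⟩, Or.inl (by simp), ?_, ?_⟩
      · rw [Finset.coe_insert]
        exact (hcST.transpose.insert_column hyT hxy).transpose
      · rw [Finset.coe_insert]
        exact (hL.scalingEquivOn_insert hyT hxS hxy (hB.mono hxS' hTt').transpose
          (hB'.mono hxS' hTt').transpose
          (fun i hi => hπ x hx i (hTt' hi)) hcST.transpose heST.transpose).transpose)
    rw [Finset.card_insert_of_notMem (by simpa using hxS)] at this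
    simp only at this
    omega

/-- `A` has a lift on `s × t`. -/
def Liftable (D : Set R) (π : R →+* K) (A : Matrix X Y K) (s : Set X) (t : Set Y) : Prop :=
  ∃ B : Matrix X Y R, MinorsIn D s t B ∧ ∀ x ∈ s, ∀ y ∈ t, π (B x y) = A x y

theorem Liftable.transpose {A : Matrix X Y K} {s : Set X} {t : Set Y} (h : Liftable D π A s t) :
    Liftable D π Aᵀ t s := by
  obtain ⟨B, hB, hBA⟩ := h
  exact ⟨Bᵀ, hB.transpose, fun y hy x hx => hBA x hx y hy⟩

theorem pivot_congr {A B : Matrix X Y R} {s : Set X} {t : Set Y}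
    (h : ∀ i ∈ s, ∀ j ∈ t, A i j = B i j) {x : X} (hx : x ∈ s) {y : Y} (hy : y ∈ t) (c : R) :
    ∀ i ∈ s, ∀ j ∈ t, pivot A x y c i j = pivot B x y c i j := by
  intro i hi j hj
  simp only [pivot, of_apply, h i hi j hj, h i hi y hy, h x hx j hj]

/-- A lift of the pivoted matrix is pivoted back at the same position. -/
theorem IsLifting.liftable_of_pivot (hL : IsLifting D P π) [Nontrivial K] {A : Matrix X Y K}
    {s : Set X} {t : Set Y} {x : X} (hx : x ∈ s) {y : Y} (hy : y ∈ t) {c : K}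
    (hc : A x y * c = 1) (h : Liftable D π (pivot A x y c) s t) : Liftable D π A s t := by
  obtain ⟨B, hB, hBA⟩ := h
  have hBxy : π (B x y) = c := by rw [hBA x hx y hy, pivot_apply_self]
  have h0 : B x y ≠ 0 := by
    intro h0
    rw [h0, map_zero] at hBxy
    simp [← hBxy] at hc
  obtain ⟨a, haD, ha⟩ := hL.source.exists_inv (hB.entry hx hy) h0
  have hπa : π a = A x y := by
    have : c * π a = 1 := by rw [← hBxy, ← map_mul, ha, map_one]
    linear_combination A x y * this - π a * hc
  refine ⟨pivot B x y a, hB.pivot hL.source hx hy haD ha, fun i hi j hj => ?_⟩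
  have h1 : π (pivot B x y a i j) = pivot (B.map π) x y (π a) i j := by rw [← pivot_map]; rfl
  rw [h1]
  conv_rhs => rw [← pivot_pivot A x y c hc]
  rw [hπa]
  exact pivot_congr (fun i hi j hj => by rw [map_apply, hBA i hi j hj]) hx hy _ i hi j hj

/-- Connectedness of the common part makes the two lifts scalings of each other there. Rescaling one
of them makes them agree, with images under π unchanged, and then `glue` applies. -/
theorem IsLifting.liftable_of_two_columns (hL : IsLifting D P π) [Nontrivial R] [Nontrivial K]
    {A : Matrix X Y K} {s : Finset X} {t : Finset Y} {u v : Y} (hu : u ∉ t) (hv : v ∉ t)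
    (huv : u ≠ v)
    (hA : MinorsIn P (s : Set X) (insert u (insert v (t : Set Y))) A)
    (hconn : ConnOn A (s : Set X) (t : Set Y))
    (hAu : Liftable D π A (s : Set X) (insert u (t : Set Y)))
    (hAv : Liftable D π A (s : Set X) (insert v (t : Set Y))) :
    Liftable D π A (s : Set X) (insert u (insert v (t : Set Y))) := by
  classical
  have hD := hL.source
  obtain ⟨B₁, hB₁, hBA₁⟩ := hAu
  obtain ⟨B₂, hB₂, hBA₂⟩ := hAv
  have htu : ∀ y ∈ t, y ∈ insert u (t : Set Y) := fun y hy => Set.mem_insert_of_mem _ hy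
  have htv : ∀ y ∈ t, y ∈ insert v (t : Set Y) := fun y hy => Set.mem_insert_of_mem _ hy
  obtain ⟨r, c, hr, hc, h⟩ := hL.scalingEquivOn s t (hB₁.mono subset_rfl (Set.subset_insert _ _))
    (hB₂.mono subset_rfl (Set.subset_insert _ _))
    (fun x hx y hy => by rw [hBA₁ x hx y (htu y hy), hBA₂ x hx y (htv y hy)])
    (hconn.congr fun x hx y hy hxy h0 => hxy (by rw [← hBA₁ x hx y (htu y hy), h0, map_zero]))
  let B : Matrix X Y R := fun x y => if y = v then B₂ x y else r x * B₁ x y * c y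
  have hBv : ∀ x ∈ s, ∀ y ∈ insert v (t : Set Y), B₂ x y = B x y := by
    intro x hx y hy
    by_cases hyv : y = v
    · simp [B, hyv]
    · simp only [B, hyv, if_false]
      exact h x hx y (hy.resolve_left hyv)
  have hBu : ∀ x ∈ s, ∀ y ∈ insert u (t : Set Y), r x * B₁ x y * c y = B x y := by
    intro x hx y hy
    have hyv : y ≠ v := by
      rintro rfl
      rcases hy with h | h
      · exact huv h.symm
      · exact hv h
    simp [B, hyv]
  have hBA : ∀ x ∈ (s : Set X), ∀ y ∈ insert u (insert v (t : Set Y)), π (B x y) = A x y := by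
    intro x hx y hy
    by_cases hy' : y ∈ insert v (t : Set Y)
    · rw [← hBv x hx y hy', hBA₂ x hx y hy']
    · have hyu : y ∈ insert u (t : Set Y) := by
        rcases hy with h | h
        · exact Or.inl h
        · exact absurd h hy'
      rw [← hBu x hx y hyu, map_mul, map_mul, (hr x).2, (hc y).2, hBA₁ x hx y hyu, one_mul, mul_one]
  refine ⟨B, hL.glue hu hv ?_ (hB₂.congr hBv) ?_ ?_, hBA⟩
  · exact (hB₁.scale hD (fun x => (hr x).1) fun y => (hc y).1).congr hBu
  · exact hA.congr fun x hx y hy => (hBA x hx y hy).symm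
  · refine hconn.congr fun x hx y hy hxy h0 => hxy ?_
    rw [← hBA x hx y (Set.mem_insert_of_mem _ (htv y hy)), h0, map_zero]

/-- Block diagonal matrices. -/
theorem MinorsIn.of_blocks (hD : IsUnitCarrier D) [Nontrivial R] {s : Set X} {t : Set Y}
    (p : X → Bool) (q : Y → Bool) {A : Matrix X Y R}
    (hz : ∀ x ∈ s, ∀ y ∈ t, A x y ≠ 0 → p x = q y)
    (hA : ∀ b, MinorsIn D {x ∈ s | p x = b} {y ∈ t | q y = b} A) : MinorsIn D s t A := by
  intro n
  induction n generalizing A with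
  | zero => intro f g _ _; simpa using hD.one_mem
  | succ n ih =>
    intro f g hf hg
    by_cases hinj : Function.Injective f ∧ Function.Injective g
    swap
    · rw [det_submatrix_eq_zero_of_not_injective A f g hinj]
      exact hD.zero_mem
    by_cases hcol : ∀ i, A (f i) (g 0) = 0
    · rw [det_eq_zero_of_column_eq_zero 0 hcol]
      exact hD.zero_mem
    push Not at hcol
    obtain ⟨i, hi⟩ := hcol
    have hpq := hz _ (hf i) _ (hg 0) hi
    have hmem := (hA (q (g 0))).entry ⟨hf i, hpq⟩ ⟨hg 0, rfl⟩
    obtain ⟨c, hcD, hc⟩ := hD.exists_inv hmem hi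
    have hz0 : ∀ x ∈ s, ∀ y ∈ t, p x ≠ q y → A x y = 0 := fun x hx y hy hxy => by
      by_contra h0
      exact hxy (hz x hx y hy h0)
    refine det_mem_of_pivot hD A hinj.1 hinj.2 i 0 hmem hc (ih ?_ ?_ _ _ (fun _ => hf _)
      (fun _ => hg _))
    · intro x hx y hy
      contrapose
      intro hxy
      have h0 := hz0 x hx y hy hxy
      have h1 : A x (g 0) = 0 ∨ A (f i) y = 0 := by
        by_contra hcon
        rw [not_or] at hcon
        exact hxy ((hz x hx _ (hg 0) hcon.1).trans
          (hpq.symm.trans (hz _ (hf i) y hy hcon.2)))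
      by_cases hx' : x = f i <;> by_cases hy' : y = g 0
      · subst hx' hy'; exact absurd hpq hxy
      · subst hx'; rw [pivot_apply_row _ _ hy', h0, mul_zero]
      · subst hy'; rw [pivot_apply_col _ _ hx', h0, zero_mul, neg_zero]
      · rw [pivot_apply_of_ne _ _ hx' hy', h0]
        rcases h1 with h1 | h1 <;> simp [h1]
    · intro b
      -- The pivot acts inside one block and leaves the other one untouched.
      by_cases hb : q (g 0) = b
      · exact (hA b).pivot hD ⟨hf i, hpq.trans hb⟩ ⟨hg 0, hb⟩ hcD hc
      · refine (hA b).congr fun x hx y hy => ?_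
        have hx' : x ≠ f i := by rintro rfl; exact hb (hpq.symm.trans hx.2)
        have hy' : y ≠ g 0 := by rintro rfl; exact hb hy.2
        rw [pivot_apply_of_ne _ _ hx' hy',
          hz0 _ hx.1 _ (hg 0) (fun h => hb (h.symm.trans hx.2)), zero_mul, zero_mul, sub_zero]

theorem IsLifting.liftable_of_blocks (hL : IsLifting D P π) [Nontrivial R] {A : Matrix X Y K}
    {s S : Set X} {t T : Set Y}
    (hz : ∀ x ∈ s, ∀ y ∈ t, A x y ≠ 0 → (x ∈ S ↔ y ∈ T)) (h₁ : Liftable D π A S T)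
    (h₂ : Liftable D π A (s \ S) (t \ T)) : Liftable D π A s t := by
  classical
  obtain ⟨B₁, hB₁, hBA₁⟩ := h₁
  obtain ⟨B₂, hB₂, hBA₂⟩ := h₂
  let B : Matrix X Y R := fun x y =>
    if x ∈ S then (if y ∈ T then B₁ x y else 0) else (if y ∈ T then 0 else B₂ x y)
  refine ⟨B, MinorsIn.of_blocks hL.source (fun x => decide (x ∈ S)) (fun y => decide (y ∈ T))
    ?_ ?_, ?_⟩
  · intro x _ y _ hxy
    by_cases hx : x ∈ S <;> by_cases hy : y ∈ T <;> simp_all [B]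
  · rintro (_ | _)
    · refine (hB₂.mono (s' := _) (t' := _) ?_ ?_).congr ?_
      · rintro x ⟨hx, hx'⟩
        exact ⟨hx, by simpa using hx'⟩
      · rintro y ⟨hy, hy'⟩
        exact ⟨hy, by simpa using hy'⟩
      · rintro x ⟨hx, hx'⟩ y ⟨hy, hy'⟩
        have hx'' : x ∉ S := by simpa using hx'
        have hy'' : y ∉ T := by simpa using hy'
        simp [B, hx'', hy'']
    · refine (hB₁.mono (s' := _) (t' := _) ?_ ?_).congr ?_
      · rintro x ⟨hx, hx'⟩
        simpa using hx'
      · rintro y ⟨hy, hy'⟩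
        simpa using hy'
      · rintro x ⟨hx, hx'⟩ y ⟨hy, hy'⟩
        have hx'' : x ∈ S := by simpa using hx'
        have hy'' : y ∈ T := by simpa using hy'
        simp [B, hx'', hy'']
  · intro x hx y hy
    have h0 : ¬ (x ∈ S ↔ y ∈ T) → A x y = 0 := fun h => by
      by_contra h0
      exact h (hz x hx y hy h0)
    by_cases hxS : x ∈ S <;> by_cases hyT : y ∈ T
    · simp [B, hxS, hyT, hBA₁ x hxS y hyT]
    · simp [B, hxS, hyT, h0]
    · simp [B, hxS, hyT, h0]
    · simp [B, hxS, hyT, hBA₂ x ⟨hx, hxS⟩ y ⟨hy, hyT⟩]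

/-- Any entrywise lift will do: minors of order at least 2 repeat a column. -/
theorem IsLifting.liftable_of_subsingleton (hL : IsLifting D P π) {A : Matrix X Y K}
    {s : Set X} {t : Set Y} (hA : MinorsIn P s t A) (ht : t.Subsingleton) :
    Liftable D π A s t := by
  classical
  have hD := hL.source
  have : ∀ x y, ∃ b ∈ D, x ∈ s → y ∈ t → π b = A x y := fun x y => by
    by_cases h : x ∈ s ∧ y ∈ t
    · obtain ⟨b, hb, hbA⟩ := hL.surj _ (hA.entry h.1 h.2)
      exact ⟨b, hb, fun _ _ => hbA⟩
    · exact ⟨0, hD.zero_mem, fun hx hy => absurd ⟨hx, hy⟩ h⟩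
  choose B hBD hB using this
  refine ⟨Matrix.of B, fun n f g hf hg => ?_, fun x hx y hy => hB x y hx hy⟩
  match n with
  | 0 => simpa using hD.one_mem
  | 1 => simpa using hBD (f 0) (g 0)
  | n + 2 =>
    rw [det_submatrix_eq_zero_of_not_injective]
    · exact hD.zero_mem
    · intro h
      have := h.2 (ht (hg 0) (hg 1))
      simp at this

theorem minorsIn_pair (hD : IsUnitCarrier D) {B : Matrix X Y R} {x x' : X} {y y' : Y}
    (hB : ∀ i j, B i j ∈ D) (h : B x y * B x' y' - B x y' * B x' y ∈ D) :
    MinorsIn D {x, x'} {y, y'} B := by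
  intro n f g hf hg
  by_cases hinj : Function.Injective f ∧ Function.Injective g
  swap
  · rw [det_submatrix_eq_zero_of_not_injective B f g hinj]
    exact hD.zero_mem
  match n with
  | 0 => simpa using hD.one_mem
  | 1 => simpa using hB _ _
  | 2 =>
    rw [det_fin_two]
    simp only [submatrix_apply]
    have hfne : f 0 ≠ f 1 := fun h => by simpa using hinj.1 h
    have hgne : g 0 ≠ g 1 := fun h => by simpa using hinj.2 h
    have h' := hD.neg_mem h
    have hf' : ∀ i, f i = x ∨ f i = x' := hf
    have hg' : ∀ i, g i = y ∨ g i = y' := hg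
    rcases hf' 0 with hf0 | hf0 <;> rcases hf' 1 with hf1 | hf1 <;>
      rcases hg' 0 with hg0 | hg0 <;> rcases hg' 1 with hg1 | hg1 <;>
      first
        | exact absurd (hf0.trans hf1.symm) hfne
        | exact absurd (hg0.trans hg1.symm) hgne
        | (rw [hf0, hf1, hg0, hg1]; exact h)
        | (rw [hf0, hf1, hg0, hg1]; convert h using 1; ring1)
        | (rw [hf0, hf1, hg0, hg1]; convert h' using 1; ring1)
  | n + 3 =>
    classical
    exfalso
    have h1 : Finset.univ.image f ⊆ {x, x'} := by
      intro i hi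
      obtain ⟨j, _, rfl⟩ := Finset.mem_image.1 hi
      simpa using hf j
    have h2 := (Finset.card_le_card h1).trans Finset.card_le_two
    rw [Finset.card_image_of_injective _ hinj.1, Finset.card_univ, Fintype.card_fin] at h2
    omega

/-- Three entries are lifted arbitrarily. The fourth is then forced to be b c q / a, where q is a
fundamental lift of the cross ratio; the determinant becomes -b c (1 - q). -/
theorem IsLifting.liftable_pair (hL : IsLifting D P π) [Nontrivial R] [Nontrivial K]
    {A : Matrix X Y K} {x x' : X} {y y' : Y} (hx : x ≠ x') (hy : y ≠ y')
    (hA : MinorsIn P {x, x'} {y, y'} A) (h₁ : A x y ≠ 0) (h₂ : A x y' ≠ 0) (h₃ : A x' y ≠ 0)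
    (h₄ : A x' y' ≠ 0) : Liftable D π A {x, x'} {y, y'} := by
  classical
  have hD := hL.source
  have hP := hL.target
  have hxm : x ∈ ({x, x'} : Set X) := by simp
  have hxm' : x' ∈ ({x, x'} : Set X) := by simp
  have hym : y ∈ ({y, y'} : Set Y) := by simp
  have hym' : y' ∈ ({y, y'} : Set Y) := by simp
  obtain ⟨a, haD, ha⟩ := hL.surj _ (hA.entry hxm hym)
  obtain ⟨b, hbD, hb⟩ := hL.surj _ (hA.entry hxm hym')
  obtain ⟨c, hcD, hc⟩ := hL.surj _ (hA.entry hxm' hym)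
  have ha0 : a ≠ 0 := by rintro rfl; exact h₁ (by rw [← ha, map_zero])
  have hb0 : b ≠ 0 := by rintro rfl; exact h₂ (by rw [← hb, map_zero])
  have hc0 : c ≠ 0 := by rintro rfl; exact h₃ (by rw [← hc, map_zero])
  obtain ⟨b', hbD', hb'⟩ := hD.exists_inv hbD hb0
  obtain ⟨c', hcD', hc'⟩ := hD.exists_inv hcD hc0
  obtain ⟨a', haD', ha'⟩ := hD.exists_inv haD ha0
  have hb0' : b' ≠ 0 := by rintro rfl; simp at hb'
  have hc0' : c' ≠ 0 := by rintro rfl; simp at hc'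
  have hπb : π b * π b' = 1 := by rw [← map_mul, hb', map_one]
  have hπc : π c * π c' = 1 := by rw [← map_mul, hc', map_one]
  have hπa : π a * π a' = 1 := by rw [← map_mul, ha', map_one]
  have hdet := hA.two hxm hxm' hym hym'
  have hπb0 : π b' ≠ 0 := (hL.map_ne_zero_iff hbD').2 hb0'
  have hπc0 : π c' ≠ 0 := (hL.map_ne_zero_iff hcD').2 hc0'
  have hbc : π b' * π c' ∈ P := hP.mul_mem (hL.map_mem hbD') (hL.map_mem hcD')
  obtain ⟨q, hq, hπq⟩ := hL.fundamental_surj (p := A x y * (A x' y' * (π b' * π c'))) (by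
    refine ⟨hP.mul_mem (hA.entry hxm hym) (hP.mul_mem (hA.entry hxm' hym') hbc),
      hP.mul_ne_zero (hA.entry hxm hym) h₁ (hP.mul_ne_zero (hA.entry hxm' hym') h₄
        (hP.mul_ne_zero (hL.map_mem hbD') hπb0 hπc0)), ?_⟩
    have : 1 - A x y * (A x' y' * (π b' * π c')) =
        -(π b' * π c' * (A x y * A x' y' - A x y' * A x' y)) := by
      rw [← hb, ← hc]
      linear_combination -hπb - π b * π b' * hπc
    rw [this]
    exact hP.neg_mem (hP.mul_mem hbc hdet))
  let B : Matrix X Y R := fun i j =>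
    if i = x then (if j = y then a else b) else (if j = y then c else b * c * (a' * q))
  have hBxy : B x y = a := by simp [B]
  have hBxy' : B x y' = b := by simp [B, hy.symm]
  have hBx'y : B x' y = c := by simp [B, hx.symm]
  have hBx'y' : B x' y' = b * c * (a' * q) := by simp [B, hx.symm, hy.symm]
  refine ⟨B, minorsIn_pair hD (fun i j => ?_) ?_, ?_⟩
  · simp only [B]
    split_ifs
    · exact haD
    · exact hbD
    · exact hcD
    · exact hD.mul_mem (hD.mul_mem hbD hcD) (hD.mul_mem haD' hq.1)
  · rw [hBxy, hBxy', hBx'y, hBx'y']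
    have : a * (b * c * (a' * q)) - b * c = -(b * c * (1 - q)) := by
      linear_combination b * c * q * ha'
    rw [this]
    exact hD.neg_mem (hD.mul_mem (hD.mul_mem hbD hcD) hq.2.2)
  · rintro i (rfl | rfl) j (rfl | rfl)
    · rw [hBxy, ha]
    · rw [hBxy', hb]
    · rw [hBx'y, hc]
    · rw [hBx'y']
      simp only [map_mul, hπq, ← ha]
      linear_combination (A i j) * (hπb * π c * π c' * π a * π a' + hπc * π a * π a' + hπa)

end Lifts

/-! ### Removing two leaves of a spanning tree -/

section Graph

variable {V : Type*}

/-- The vertices in `W` are connected to each other within `W`. -/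
def ConnectedIn (adj : V → V → Prop) (W : Set V) : Prop :=
  ∀ S ⊆ W, S.Nonempty → (∀ a ∈ W, ∀ b ∈ W, adj a b → (a ∈ S ↔ b ∈ S)) → S = W

/-- This is a breadth-first spanning tree rooted at w: d is the distance from w, and `par` the next
vertex on a shortest path to w. -/
theorem ConnectedIn.exists_parent {adj : V → V → Prop} (hsymm : ∀ a b, adj a b → adj b a)
    {W : Set V} (h : ConnectedIn adj W) {w : V} (hw : w ∈ W) :
    ∃ (d : V → ℕ) (par : V → V), (∀ a ∈ W, d a = 0 → a = w) ∧
      (∀ a ∈ W, adj w a → d a ≤ 1) ∧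
      ∀ a ∈ W, a ≠ w → par a ∈ W ∧ adj a (par a) ∧ d (par a) + 1 = d a := by
  classical
  let G : SimpleGraph V :=
    { Adj := fun a b => a ≠ b ∧ a ∈ W ∧ b ∈ W ∧ adj a b
      symm := ⟨fun a b h => ⟨h.1.symm, h.2.2.1, h.2.1, hsymm _ _ h.2.2.2⟩⟩ }
  have hreach : ∀ a ∈ W, G.Reachable a w := by
    have := h {a ∈ W | G.Reachable a w} (fun a ha => ha.1) ⟨w, hw, SimpleGraph.Reachable.refl w⟩ (by
      intro a ha b hb hab
      by_cases hne : a = b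
      · rw [hne]
      have hG : G.Adj a b := ⟨hne, ha, hb, hab⟩
      exact ⟨fun h => ⟨hb, hG.symm.reachable.trans h.2⟩, fun h => ⟨ha, hG.reachable.trans h.2⟩⟩)
    intro a ha
    rw [← this] at ha
    exact ha.2
  have hpar : ∀ a, ∃ b, a ∈ W → a ≠ w → b ∈ W ∧ adj a b ∧ G.dist b w + 1 = G.dist a w := by
    intro a
    by_cases ha : a ∈ W ∧ a ≠ w
    swap
    · exact ⟨a, fun h1 h2 => absurd ⟨h1, h2⟩ ha⟩
    obtain ⟨p, hp⟩ := (hreach a ha.1).exists_walk_length_eq_dist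
    cases p with
    | nil => exact absurd rfl ha.2
    | @cons _ b _ hab q =>
      refine ⟨b, fun _ _ => ⟨hab.2.2.1, hab.2.2.2, ?_⟩⟩
      rw [SimpleGraph.Walk.length_cons] at hp
      obtain ⟨q', hq'⟩ := (hreach b hab.2.2.1).exists_walk_length_eq_dist
      have h1 := SimpleGraph.dist_le q
      have h2 := SimpleGraph.dist_le (SimpleGraph.Walk.cons hab q')
      rw [SimpleGraph.Walk.length_cons] at h2
      omega
  choose par hpar using hpar
  refine ⟨fun a => G.dist a w, par, fun a ha h0 => ?_, fun a ha hwa => ?_, hpar⟩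
  · exact (hreach a ha).dist_eq_zero_iff.1 h0
  · by_cases hne : a = w
    · simp [hne]
    · have hG : G.Adj a w := ⟨hne, ha, hw, hsymm _ _ hwa⟩
      exact (SimpleGraph.dist_eq_one_iff_adj.2 hG).le

/-- A connected graph with a vertex of degree at least three has three vertices any subset of which
can be removed. -/
theorem ConnectedIn.exists_leaves {adj : V → V → Prop} (hsymm : ∀ a b, adj a b → adj b a)
    {W : Finset V} (h : ConnectedIn adj (W : Set V)) {w : V} (hw : w ∈ W) {N : Finset V}
    (hN : N ⊆ W) (hwN : w ∉ N) (hadj : ∀ a ∈ N, adj w a) (hcard : 3 ≤ N.card) :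
    ∃ L ⊆ W, 3 ≤ L.card ∧ ∀ L' ⊆ L, ConnectedIn adj ((W : Set V) \ L') := by
  classical
  obtain ⟨d, par, hd0, hd1, hpar⟩ := h.exists_parent hsymm hw
  -- The inner vertices of the tree; those outside I are leaves.
  let I := (W.erase w).image par
  have hparN : ∀ a ∈ N, par a = w := by
    intro a ha
    have haw : a ≠ w := fun h => hwN (h ▸ ha)
    obtain ⟨h1, _, h2⟩ := hpar a (hN ha) haw
    have := hd1 a (hN ha) (hadj a ha)
    exact hd0 _ h1 (by omega)
  have hIW : I ⊆ W := by
    intro b hb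
    obtain ⟨a, ha, rfl⟩ := Finset.mem_image.1 hb
    rw [Finset.mem_erase] at ha
    exact (hpar a ha.2 ha.1).1
  have hwI : w ∈ I := by
    obtain ⟨a, ha⟩ := Finset.card_pos.1 (by omega : 0 < N.card)
    exact Finset.mem_image.2 ⟨a, Finset.mem_erase.2 ⟨fun h => hwN (h ▸ ha), hN ha⟩, hparN a ha⟩
  -- All vertices of N have parent w, so the inner vertices other than w are parents of the
  -- remaining at most |W| - 4 vertices.
  have hIcard : I.card + 3 ≤ W.card := by
    have h1 : I.erase w ⊆ ((W.erase w) \ N).image par := by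
      intro b hb
      obtain ⟨hbw, hb⟩ := Finset.mem_erase.1 hb
      obtain ⟨a, ha, rfl⟩ := Finset.mem_image.1 hb
      exact Finset.mem_image_of_mem _ (Finset.mem_sdiff.2 ⟨ha, fun haN => hbw (hparN a haN)⟩)
    have h2 := (Finset.card_le_card h1).trans Finset.card_image_le
    have hNW : N ⊆ W.erase w := fun a ha => Finset.mem_erase.2 ⟨fun h => hwN (h ▸ ha), hN ha⟩
    rw [Finset.card_sdiff_of_subset hNW, Finset.card_erase_of_mem hwI, Finset.card_erase_of_mem hw] at h2
    have h3 := Finset.card_le_card hNW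
    rw [Finset.card_erase_of_mem hw] at h3
    have h4 : 0 < I.card := Finset.card_pos.2 ⟨w, hwI⟩
    have h5 : 0 < W.card := Finset.card_pos.2 ⟨w, hw⟩
    omega
  refine ⟨W \ I, Finset.sdiff_subset, ?_, fun L' hL' => ?_⟩
  · rw [Finset.card_sdiff_of_subset hIW]
    omega
  have hI : ∀ a ∈ I, a ∈ (W : Set V) \ L' := fun a ha =>
    ⟨hIW ha, fun haL => (Finset.mem_sdiff.1 (hL' haL)).2 ha⟩
  have hparI : ∀ a ∈ W, a ≠ w → par a ∈ (W : Set V) \ L' := fun a ha haw =>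
    hI _ (Finset.mem_image_of_mem _ (Finset.mem_erase.2 ⟨haw, ha⟩))
  intro S hS ⟨a, ha⟩ hcl
  have hstep : ∀ a ∈ (W : Set V) \ L', a ≠ w → (a ∈ S ↔ par a ∈ S) := fun a ha haw =>
    hcl a ha _ (hparI a ha.1 haw) (hpar a ha.1 haw).2.1
  have hroot : ∀ n, ∀ a ∈ (W : Set V) \ L', d a = n → (a ∈ S ↔ w ∈ S) := by
    intro n
    induction n with
    | zero =>
      intro a ha h0
      rw [hd0 a ha.1 h0]
    | succ n ih =>
      intro a ha hn
      by_cases haw : a = w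
      · rw [haw]
      rw [hstep a ha haw]
      refine ih _ (hparI a ha.1 haw) ?_
      have := (hpar a ha.1 haw).2.2
      omega
  refine hS.antisymm fun b hb => ?_
  rw [hroot _ b hb rfl, ← hroot _ a (hS ha) rfl]
  exact ha

end Graph

/-! ### Existence of lifts by induction on the number of rows and columns. -/

section Lifts

variable {R K : Type*} [CommRing R] [CommRing K]
  {X Y : Type*} {D : Set R} {P : Set K}
  {π : R →+* K}

/-- Adjacency in the bipartite graph of the nonzero entries of a matrix. -/
def bipartiteAdj (A : Matrix X Y K) : X ⊕ Y → X ⊕ Y → Prop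
  | .inl x, .inr y => A x y ≠ 0
  | .inr y, .inl x => A x y ≠ 0
  | _, _ => False

theorem bipartiteAdj_symm (A : Matrix X Y K) : ∀ a b, bipartiteAdj A a b → bipartiteAdj A b a := by
  rintro (x | y) (x' | y') h <;> exact h

theorem connOn_iff_connectedIn {A : Matrix X Y K} {W : Set (X ⊕ Y)} :
    ConnOn A (Sum.inl ⁻¹' W) (Sum.inr ⁻¹' W) ↔ ConnectedIn (bipartiteAdj A) W := by
  constructor
  · intro h S hS hne hcl
    obtain ⟨h1, h2⟩ := h (Sum.inl ⁻¹' S) (Set.preimage_mono hS) (Sum.inr ⁻¹' S)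
      (Set.preimage_mono hS) (by
        obtain ⟨a | a, ha⟩ := hne
        · exact Or.inl ⟨a, ha⟩
        · exact Or.inr ⟨a, ha⟩)
      (fun x hx y hy hxy => hcl (.inl x) hx (.inr y) hy hxy)
    ext (a | a)
    · exact Set.ext_iff.1 h1 a
    · exact Set.ext_iff.1 h2 a
  · intro h S hS T hT hne hcl
    have := h {v | Sum.elim (· ∈ S) (· ∈ T) v} (by
        rintro (a | a) ha
        · exact hS ha
        · exact hT ha) (by
        rcases hne with ⟨a, ha⟩ | ⟨a, ha⟩
        · exact ⟨.inl a, ha⟩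
        · exact ⟨.inr a, ha⟩) (by
        rintro (x | y) hx (x' | y') hy hxy
        · exact hxy.elim
        · exact hcl x hx y' hy hxy
        · exact (hcl x' hy y hx hxy).symm
        · exact hxy.elim)
    rw [← this]
    exact ⟨rfl, rfl⟩

/-- Among three removable leaves of the bipartite graph, two lie on the same side. -/
theorem ConnOn.exists_two_removable {A : Matrix X Y K} {s : Finset X} {t : Finset Y}
    (h : ConnOn A (s : Set X) (t : Set Y)) {x : X} (hx : x ∈ s) {N : Finset Y} (hN : N ⊆ t)
    (hadj : ∀ y ∈ N, A x y ≠ 0) (hcard : 3 ≤ N.card) :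
    (∃ u ∈ s, ∃ v ∈ s, u ≠ v ∧ ConnOn A ((s : Set X) \ {u, v}) t) ∨
      (∃ u ∈ t, ∃ v ∈ t, u ≠ v ∧ ConnOn A (s : Set X) ((t : Set Y) \ {u, v})) := by
  classical
  have hs : (Sum.inl ⁻¹' ((s.disjSum t : Finset (X ⊕ Y)) : Set (X ⊕ Y)) : Set X) = s := by
    ext; simp
  have ht : (Sum.inr ⁻¹' ((s.disjSum t : Finset (X ⊕ Y)) : Set (X ⊕ Y)) : Set Y) = t := by
    ext; simp
  have h' : ConnOn A (Sum.inl ⁻¹' ((s.disjSum t : Finset (X ⊕ Y)) : Set (X ⊕ Y)))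
      (Sum.inr ⁻¹' ((s.disjSum t : Finset (X ⊕ Y)) : Set (X ⊕ Y))) := by rwa [hs, ht]
  obtain ⟨L, hLW, hL3, hL⟩ := (connOn_iff_connectedIn.1 h').exists_leaves (bipartiteAdj_symm A)
    (w := .inl x) (by simpa using hx) (N := N.map ⟨Sum.inr, Sum.inr_injective⟩)
    (by
      intro a ha
      obtain ⟨y, hy, rfl⟩ := Finset.mem_map.1 ha
      simpa using hN hy) (by simp) (by
      intro a ha
      obtain ⟨y, hy, rfl⟩ := Finset.mem_map.1 ha
      exact hadj y hy) (by simpa using hcard)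
  rw [← Finset.card_toLeft_add_card_toRight] at hL3
  rcases (by omega : 1 < L.toLeft.card ∨ 1 < L.toRight.card) with hc | hc
  · left
    obtain ⟨u, hu, v, hv, huv⟩ := Finset.one_lt_card.1 hc
    rw [Finset.mem_toLeft] at hu hv
    refine ⟨u, by simpa using hLW hu, v, by simpa using hLW hv, huv, ?_⟩
    have := connOn_iff_connectedIn.2 (hL {.inl u, .inl v} (by
      intro a ha
      simp only [Finset.mem_insert, Finset.mem_singleton] at ha
      rcases ha with rfl | rfl <;> assumption))
    convert this using 1
    · ext; simp
    · ext; simp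
  · right
    obtain ⟨u, hu, v, hv, huv⟩ := Finset.one_lt_card.1 hc
    rw [Finset.mem_toRight] at hu hv
    refine ⟨u, by simpa using hLW hu, v, by simpa using hLW hv, huv, ?_⟩
    have := connOn_iff_connectedIn.2 (hL {.inr u, .inr v} (by
      intro a ha
      simp only [Finset.mem_insert, Finset.mem_singleton] at ha
      rcases ha with rfl | rfl <;> assumption))
    convert this using 1
    · ext; simp
    · ext; simp

theorem IsLifting.liftable_of_removable_columns (hL : IsLifting D P π) [Nontrivial R] [Nontrivial K]
    {A : Matrix X Y K} {s : Finset X} {t : Finset Y}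
    (hsub : ∀ s' ⊆ s, ∀ t' ⊆ t, s'.card + t'.card < s.card + t.card →
      Liftable D π A (s' : Set X) (t' : Set Y))
    (hA : MinorsIn P (s : Set X) (t : Set Y) A) {u v : Y} (hu : u ∈ t) (hv : v ∈ t) (huv : u ≠ v)
    (hconn : ConnOn A (s : Set X) ((t : Set Y) \ {u, v})) :
    Liftable D π A (s : Set X) (t : Set Y) := by
  classical
  let t₀ := (t.erase u).erase v
  have ht₀ : ((t₀ : Finset Y) : Set Y) = (t : Set Y) \ {u, v} := by
    ext y
    simp only [t₀, Finset.coe_erase, Set.mem_sdiff, Set.mem_singleton_iff, Set.mem_insert_iff]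
    tauto
  have ht : insert u (insert v (t₀ : Set Y)) = t := by
    ext y
    simp only [ht₀, Set.mem_sdiff, Set.mem_insert_iff, Set.mem_singleton_iff, Finset.mem_coe]
    constructor
    · rintro (rfl | rfl | h)
      · exact hu
      · exact hv
      · exact h.1
    · tauto
  have e1 : insert u (t₀ : Set Y) = (t.erase v : Finset Y) := by
    ext y
    simp only [ht₀, Set.mem_sdiff, Set.mem_insert_iff, Set.mem_singleton_iff, Finset.mem_coe,
      Finset.mem_erase]
    constructor
    · rintro (rfl | h)
      · exact ⟨huv, hu⟩
      · tauto
    · tauto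
  have e2 : insert v (t₀ : Set Y) = (t.erase u : Finset Y) := by
    ext y
    simp only [ht₀, Set.mem_sdiff, Set.mem_insert_iff, Set.mem_singleton_iff, Finset.mem_coe,
      Finset.mem_erase]
    constructor
    · rintro (rfl | h)
      · exact ⟨huv.symm, hv⟩
      · tauto
    · tauto
  have := hL.liftable_of_two_columns (A := A) (s := s) (t := t₀) (u := u) (v := v)
    (by simp [t₀]) (by simp [t₀]) huv (by rwa [ht]) (by rwa [ht₀]) ?_ ?_
  · rwa [ht] at this
  · rw [e1]
    exact hsub s subset_rfl _ (Finset.erase_subset _ _) (by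
      have := Finset.card_erase_lt_of_mem hv
      omega)
  · rw [e2]
    exact hsub s subset_rfl _ (Finset.erase_subset _ _) (by
      have := Finset.card_erase_lt_of_mem hu
      omega)

theorem IsLifting.liftable_of_three_le_degree (hL : IsLifting D P π) [Nontrivial R] [Nontrivial K]
    {A : Matrix X Y K} {s : Finset X} {t : Finset Y}
    (hsub : ∀ s' ⊆ s, ∀ t' ⊆ t, s'.card + t'.card < s.card + t.card →
      Liftable D π A (s' : Set X) (t' : Set Y))
    (hA : MinorsIn P (s : Set X) (t : Set Y) A) (hconn : ConnOn A (s : Set X) (t : Set Y))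
    {x : X} (hx : x ∈ s) {N : Finset Y} (hN : N ⊆ t)
    (hadj : ∀ y ∈ N, A x y ≠ 0) (hcard : 3 ≤ N.card) :
    Liftable D π A (s : Set X) (t : Set Y) := by
  rcases hconn.exists_two_removable hx hN hadj hcard with
    ⟨u, hu, v, hv, huv, h⟩ | ⟨u, hu, v, hv, huv, h⟩
  · exact (hL.liftable_of_removable_columns (A := Aᵀ)
      (fun t' ht' s' hs' hlt => (hsub s' hs' t' ht' (by omega)).transpose)
      hA.transpose hu hv huv h.transpose).transpose
  · exact hL.liftable_of_removable_columns hsub hA hu hv huv h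

/-- Either the cycle is the whole graph, or by connectedness an edge leaves it, and its end on the
cycle has degree at least 3. -/
theorem IsLifting.liftable_of_four_cycle (hL : IsLifting D P π) [Nontrivial R] [Nontrivial K]
    {A : Matrix X Y K} {s : Finset X} {t : Finset Y}
    (hsub : ∀ s' ⊆ s, ∀ t' ⊆ t, s'.card + t'.card < s.card + t.card →
      Liftable D π A (s' : Set X) (t' : Set Y))
    (hA : MinorsIn P (s : Set X) (t : Set Y) A) (hconn : ConnOn A (s : Set X) (t : Set Y))
    {x x' : X} {y y' : Y} (hx : x ∈ s) (hx' : x' ∈ s) (hy : y ∈ t) (hy' : y' ∈ t)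
    (hxx : x ≠ x') (hyy : y ≠ y') (h₁ : A x y ≠ 0) (h₂ : A x y' ≠ 0) (h₃ : A x' y ≠ 0)
    (h₄ : A x' y' ≠ 0) : Liftable D π A (s : Set X) (t : Set Y) := by
  classical
  have hs2 : ({x, x'} : Set X) ⊆ s := by rintro i (rfl | rfl) <;> assumption
  have ht2 : ({y, y'} : Set Y) ⊆ t := by rintro i (rfl | rfl) <;> assumption
  by_cases hcl : ∀ i ∈ (s : Set X), ∀ j ∈ (t : Set Y), A i j ≠ 0 →
      (i ∈ ({x, x'} : Set X) ↔ j ∈ ({y, y'} : Set Y))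
  · obtain ⟨e1, e2⟩ := hconn _ hs2 _ ht2 (Or.inl ⟨x, by simp⟩) hcl
    rw [← e1, ← e2]
    rw [← e1, ← e2] at hA
    exact hL.liftable_pair hxx hyy hA h₁ h₂ h₃ h₄
  push Not at hcl
  obtain ⟨i, hi, j, hj, hij, hcl⟩ := hcl
  have hsubT : ∀ t' ⊆ t, ∀ s' ⊆ s, t'.card + s'.card < t.card + s.card →
      Liftable D π Aᵀ (t' : Set Y) (s' : Set X) :=
    fun t' ht' s' hs' hlt => (hsub s' hs' t' ht' (by omega)).transpose
  rcases hcl with ⟨hi2, hj2⟩ | ⟨hi2, hj2⟩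
  · have hjy : j ≠ y := fun h => hj2 (Or.inl h)
    have hjy' : j ≠ y' := fun h => hj2 (Or.inr h)
    refine hL.liftable_of_three_le_degree hsub hA hconn hi (N := {j, y, y'}) ?_ ?_
      (by rw [Finset.card_eq_three.2 ⟨j, y, y', hjy, hjy', hyy, rfl⟩])
    · intro k hk
      simp only [Finset.mem_insert, Finset.mem_singleton] at hk
      rcases hk with rfl | rfl | rfl <;> assumption
    · intro k hk
      simp only [Finset.mem_insert, Finset.mem_singleton] at hk
      rcases hi2 with rfl | hi2
      · rcases hk with rfl | rfl | rfl <;> assumption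
      · rw [Set.mem_singleton_iff] at hi2
        subst hi2
        rcases hk with rfl | rfl | rfl <;> assumption
  · have hix : i ≠ x := fun h => hi2 (Or.inl h)
    have hix' : i ≠ x' := fun h => hi2 (Or.inr h)
    refine (hL.liftable_of_three_le_degree hsubT hA.transpose hconn.transpose hj
      (N := {i, x, x'}) ?_ ?_
      (by rw [Finset.card_eq_three.2 ⟨i, x, x', hix, hix', hxx, rfl⟩])).transpose
    · intro k hk
      simp only [Finset.mem_insert, Finset.mem_singleton] at hk
      rcases hk with rfl | rfl | rfl <;> assumption
    · intro k hk
      simp only [Finset.mem_insert, Finset.mem_singleton] at hk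
      rw [transpose_apply]
      rcases hj2 with rfl | hj2
      · rcases hk with rfl | rfl | rfl <;> assumption
      · rw [Set.mem_singleton_iff] at hj2
        subst hj2
        rcases hk with rfl | rfl | rfl <;> assumption

/-- A connected bipartite graph that is not a star contains a path with four vertices. -/
theorem ConnOn.exists_path {A : Matrix X Y K} {s : Set X} {t : Set Y} (h : ConnOn A s t)
    (hs : s.Nontrivial) (ht : t.Nontrivial) :
    ∃ x ∈ s, ∃ x' ∈ s, ∃ y ∈ t, ∃ y' ∈ t, x ≠ x' ∧ y ≠ y' ∧ A x y ≠ 0 ∧ A x y' ≠ 0 ∧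
      A x' y ≠ 0 := by
  by_contra hcon
  push Not at hcon
  have hedge : ∃ x ∈ s, ∃ y ∈ t, A x y ≠ 0 := by
    by_contra hno
    push Not at hno
    obtain ⟨x, hx⟩ := hs.nonempty
    obtain ⟨y, hy⟩ := ht.nonempty
    have := (h {x} (by simpa using hx) ∅ (Set.empty_subset _) (Or.inl (by simp))
      fun i hi j hj hij => absurd (hno i hi j hj) hij).2
    rw [← this] at hy
    exact hy
  obtain ⟨x, hx, y, hy, hxy⟩ := hedge
  by_cases hdeg : ∃ y' ∈ t, y' ≠ y ∧ A x y' ≠ 0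
  · obtain ⟨y', hy', hyy, hxy'⟩ := hdeg
    have := (h {x} (by simpa using hx) {j ∈ t | A x j ≠ 0} (fun j hj => hj.1) (Or.inl (by simp)) (by
      intro i hi j hj hij
      constructor
      · rintro rfl
        exact ⟨hj, hij⟩
      · rintro ⟨_, hxj⟩
        by_contra hix
        by_cases hjy : j = y
        · subst hjy
          exact hij (hcon x hx i hi j hj y' hy' (Ne.symm hix) hyy.symm hxj hxy')
        · exact hij (hcon x hx i hi j hj y hy (Ne.symm hix) hjy hxj hxy))).1
    rw [← this] at hs
    exact Set.not_nontrivial_singleton hs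
  · push Not at hdeg
    have := (h {i ∈ s | A i y ≠ 0} (fun j hj => hj.1) {y} (by simpa using hy) (Or.inr (by simp)) (by
      intro i hi j hj hij
      constructor
      · rintro ⟨_, hiy⟩
        by_contra hjy
        by_cases hix : i = x
        · subst hix
          exact hij (hdeg j hj hjy)
        · exact hxy (hcon i hi x hx y hy j hj hix (Ne.symm hjy) hiy hij)
      · rintro rfl
        exact ⟨hi, hij⟩)).2
    rw [← this] at ht
    exact Set.not_nontrivial_singleton ht

/-- The lift theorem. -/
theorem IsLifting.liftable (hL : IsLifting D P π) [Nontrivial R] [Nontrivial K] (n : ℕ) :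
    ∀ (A : Matrix X Y K) (s : Finset X) (t : Finset Y), s.card + t.card = n →
      MinorsIn P (s : Set X) (t : Set Y) A → Liftable D π A (s : Set X) (t : Set Y) := by
  classical
  induction n using Nat.strong_induction_on with
  | _ n ih =>
  intro A s t hn hA
  -- Stated for every B because the pivoted matrix is used as well, with the same row and column
  -- sets.
  have hsub : ∀ B : Matrix X Y K, MinorsIn P (s : Set X) (t : Set Y) B → ∀ s' ⊆ s, ∀ t' ⊆ t,
      s'.card + t'.card < s.card + t.card → Liftable D π B (s' : Set X) (t' : Set Y) :=
    fun B hB s' hs' t' ht' hlt => ih _ (by omega) B s' t' rfl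
      (hB.mono (Finset.coe_subset.2 hs') (Finset.coe_subset.2 ht'))
  by_cases hconn : ConnOn A (s : Set X) (t : Set Y)
  swap
  · rw [ConnOn] at hconn
    push Not at hconn
    obtain ⟨S, hS, T, hT, hne, hcl, hST⟩ := hconn
    lift S to Finset X using s.finite_toSet.subset hS
    lift T to Finset Y using t.finite_toSet.subset hT
    rw [Finset.coe_subset] at hS hT
    have hS1 := Finset.card_le_card hS
    have hT1 := Finset.card_le_card hT
    refine hL.liftable_of_blocks (S := S) (T := T) hcl (hsub A hA S hS T hT ?_) ?_
    · by_contra hge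
      have e1 := Finset.eq_of_subset_of_card_le hS (by omega)
      have e2 := Finset.eq_of_subset_of_card_le hT (by omega)
      exact hST (by rw [e1]) (by rw [e2])
    · rw [← Finset.coe_sdiff, ← Finset.coe_sdiff]
      refine hsub A hA _ Finset.sdiff_subset _ Finset.sdiff_subset ?_
      rw [Finset.card_sdiff_of_subset hS, Finset.card_sdiff_of_subset hT]
      have : 0 < S.card ∨ 0 < T.card := by
        rcases hne with h | h
        · exact Or.inl (Finset.card_pos.2 (by simpa using h))
        · exact Or.inr (Finset.card_pos.2 (by simpa using h))
      omega
  by_cases ht : (t : Set Y).Subsingleton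
  · exact hL.liftable_of_subsingleton hA ht
  by_cases hs : (s : Set X).Subsingleton
  · exact (hL.liftable_of_subsingleton hA.transpose hs).transpose
  rw [Set.not_subsingleton_iff] at hs ht
  obtain ⟨x, hx, x', hx', y, hy, y', hy', hxx, hyy, h₁, h₂, h₃⟩ := hconn.exists_path hs ht
  by_cases h₄ : A x' y' ≠ 0
  · exact hL.liftable_of_four_cycle (hsub A hA) hA hconn hx hx' hy hy' hxx hyy h₁ h₂ h₃ h₄
  rw [not_not] at h₄
  have hP := hL.target
  -- The path x', y, x, y' has no closing edge; pivoting on its middle edge (x, y) creates one and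
  -- keeps the other three entries nonzero.
  obtain ⟨c, hcP, hc⟩ := hP.exists_inv (hA.entry hx hy) h₁
  have hc0 : c ≠ 0 := by rintro rfl; simp at hc
  have hA' := hA.pivot hP hx hy hcP hc
  refine hL.liftable_of_pivot hx hy hc (hL.liftable_of_four_cycle (hsub _ hA') hA'
    (hconn.pivot hx hy hc) hx hx' hy hy' hxx hyy ?_ ?_ ?_ ?_)
  · rwa [pivot_apply_self]
  · rw [pivot_apply_row _ _ hyy.symm]
    exact hP.mul_ne_zero hcP hc0 h₂
  · rw [pivot_apply_col _ _ hxx.symm, neg_ne_zero]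
    exact hP.mul_ne_zero (hA.entry hx' hy) h₃ hc0
  · rw [pivot_apply_of_ne _ _ hxx.symm hyy.symm, h₄, zero_sub, neg_ne_zero]
    exact hP.mul_ne_zero (hP.mul_mem (hA.entry hx' hy) hcP)
      (hP.mul_ne_zero (hA.entry hx' hy) h₃ hc0) h₂

end Lifts

end

/-! ### Lifting from `GF(3) ⊗ GF(5)` to the dyadic numbers -/

section Dyadic

/-- For k ≥ 1 the left side is odd, so it must be 1; a negative j is excluded by parity after
clearing denominators. -/
theorem two_pow_sub_one_eq {k : ℕ} (hk : k ≠ 0) {j : ℤ}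
    (h : (2 : ℚ) ^ k - 1 = 2 ^ j ∨ (2 : ℚ) ^ k - 1 = -2 ^ j) : k = 1 := by
  obtain ⟨a, rfl⟩ : ∃ a, k = a + 1 := ⟨k - 1, by omega⟩
  rcases le_or_gt 0 j with hj | hj
  · obtain ⟨i, rfl⟩ := Int.eq_ofNat_of_zero_le hj
    have h' : (2 : ℤ) ^ (a + 1) - 1 = 2 ^ i ∨ (2 : ℤ) ^ (a + 1) - 1 = -2 ^ i := by
      simp only [zpow_natCast] at h
      exact_mod_cast h
    have hi : i = 0 := by
      by_contra hi
      obtain ⟨b, rfl⟩ : ∃ b, i = b + 1 := ⟨i - 1, by omega⟩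
      rw [pow_succ, pow_succ] at h'
      omega
    subst hi
    rw [pow_succ, pow_zero] at h'
    have hpos : (0 : ℤ) < 2 ^ a := by positivity
    have ha : (2 : ℤ) ^ a = 1 := by omega
    have : a = 0 := by
      by_contra ha0
      obtain ⟨b, rfl⟩ : ∃ b, a = b + 1 := ⟨a - 1, by omega⟩
      rw [pow_succ] at ha
      omega
    omega
  · exfalso
    obtain ⟨i, hi⟩ : ∃ i : ℕ, j = -((i + 1 : ℕ) : ℤ) := ⟨(-j).toNat - 1, by omega⟩
    have h2 : (2 : ℚ) ^ j * 2 ^ (i + 1) = 1 := by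
      rw [hi, zpow_neg, zpow_natCast]
      exact inv_mul_cancel₀ (by positivity)
    have h' : ((2 : ℤ) ^ (a + 1) - 1) * 2 ^ (i + 1) = 1 ∨
        ((2 : ℤ) ^ (a + 1) - 1) * 2 ^ (i + 1) = -1 := by
      rcases h with h | h
      · left
        rw [← h] at h2
        exact_mod_cast h2
      · right
        have : ((2 : ℚ) ^ (a + 1) - 1) * 2 ^ (i + 1) = -1 := by rw [h, neg_mul, h2]
        exact_mod_cast this
    rw [pow_succ (2 : ℤ) i, ← mul_assoc] at h'
    omega

theorem two_pow_add_one_ne {k : ℕ} (hk : k ≠ 0) (j : ℤ) : (2 : ℚ) ^ k + 1 ≠ 2 ^ j := by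
  intro h
  obtain ⟨a, rfl⟩ : ∃ a, k = a + 1 := ⟨k - 1, by omega⟩
  rcases le_or_gt 0 j with hj | hj
  · obtain ⟨i, rfl⟩ := Int.eq_ofNat_of_zero_le hj
    have h' : (2 : ℤ) ^ (a + 1) + 1 = 2 ^ i := by
      simp only [zpow_natCast] at h
      exact_mod_cast h
    have hi : i = 0 := by
      by_contra hi
      obtain ⟨b, rfl⟩ : ∃ b, i = b + 1 := ⟨i - 1, by omega⟩
      rw [pow_succ, pow_succ] at h'
      omega
    subst hi
    have : (0 : ℤ) < 2 ^ (a + 1) := by positivity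
    rw [pow_zero] at h'
    omega
  · have h1 : (2 : ℚ) ^ j < 1 := zpow_lt_one_of_neg₀ one_lt_two hj
    have h2 : (0 : ℚ) < 2 ^ (a + 1) := by positivity
    linarith

/-- The powers of `2` with fundamental value. -/
theorem exponent_of_one_sub {n m : ℤ}
    (h : (1 : ℚ) - 2 ^ n = 0 ∨ (1 : ℚ) - 2 ^ n = 2 ^ m ∨ (1 : ℚ) - 2 ^ n = -2 ^ m) :
    n = 0 ∨ n = 1 ∨ n = -1 := by
  rcases lt_trichotomy n 0 with hn | hn | hn
  · right; right
    obtain ⟨k, hk⟩ : ∃ k : ℕ, n = -(k : ℤ) := ⟨(-n).toNat, by omega⟩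
    have h2 : (2 : ℚ) ^ n * 2 ^ k = 1 := by
      rw [hk, zpow_neg, zpow_natCast]
      exact inv_mul_cancel₀ (by positivity)
    have hlt : (2 : ℚ) ^ n < 1 := zpow_lt_one_of_neg₀ one_lt_two hn
    have : k = 1 := by
      refine two_pow_sub_one_eq (by omega) (j := m + k) ?_
      rw [zpow_add₀ two_ne_zero, zpow_natCast]
      rcases h with h | h | h
      · linarith
      · left; rw [← h]; linear_combination h2
      · right; linear_combination 2 ^ k * h + h2
    omega
  · exact Or.inl hn
  · right; left
    obtain ⟨k, rfl⟩ := Int.eq_ofNat_of_zero_le hn.le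
    have hlt : (1 : ℚ) < 2 ^ (k : ℤ) := one_lt_zpow₀ one_lt_two hn
    have : k = 1 := by
      refine two_pow_sub_one_eq (by omega) (j := m) ?_
      rw [← zpow_natCast]
      rcases h with h | h | h
      · linarith
      · right; linarith
      · left; linarith
    omega

theorem exponent_of_one_add {n m : ℤ}
    (h : (1 : ℚ) + 2 ^ n = 0 ∨ (1 : ℚ) + 2 ^ n = 2 ^ m ∨ (1 : ℚ) + 2 ^ n = -2 ^ m) :
    n = 0 := by
  have hpos : (0 : ℚ) < 2 ^ n := by positivity
  have hpos' : (0 : ℚ) < 2 ^ m := by positivity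
  obtain h : (1 : ℚ) + 2 ^ n = 2 ^ m := by
    rcases h with h | h | h
    · linarith
    · exact h
    · linarith
  rcases lt_trichotomy n 0 with hn | hn | hn
  · exfalso
    obtain ⟨k, hk⟩ : ∃ k : ℕ, n = -(k : ℤ) := ⟨(-n).toNat, by omega⟩
    have h2 : (2 : ℚ) ^ n * 2 ^ k = 1 := by
      rw [hk, zpow_neg, zpow_natCast]
      exact inv_mul_cancel₀ (by positivity)
    refine two_pow_add_one_ne (k := k) (by omega) (m + k) ?_
    rw [zpow_add₀ two_ne_zero, zpow_natCast, ← h]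
    linear_combination -h2
  · exact hn
  · exfalso
    obtain ⟨k, rfl⟩ := Int.eq_ofNat_of_zero_le hn.le
    refine two_pow_add_one_ne (k := k) (by omega) m ?_
    rw [← h, zpow_natCast, add_comm]

/-- The ring containing `GF(3) ⊗ GF(5)`. -/
abbrev ResidueRing : Type := ZMod 3 × ZMod 5

/-- The ring in which elements of `GF(3) ⊗ GF(5)` are paired with rational lifts. -/
abbrev LiftRing : Type := ResidueRing × ℚ

/-- The underlying set of `GF(3) ⊗ GF(5)`. -/
def residueCarrier : Set ResidueRing := {x | x.1 = 0 ↔ x.2 = 0}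

instance : DecidablePred (· ∈ residueCarrier) := fun x =>
  inferInstanceAs (Decidable (x.1 = 0 ↔ x.2 = 0))

theorem isUnitCarrier_residueCarrier : IsUnitCarrier residueCarrier where
  zero_mem := by decide
  one_mem := by decide
  neg_mem {x} := (by decide : ∀ x : ResidueRing, x ∈ residueCarrier → -x ∈ residueCarrier) x
  mul_mem {x y} := (by decide : ∀ x y : ResidueRing, x ∈ residueCarrier → y ∈ residueCarrier →
    x * y ∈ residueCarrier) x y
  exists_inv {x} := (by decide : ∀ x : ResidueRing, x ∈ residueCarrier → x ≠ 0 →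
    ∃ y ∈ residueCarrier, x * y = 1) x

/-- The unit `2`. -/
def liftTwo : LiftRingˣ where
  val := 2
  -- The inverses of 2 modulo 3 and modulo 5 are 2 and 3.
  inv := ((2, 3), 1 / 2)
  val_inv := by
    refine Prod.ext (by decide) ?_
    change (2 : ℚ) * (1 / 2) = 1
    norm_num
  inv_val := by
    refine Prod.ext (by decide) ?_
    change (1 / 2 : ℚ) * 2 = 1
    norm_num

/-- The elements of the dyadic partial field, paired with their residues. -/
def liftCarrier : Set LiftRing := PartialField.ringCarrier LiftRing {liftTwo}

theorem PartialField.mem_ringCarrier_singleton {R : Type*} [CommRing R] {u : Rˣ} {x : R} :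
    x ∈ PartialField.ringCarrier R {u} ↔
      x = 0 ∨ ∃ n : ℤ, x = ((u ^ n : Rˣ) : R) ∨ x = -((u ^ n : Rˣ) : R) := by
  unfold PartialField.ringCarrier
  rw [Set.mem_ofPred_eq, Set.singleton_union]
  refine or_congr Iff.rfl ⟨?_, ?_⟩
  · rintro ⟨g, hg, rfl⟩
    obtain ⟨m, n, rfl⟩ := Subgroup.mem_closure_pair.1 hg
    refine ⟨m, ?_⟩
    rcases Int.even_or_odd n with h | h
    · left; rw [h.neg_one_zpow, mul_one]
    · right; rw [h.neg_one_zpow]; simp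
  · rintro ⟨n, rfl | rfl⟩
    · exact ⟨_, Subgroup.mem_closure_pair.2 ⟨n, 0, rfl⟩, by simp⟩
    · exact ⟨_, Subgroup.mem_closure_pair.2 ⟨n, 1, rfl⟩, by simp⟩

theorem PartialField.isUnitCarrier_ringCarrier {R : Type*} [CommRing R] (S : Set Rˣ) :
    IsUnitCarrier (PartialField.ringCarrier R S) where
  zero_mem := Or.inl rfl
  one_mem := PartialField.ringCarrier_one
  neg_mem := PartialField.ringCarrier_neg
  mul_mem := PartialField.ringCarrier_mul
  exists_inv := by
    rintro x (rfl | ⟨g, hg, rfl⟩) h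
    · exact absurd rfl h
    · exact ⟨_, Or.inr ⟨g⁻¹, inv_mem hg, rfl⟩, g.mul_inv⟩

theorem mem_liftCarrier_of_zpow (n : ℤ) : ((liftTwo ^ n : LiftRingˣ) : LiftRing) ∈ liftCarrier :=
  PartialField.mem_ringCarrier_singleton.2 (Or.inr ⟨n, Or.inl rfl⟩)

theorem liftTwo_zpow_snd (n : ℤ) : ((liftTwo ^ n : LiftRingˣ) : LiftRing).2 = 2 ^ n := by
  have h : ((liftTwo ^ n : LiftRingˣ) : LiftRing).2 =
    ((Units.map (RingHom.snd ResidueRing ℚ).toMonoidHom (liftTwo ^ n) : ℚˣ) : ℚ) := rfl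
  rw [h, map_zpow, Units.val_zpow_eq_zpow_val]
  rfl

theorem snd_of_mem_liftCarrier {x : LiftRing} (h : x ∈ liftCarrier) :
    ∃ m : ℤ, x.2 = 0 ∨ x.2 = 2 ^ m ∨ x.2 = -2 ^ m := by
  rcases PartialField.mem_ringCarrier_singleton.1 h with rfl | ⟨n, rfl | rfl⟩
  · exact ⟨0, Or.inl rfl⟩
  · exact ⟨n, Or.inr (Or.inl (liftTwo_zpow_snd n))⟩
  · exact ⟨n, Or.inr (Or.inr (by rw [Prod.snd_neg, liftTwo_zpow_snd]))⟩

/-- The element `1 / 2`. -/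
def liftHalf : LiftRing := ((2, 3), 1 / 2)

/-- The rational component decides: 1 - 2^n is 0 or ± a power of 2 only for n = 0, 1, -1, and 1 +
2^n only for n = 0. -/
theorem fundamental_liftCarrier {p : LiftRing} (h : Fundamental liftCarrier p) :
    p = 1 ∨ p = 2 ∨ p = liftHalf ∨ p = -1 := by
  obtain ⟨hp, hp0, h1⟩ := h
  obtain ⟨m, hm⟩ := snd_of_mem_liftCarrier h1
  rcases PartialField.mem_ringCarrier_singleton.1 hp with rfl | ⟨n, rfl | rfl⟩
  · exact absurd rfl hp0
  · rw [Prod.snd_sub, liftTwo_zpow_snd] at hm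
    rcases exponent_of_one_sub hm with rfl | rfl | rfl
    · left; simp
    · right; left; rw [zpow_one]; rfl
    · right; right; left; rw [zpow_neg_one]; rfl
  · rw [sub_neg_eq_add, Prod.snd_add, liftTwo_zpow_snd] at hm
    obtain rfl := exponent_of_one_add hm
    right; right; right; simp

theorem fst_mem_of_mem_liftCarrier {x : LiftRing} (h : x ∈ liftCarrier) :
    x.1 ∈ residueCarrier := by
  have hunit : ∀ u : ResidueRingˣ, (u : ResidueRing) ∈ residueCarrier := fun u =>
    (by decide : ∀ x y : ResidueRing, x * y = 1 → x ∈ residueCarrier) _ _ u.mul_inv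
  rcases h with rfl | ⟨g, _, rfl⟩
  · exact isUnitCarrier_residueCarrier.zero_mem
  · exact hunit (Units.map (RingHom.fst ResidueRing ℚ).toMonoidHom g)

theorem fst_ne_zero_of_mem_liftCarrier {x : LiftRing} (h : x ∈ liftCarrier) (hx : x.1 = 0) :
    x = 0 := by
  rcases h with rfl | ⟨g, _, rfl⟩
  · rfl
  · exact absurd hx (Units.map (RingHom.fst ResidueRing ℚ).toMonoidHom g).ne_zero

theorem two_mem_liftCarrier : (2 : LiftRing) ∈ liftCarrier := by
  have := mem_liftCarrier_of_zpow 1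
  rwa [zpow_one] at this

theorem half_mem_liftCarrier : liftHalf ∈ liftCarrier := by
  have := mem_liftCarrier_of_zpow (-1)
  rwa [zpow_neg_one] at this

theorem two_mul_liftHalf : 2 * liftHalf = 1 := liftTwo.mul_inv

/-- The only other products of two fundamental elements are 4 and 1/4. They are ruled out because a
b - a + 1 is then 3 or 3/4, which vanishes modulo 3 but not modulo 5. -/
theorem shortProduct_liftCarrier {p : LiftRing} (h : ShortProduct liftCarrier p) :
    p = 1 ∨ p = 2 ∨ p = liftHalf ∨ p = -1 ∨ p = -2 ∨ p = -liftHalf := by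
  have h2 := two_mul_liftHalf
  rcases h with h | h | ⟨a, b, ha, hb, hab, rfl⟩
  · rcases fundamental_liftCarrier h with rfl | rfl | rfl | rfl <;> simp
  · rcases fundamental_liftCarrier h with h | h | h | h <;>
      rw [neg_eq_iff_eq_neg] at h <;> simp [h]
  · have hK := fst_mem_of_mem_liftCarrier hab
    rcases fundamental_liftCarrier ha with rfl | rfl | rfl | rfl <;>
      rcases fundamental_liftCarrier hb with rfl | rfl | rfl | rfl <;>
      first
        | simp
        | (exact absurd hK (by decide))
        | (left; exact h2)

theorem isLifting_liftCarrier :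
    IsLifting liftCarrier residueCarrier (RingHom.fst ResidueRing ℚ) where
  source := PartialField.isUnitCarrier_ringCarrier _
  target := isUnitCarrier_residueCarrier
  map_mem := fst_mem_of_mem_liftCarrier
  ker := fst_ne_zero_of_mem_liftCarrier
  surj := by
    have hD : IsUnitCarrier liftCarrier := PartialField.isUnitCarrier_ringCarrier _
    have h4 : (4 : LiftRing) ∈ liftCarrier := by
      have := hD.mul_mem two_mem_liftCarrier two_mem_liftCarrier
      norm_num at this
      exact this
    intro p hp
    have key : ∀ p : ResidueRing, p ∈ residueCarrier → p = 0 ∨ p = 1 ∨ p = -1 ∨ p = 2 ∨ p = -2 ∨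
      p = 4 ∨ p = -4 ∨ p = (2, 3) ∨ p = -(2, 3) := by decide
    rcases key p hp with rfl | rfl | rfl | rfl | rfl | rfl | rfl | rfl | rfl
    · exact ⟨0, hD.zero_mem, rfl⟩
    · exact ⟨1, hD.one_mem, rfl⟩
    · exact ⟨-1, hD.neg_mem hD.one_mem, rfl⟩
    · exact ⟨2, two_mem_liftCarrier, rfl⟩
    · exact ⟨-2, hD.neg_mem two_mem_liftCarrier, rfl⟩
    · exact ⟨4, h4, rfl⟩
    · exact ⟨-4, hD.neg_mem h4, rfl⟩
    · exact ⟨liftHalf, half_mem_liftCarrier, rfl⟩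
    · exact ⟨-liftHalf, hD.neg_mem half_mem_liftCarrier, rfl⟩
  fundamental_inj := by
    intro p q hp hq h
    rcases fundamental_liftCarrier hp with rfl | rfl | rfl | rfl <;>
      rcases fundamental_liftCarrier hq with rfl | rfl | rfl | rfl <;>
      first
        | rfl
        | (exact absurd h (by decide))
  fundamental_surj := by
    have hD : IsUnitCarrier liftCarrier := PartialField.isUnitCarrier_ringCarrier _
    have h2 := two_mul_liftHalf
    intro p ⟨hp, hp0, hp1⟩
    have key : ∀ p : ResidueRing, p ∈ residueCarrier → p ≠ 0 → 1 - p ∈ residueCarrier →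
      p = 1 ∨ p = 2 ∨ p = (2, 3) ∨ p = -1 := by decide
    rcases key p hp hp0 hp1 with rfl | rfl | rfl | rfl
    · exact ⟨1, ⟨hD.one_mem, one_ne_zero, by simpa using hD.zero_mem⟩, rfl⟩
    · refine ⟨2, ⟨two_mem_liftCarrier, two_ne_zero, ?_⟩, rfl⟩
      convert hD.neg_mem hD.one_mem using 1
      ring
    · refine ⟨liftHalf, ⟨half_mem_liftCarrier, ?_, ?_⟩, rfl⟩
      · intro h
        rw [h, mul_zero] at h2
        exact zero_ne_one h2
      · convert half_mem_liftCarrier using 1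
        linear_combination -h2
    · refine ⟨-1, ⟨hD.neg_mem hD.one_mem, neg_ne_zero.2 one_ne_zero, ?_⟩, rfl⟩
      convert two_mem_liftCarrier using 1
      ring
  short_sub := by
    have hD : IsUnitCarrier liftCarrier := PartialField.isUnitCarrier_ringCarrier _
    have h2 := two_mul_liftHalf
    have hmem : ∀ y : LiftRing, y = 0 ∨ y = 1 ∨ y = 2 ∨ y = 2 * 2 ∨ y = liftHalf → y ∈ liftCarrier := by
      rintro y (rfl | rfl | rfl | rfl | rfl)
      · exact hD.zero_mem
      · exact hD.one_mem
      · exact two_mem_liftCarrier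
      · exact hD.mul_mem two_mem_liftCarrier two_mem_liftCarrier
      · exact half_mem_liftCarrier
    intro p q hp hq h
    have h' : (q - p).1 ∈ residueCarrier := h
    have h2' : 1 - liftHalf = liftHalf := by linear_combination -h2
    have h2'' : liftHalf + liftHalf = 1 := by linear_combination h2
    -- Of the 36 differences, those that are not 0 or ±1, ±2, ±4, ±1/2 equal ±3, ±3/2 or ±5/2; each
    -- of these vanishes modulo exactly one of 3 and 5.
    rcases shortProduct_liftCarrier hp with rfl | rfl | rfl | rfl | rfl | rfl <;>
      rcases shortProduct_liftCarrier hq with rfl | rfl | rfl | rfl | rfl | rfl <;>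
      first
        | (exact absurd h' (by decide))
        | (refine hmem _ (Or.inl ?_); ring1)
        | (refine hmem _ (Or.inr (Or.inl ?_)); first | ring1 | linear_combination h2'')
        | (refine hmem _ (Or.inr (Or.inr (Or.inl ?_))); ring1)
        | (refine hmem _ (Or.inr (Or.inr (Or.inr (Or.inl ?_)))); ring1)
        | (refine hmem _ (Or.inr (Or.inr (Or.inr (Or.inr ?_)))); linear_combination h2')
        | (refine hD.neg_mem_iff.1 (hmem _ (Or.inr (Or.inl ?_))); first | ring1 | linear_combination h2'')
        | (refine hD.neg_mem_iff.1 (hmem _ (Or.inr (Or.inr (Or.inl ?_)))); ring1)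
        | (refine hD.neg_mem_iff.1 (hmem _ (Or.inr (Or.inr (Or.inr (Or.inl ?_))))); ring1)
        | (refine hD.neg_mem_iff.1 (hmem _ (Or.inr (Or.inr (Or.inr (Or.inr ?_))))); linear_combination h2')

end Dyadic

/-! ### Sums and determinants in partial fields realized in rings -/

namespace PartialField

section Sums

/-- One leaf r of the tree is replaced by a node with leaves p and q. -/
theorem association_replace {P : Type*} {padd : P → P → Part P} {p q r x : P} (hr : r ∈ padd p q)
    {S : Multiset P} (h : Association padd S x) :
    ∀ T, S = r ::ₘ T → Association padd (p ::ₘ q ::ₘ T) x := by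
  have hpq : Association padd {p, q} r :=
    Association.node (S := {p}) (T := {q}) (.leaf p) (.leaf q) hr
  induction h with
  | leaf a =>
    intro T hT
    obtain ⟨rfl, rfl⟩ : r = a ∧ T = 0 := by
      have h1 := congrArg Multiset.card hT
      rw [Multiset.card_singleton, Multiset.card_cons] at h1
      have h2 : T = 0 := Multiset.card_eq_zero.1 (by omega)
      subst h2
      exact ⟨(Multiset.singleton_inj.1 hT).symm, rfl⟩
    exact hpq
  | @node S₁ S₂ u w x' h₁ h₂ hx ih₁ ih₂ =>
    intro T hT
    have hmem : r ∈ S₁ + S₂ := by rw [hT]; exact Multiset.mem_cons_self r T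
    rcases Multiset.mem_add.1 hmem with hm | hm
    · obtain ⟨S', rfl⟩ := Multiset.exists_cons_of_mem hm
      rw [Multiset.cons_add] at hT
      rw [← (Multiset.cons_inj_right r).1 hT]
      have := Association.node (ih₁ S' rfl) h₂ hx
      rwa [Multiset.cons_add, Multiset.cons_add] at this
    · obtain ⟨S', rfl⟩ := Multiset.exists_cons_of_mem hm
      rw [Multiset.add_cons] at hT
      rw [← (Multiset.cons_inj_right r).1 hT]
      have := Association.node h₁ (ih₂ S' rfl) hx
      rwa [Multiset.add_cons, Multiset.add_cons] at this

variable {P : Type*} [PartialField P]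

theorem SumsTo.replace {p q r x : P} (hr : r ∈ padd p q) {T : Multiset P}
    (h : SumsTo (r ::ₘ T) x) : SumsTo (p ::ₘ q ::ₘ T) x := by
  obtain ⟨Z, hZ⟩ := h
  refine ⟨Z, ?_⟩
  rw [Multiset.cons_add, Multiset.cons_add]
  exact association_replace hr hZ _ (Multiset.cons_add _ _ _)

theorem sumsTo_cons_neg_cons_iff {z x : P} {T : Multiset P} :
    SumsTo (z ::ₘ (-z) ::ₘ T) x ↔ SumsTo T x := by
  constructor
  · rintro ⟨Z, hZ⟩
    refine ⟨z ::ₘ Z, ?_⟩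
    convert hZ using 1
    rw [Multiset.map_cons]
    simp only [← Multiset.singleton_add]
    abel
  · rintro ⟨Z, hZ⟩
    refine ⟨Z, ?_⟩
    have h0 : (0 : P) ∈ padd z (-z) := (zero_mem_padd_iff _ _).2 rfl
    have := Association.node hZ (Association.node (.leaf z) (.leaf (-z)) h0)
      (by rw [padd_zero]; exact Part.mem_some x)
    convert this using 1
    simp only [← Multiset.singleton_add]
    abel

theorem sumsTo_singleton (r : P) : SumsTo {r} r :=
  ⟨0, by simpa using Association.leaf r⟩

end Sums

/-- The partial field `P` is contained in the ring `R` in such a way that a sum is defined if and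
only if it lies in `P`. -/
structure IsRealization {P R : Type*} [PartialField P] [CommRing R] (val : P → R) : Prop where
  map_zero : val 0 = 0
  map_one : val 1 = 1
  map_mul : ∀ p q, val (p * q) = val p * val q
  map_neg : ∀ p, val (-p) = -val p
  injective : Function.Injective val
  mem_padd : ∀ {p q r}, r ∈ padd p q ↔ val r = val p + val q

section Realization

variable {P R : Type*} [PartialField P] [CommRing R] {val : P → R}

theorem IsRealization.sum_eq_of_association (h : IsRealization val) {S : Multiset P} {r : P}
    (hS : Association padd S r) : (S.map val).sum = val r := by
  induction hS with
  | leaf p => simp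
  | node _ _ hr h₁ h₂ =>
    rw [Multiset.map_add, Multiset.sum_add, h₁, h₂, h.mem_padd.1 hr]

theorem IsRealization.sum_eq (h : IsRealization val) {S : Multiset P} {r : P} (hS : SumsTo S r) :
    (S.map val).sum = val r := by
  obtain ⟨Z, hZ⟩ := hS
  rw [← h.sum_eq_of_association hZ, Multiset.map_add, Multiset.map_add, Multiset.sum_add,
    Multiset.sum_add, Multiset.map_map]
  have : (val ∘ fun z => -z) = fun z => -val z := funext h.map_neg
  rw [this, Multiset.sum_map_neg, add_neg_cancel, add_zero]

/-- For the converse of `SumsTo.replace`, split p as r + (-q) and cancel -q against q. -/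
theorem IsRealization.sumsTo_replace_iff (h : IsRealization val) {p q r x : P} (hr : r ∈ padd p q)
    {T : Multiset P} : SumsTo (p ::ₘ q ::ₘ T) x ↔ SumsTo (r ::ₘ T) x := by
  refine ⟨fun hT => ?_, fun hT => hT.replace hr⟩
  have hp : p ∈ padd r (-q) := by
    rw [h.mem_padd] at hr ⊢
    rw [h.map_neg, hr, add_neg_cancel_right]
  have := hT.replace hp
  rw [Multiset.cons_swap (-q), Multiset.cons_swap r, Multiset.cons_swap r,
    sumsTo_cons_neg_cons_iff] at this
  exact this

/-- The hypothesis `hsum` is the only nonformal part: a sum with value in P must actually have an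
association, after adding pairs z, -z. -/
theorem IsRealization.hasDet_iff (h : IsRealization val)
    (hsum : ∀ (S : Multiset P) (r : P), (S.map val).sum = val r → SumsTo S r)
    {n : ℕ} {A : Matrix (Fin n) (Fin n) P} {d : P} : HasDet A d ↔ (A.map val).det = val d := by
  have hprod : ∀ f : Fin n → P, val (∏ i, f i) = ∏ i, val (f i) := fun f =>
    map_prod (⟨⟨val, h.map_one⟩, h.map_mul⟩ : P →* R) f Finset.univ
  have hdet : (A.map val).det =
      (((Finset.univ : Finset (Equiv.Perm (Fin n))).val.map
        fun σ => signed (Equiv.Perm.sign σ) (∏ i, A i (σ i))).map val).sum := by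
    rw [← Matrix.det_transpose, Matrix.det_apply, Multiset.map_map]
    refine congrArg Multiset.sum (Multiset.map_congr rfl fun σ _ => ?_)
    rw [Function.comp_apply, signed]
    simp only [Matrix.transpose_apply, Matrix.map_apply, ← hprod]
    rcases Int.units_eq_one_or (Equiv.Perm.sign σ) with hσ | hσ
    · simp [hσ]
    · rw [hσ, if_neg (by decide), h.map_neg]
      simp
  rw [hdet]
  exact ⟨h.sum_eq, hsum _ _⟩

/-- Two multisets are equivalent if they can be exchanged in all sums. -/
def sumCon (P : Type*) [PartialField P] : AddCon (Multiset P) where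
  r S T := ∀ U x, SumsTo (S + U) x ↔ SumsTo (T + U) x
  iseqv := ⟨fun _ _ _ => Iff.rfl, fun h U x => (h U x).symm, fun h h' U x => (h U x).trans (h' U x)⟩
  add' := fun {S S' T T'} h h' U x => by
    rw [add_assoc, h, ← add_assoc, add_comm S' T, add_assoc, h', ← add_assoc, add_comm T' S']

/-- The class of an element of `P`. -/
noncomputable def sumClass (p : P) :
    AddUnits (sumCon P).Quotient where
  val := (({p} : Multiset P) : (sumCon P).Quotient)
  neg := (({-p} : Multiset P) : (sumCon P).Quotient)
  val_neg := (AddCon.eq _).2 fun U x => by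
    simpa [Multiset.singleton_add] using sumsTo_cons_neg_cons_iff
  neg_val := (AddCon.eq _).2 fun U x => by
    change SumsTo ({-p} + {p} + U) x ↔ SumsTo (0 + U) x
    rw [add_comm ({-p} : Multiset P)]
    simpa [Multiset.singleton_add] using sumsTo_cons_neg_cons_iff

/-- The classes lie in a commutative group, and every defined sum of two elements becomes an
equation there. An equality of classes in this group gives back an equivalence of multisets under
`SumsTo`. -/
theorem IsRealization.sumClass_add (h : IsRealization val) {p q r : P} (hr : val r = val p + val q) :
    sumClass r = sumClass p + sumClass q :=
  AddUnits.ext ((AddCon.eq _).2 fun U x => by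
    simpa [Multiset.singleton_add] using (h.sumsTo_replace_iff (h.mem_padd.2 hr)).symm)

theorem IsRealization.sumClass_zero (h : IsRealization val) : sumClass (0 : P) = 0 := by
  have := h.sumClass_add (p := 0) (q := 0) (r := 0) (by simp [h.map_zero])
  simpa using this

theorem IsRealization.sumClass_neg (h : IsRealization val) (p : P) : sumClass (-p) = -sumClass p := by
  have := h.sumClass_add (p := p) (q := -p) (r := 0) (by simp [h.map_zero, h.map_neg])
  rw [h.sumClass_zero] at this
  exact (neg_eq_of_add_eq_zero_right this.symm).symm

theorem sum_sumClass (S : Multiset P) :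
    ((S.map sumClass).sum : AddUnits (sumCon P).Quotient).val = (S : (sumCon P).Quotient) := by
  induction S using Multiset.induction_on with
  | empty => rfl
  | cons p S ih =>
    rw [Multiset.map_cons, Multiset.sum_cons, AddUnits.val_add, ih, ← Multiset.singleton_add]
    rfl

theorem IsRealization.sumClass_two_pow_mul (h : IsRealization val) {two : P} (htwo : val two = 2)
    (e : P) (j : ℕ) : sumClass (two ^ j * e) = 2 ^ j • sumClass e := by
  induction j with
  | zero => simp
  | succ j ih =>
    rw [pow_succ (2 : ℕ), mul_nsmul, two_nsmul, ← ih]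
    refine h.sumClass_add ?_
    rw [pow_succ', mul_assoc, h.map_mul, htwo]
    ring

/-- If `P` is generated by `-1` and `2`, then a sum is defined as soon as its value lies in `P`. -/
theorem IsRealization.sumsTo_of_sum_eq (h : IsRealization val) {two : P} (htwo : val two = 2)
    (htwo0 : two ≠ 0) (hgen : ∀ p : P, p = 0 ∨ ∃ n : ℤ, p = two ^ n ∨ p = -two ^ n)
    {k : ℕ} (hk : (2 : R) ^ k = 1) (hchar : ∀ N : ℤ, (N : R) = 0 → (2 ^ k - 1 : ℤ) ∣ N)
    (S : Multiset P) (r : P) (hS : (S.map val).sum = val r) : SumsTo S r := by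
  -- A common denominator: for large m every element involved is an integer multiple of 2^(-m), with
  -- the same integer for its value and for its class.
  let e : ℕ → P := fun m => two⁻¹ ^ m
  have hpow : ∀ n : ℤ, ∃ m₀ : ℕ, ∀ m ≥ m₀, ∃ j : ℕ, two ^ n = two ^ j * e m := by
    intro n
    refine ⟨(-n).toNat, fun m hm => ⟨(n + m).toNat, ?_⟩⟩
    have h1 : two ^ (n + m).toNat = two ^ (n + m) := by
      rw [← zpow_natCast, Int.toNat_of_nonneg (by omega)]
    rw [h1, zpow_add₀ htwo0, zpow_natCast, mul_assoc, ← mul_pow, mul_inv_cancel₀ htwo0, one_pow,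
      mul_one]
  have hval : ∀ j m, val (two ^ j * e m) = 2 ^ j * val (e m) := by
    intro j m
    induction j with
    | zero => simp
    | succ j ih => rw [pow_succ', mul_assoc, h.map_mul, ih, htwo]; ring
  have helt : ∀ p : P, ∃ m₀ : ℕ, ∀ m ≥ m₀, ∃ N : ℤ, val p = N * val (e m) ∧
      sumClass p = N • sumClass (e m) := by
    intro p
    rcases hgen p with rfl | ⟨n, hn⟩
    · exact ⟨0, fun m _ => ⟨0, by simp [h.map_zero], by simp [h.sumClass_zero]⟩⟩
    · obtain ⟨m₀, hm₀⟩ := hpow n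
      refine ⟨m₀, fun m hm => ?_⟩
      obtain ⟨j, hj⟩ := hm₀ m hm
      have hu : sumClass (two ^ j * e m) = (2 ^ j : ℤ) • sumClass (e m) := by
        rw [h.sumClass_two_pow_mul htwo, ← natCast_zsmul]
        push_cast
        rfl
      rcases hn with rfl | rfl
      · exact ⟨2 ^ j, by rw [hj, hval]; push_cast; rfl, by rw [hj, hu]⟩
      · exact ⟨-2 ^ j, by rw [h.map_neg, hj, hval]; push_cast; ring,
          by rw [h.sumClass_neg, hj, hu, neg_zsmul]⟩
  have hms : ∀ S : Multiset P, ∃ m₀ : ℕ, ∀ m ≥ m₀, ∃ N : ℤ, (S.map val).sum = N * val (e m) ∧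
      (S.map sumClass).sum = N • sumClass (e m) := by
    intro S
    induction S using Multiset.induction_on with
    | empty => exact ⟨0, fun m _ => ⟨0, by simp, by simp⟩⟩
    | cons p S ih =>
      obtain ⟨m₁, h₁⟩ := helt p
      obtain ⟨m₂, h₂⟩ := ih
      refine ⟨max m₁ m₂, fun m hm => ?_⟩
      obtain ⟨N₁, h₁, h₁'⟩ := h₁ m (le_of_max_le_left hm)
      obtain ⟨N₂, h₂, h₂'⟩ := h₂ m (le_of_max_le_right hm)
      refine ⟨N₁ + N₂, ?_, ?_⟩
      · rw [Multiset.map_cons, Multiset.sum_cons, h₁, h₂]; push_cast; ring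
      · rw [Multiset.map_cons, Multiset.sum_cons, h₁', h₂', add_zsmul]
  obtain ⟨m₁, h₁⟩ := hms S
  obtain ⟨m₂, h₂⟩ := helt r
  obtain ⟨N₁, h₁, h₁'⟩ := h₁ (max m₁ m₂) (le_max_left _ _)
  obtain ⟨N₂, h₂, h₂'⟩ := h₂ (max m₁ m₂) (le_max_right _ _)
  generalize max m₁ m₂ = m at *
  have he : val (e m) * val (two ^ m) = 1 := by
    rw [← h.map_mul, ← mul_pow, inv_mul_cancel₀ htwo0, one_pow, h.map_one]
  obtain ⟨M, hM⟩ := hchar (N₁ - N₂) (by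
    have : (N₁ : R) * val (e m) = N₂ * val (e m) := by rw [← h₁, ← h₂, hS]
    push_cast
    linear_combination val (two ^ m) * this - (N₁ - N₂ : R) * he)
  -- Since 2^k = 1 in R, doubling k times returns to the same element, so 2^k - 1 kills the class.
  -- By `hchar` it also divides the difference of the two coefficients.
  have hcycle : ((2 ^ k - 1 : ℤ)) • sumClass (e m) = 0 := by
    have h3 := h.sumClass_two_pow_mul htwo (e m) k
    have h4 : two ^ k * e m = e m := h.injective (by rw [hval, hk, one_mul])
    rw [h4, ← natCast_zsmul] at h3
    push_cast at h3
    rw [sub_zsmul, one_zsmul, ← h3, add_neg_cancel]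
  have hunit : (S.map sumClass).sum = sumClass r := by
    rw [h₁', h₂', ← sub_eq_zero, sub_eq_add_neg, ← sub_zsmul, hM, mul_comm, mul_zsmul, hcycle, zsmul_zero]
  have hQ := congrArg AddUnits.val hunit
  rw [sum_sumClass] at hQ
  have := (AddCon.eq _).1 hQ 0 r
  rw [add_zero, add_zero] at this
  exact this.2 (sumsTo_singleton r)

end Realization

/-! ### The partial fields of the theorem -/

theorem isRealization_field (F : Type*) [Field F] : IsRealization (fun x : F => x) where
  map_zero := rfl
  map_one := rfl
  map_mul _ _ := rfl
  map_neg _ := rfl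
  injective _ _ h := h
  mem_padd := Part.mem_some_iff

theorem sumsTo_of_sum_eq_field {F : Type*} [Field F] (S : Multiset F) (r : F)
    (hS : S.sum = r) : SumsTo S r := by
  subst hS
  -- The pair 0, -0 is added because the empty multiset has no association.
  refine ⟨{0}, ?_⟩
  have h0 : Association (padd : F → F → Part F) {(0 : F), -0} 0 :=
    Association.node (S := {(0 : F)}) (.leaf _) (.leaf _) ((zero_mem_padd_iff _ _).2 rfl)
  rw [Multiset.map_singleton]
  induction S using Multiset.induction_on with
  | empty =>
    rw [Multiset.sum_zero, zero_add]
    exact h0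
  | cons a S ih =>
    rw [Multiset.cons_add, Multiset.sum_cons, ← Multiset.singleton_add]
    exact Association.node (.leaf a) ih (Part.mem_some_iff.2 rfl)

theorem hasDet_field_iff {F : Type*} [Field F] {n : ℕ} {A : Matrix (Fin n) (Fin n) F} {d : F} :
    HasDet A d ↔ A.det = d :=
  (isRealization_field F).hasDet_iff fun S r h => sumsTo_of_sum_eq_field S r (by simpa using h)

theorem isRealization_ofRing {R : Type*} [CommRing R] [Nontrivial R] (S : Set Rˣ) :
    IsRealization (OfRing.val : OfRing R S → R) where
  map_zero := rfl
  map_one := rfl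
  map_mul _ _ := rfl
  map_neg _ := rfl
  injective _ _ h := OfRing.ext h
  mem_padd := mem_ofRing_padd

theorem isRealization_directProduct (F G : Type*) [Field F] [Field G] :
    IsRealization (fun x : DirectProduct F G => (x.fst, x.snd)) where
  map_zero := rfl
  map_one := rfl
  map_mul _ _ := rfl
  map_neg _ := rfl
  injective x y h := DirectProduct.ext (congrArg Prod.fst h) (congrArg Prod.snd h)
  mem_padd {p q r} := by
    rw [show r ∈ padd p q ↔ _ from DirectProduct.mem_add, Prod.ext_iff]
    exact and_congr Part.mem_some_iff Part.mem_some_iff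

/-- The element `2` of the dyadic partial field. -/
def dyadicTwo : DyadicPartialField :=
  ⟨2, Or.inr ⟨_, Subgroup.subset_closure (Or.inl rfl), rfl⟩⟩

theorem dyadic_eq_zpow (p : DyadicPartialField) :
    p = 0 ∨ ∃ n : ℤ, p = dyadicTwo ^ n ∨ p = -dyadicTwo ^ n := by
  have hval : ∀ n : ℤ, (dyadicTwo ^ n : DyadicPartialField).val = 2 ^ n := by
    intro n
    have := map_zpow₀ (⟨⟨OfRing.val, rfl⟩, rfl, fun _ _ => rfl⟩ : DyadicPartialField →*₀ ℚ) dyadicTwo n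
    exact this
  rcases mem_ringCarrier_singleton.1 p.mem with h | ⟨n, h | h⟩
  · exact Or.inl (OfRing.ext h)
  · refine Or.inr ⟨n, Or.inl (OfRing.ext ?_)⟩
    rw [h, hval, Units.val_zpow_eq_zpow_val, Units.val_mk0]
  · refine Or.inr ⟨n, Or.inr (OfRing.ext ?_)⟩
    change p.val = -(dyadicTwo ^ n : DyadicPartialField).val
    rw [h, hval, Units.val_zpow_eq_zpow_val, Units.val_mk0]

theorem hasDet_dyadic_iff {n : ℕ} {A : Matrix (Fin n) (Fin n) DyadicPartialField}
    {d : DyadicPartialField} : HasDet A d ↔ (A.map OfRing.val).det = d.val := by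
  -- With k = 0 the divisor 2^k - 1 is 0, which suits characteristic 0.
  refine (isRealization_ofRing _).hasDet_iff
    ((isRealization_ofRing _).sumsTo_of_sum_eq (two := dyadicTwo) rfl ?_ dyadic_eq_zpow (k := 0)
      (pow_zero _) ?_)
  · intro h
    exact two_ne_zero (α := ℚ) (congrArg OfRing.val h)
  · intro N hN
    have : N = 0 := by exact_mod_cast hN
    simp [this]

/-- The element `2` of `GF(3) ⊗ GF(5)`. -/
def residueTwo : DirectProduct (ZMod 3) (ZMod 5) := ⟨2, 2, by decide⟩

theorem residue_eq_zpow (p : DirectProduct (ZMod 3) (ZMod 5)) :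
    p = 0 ∨ ∃ n : ℤ, p = residueTwo ^ n ∨ p = -residueTwo ^ n := by
  have hval := (isRealization_directProduct (ZMod 3) (ZMod 5))
  have hpow : ∀ n : ℕ, ((residueTwo ^ n).fst, (residueTwo ^ n).snd) = (2 : ZMod 3 × ZMod 5) ^ n := by
    intro n
    induction n with
    | zero => rfl
    | succ n ih =>
      rw [pow_succ, pow_succ, ← ih]
      rfl
  have key : ∀ x : ZMod 3 × ZMod 5, (x.1 ≠ 0 ↔ x.2 ≠ 0) → x = 0 ∨ ∃ n : Fin 4,
      x = 2 ^ (n : ℕ) ∨ x = -2 ^ (n : ℕ) := by decide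
  rcases key (p.fst, p.snd) p.nonzero_iff with h | ⟨n, h | h⟩
  · exact Or.inl (hval.injective h)
  · refine Or.inr ⟨(n : ℕ), Or.inl (hval.injective ?_)⟩
    rw [zpow_natCast]
    exact h.trans (hpow n).symm
  · refine Or.inr ⟨(n : ℕ), Or.inr (hval.injective ?_)⟩
    rw [hval.map_neg, zpow_natCast]
    exact h.trans (congrArg Neg.neg (hpow n).symm)

theorem hasDet_residue_iff {n : ℕ} {A : Matrix (Fin n) (Fin n) (DirectProduct (ZMod 3) (ZMod 5))}
    {d : DirectProduct (ZMod 3) (ZMod 5)} :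
    HasDet A d ↔ (A.map fun x => ((x.fst, x.snd) : ZMod 3 × ZMod 5)).det = (d.fst, d.snd) := by
  -- With k = 4 the divisor is 15, and 2^4 = 1 modulo 15.
  refine (isRealization_directProduct (ZMod 3) (ZMod 5)).hasDet_iff
    ((isRealization_directProduct (ZMod 3) (ZMod 5)).sumsTo_of_sum_eq (two := residueTwo) rfl ?_
      residue_eq_zpow (k := 4) (by decide) ?_)
  · intro h
    exact absurd (congrArg DirectProduct.fst h) (by decide)
  · intro N hN
    rw [Prod.ext_iff] at hN
    have h3 := (ZMod.intCast_zmod_eq_zero_iff_dvd N 3).1 hN.1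
    have h5 := (ZMod.intCast_zmod_eq_zero_iff_dvd N 5).1 hN.2
    norm_num
    omega

end PartialField

namespace PartialField

/-! ### Representations of matroids -/

section Representations

variable {α : Type*} {M : Matroid α}

theorem rank_eq_of_hasNonzeroDet {P : Type*} [PartialField P] {E : Type*} {r : ℕ}
    {A : Matrix (Fin r) E P} (g : Fin r ↪ E) (hg : HasNonzeroDet (A.submatrix id g)) :
    rank A = r := by
  have hr : r ∈ {k : ℕ | ∃ (f : Fin k ↪ Fin r) (g : Fin k ↪ E), HasNonzeroDet (A.submatrix f g)} :=
    ⟨Function.Embedding.refl _, g, hg⟩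
  have hle : ∀ k ∈ {k : ℕ | ∃ (f : Fin k ↪ Fin r) (g : Fin k ↪ E),
      HasNonzeroDet (A.submatrix f g)}, k ≤ r := by
    rintro k ⟨f, -⟩
    simpa using Fintype.card_le_of_embedding f
  exact le_antisymm (csSup_le ⟨r, hr⟩ hle) (le_csSup ⟨r, hle⟩ hr)

/-- A matrix whose nonzero subdeterminants are in the same positions as those of a representation is
a representation. -/
theorem isRepresentable_of_hasNonzeroDet_iff {P Q : Type*} [PartialField P] [PartialField Q] {r : ℕ}
    {A : Matrix (Fin r) M.E P} (hrank : rank A = r)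
    (hbase : ∀ B : Set M.E, M.IsBase (Subtype.val '' B) ↔ B ∈ bases A)
    {A' : Matrix (Fin r) M.E Q} (hA' : IsPMatrix A')
    (h : ∀ (n : ℕ) (f : Fin n ↪ Fin r) (g : Fin n ↪ M.E),
      HasNonzeroDet (A.submatrix f g) ↔ HasNonzeroDet (A'.submatrix f g)) :
    IsRepresentable Q M := by
  refine ⟨r, A', hA', ?_, fun B => ?_⟩
  · have : rank A' = rank A := by simp only [rank, h]
    exact this.trans hrank
  · rw [hbase]
    exact exists_congr fun g => and_congr_right fun _ => h r (Function.Embedding.refl _) g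

theorem hasNonzeroDet_field_iff {F : Type*} [Field F] {n : ℕ} {A : Matrix (Fin n) (Fin n) F} :
    HasNonzeroDet A ↔ A.det ≠ 0 :=
  ⟨fun ⟨_, hd, hA⟩ => by rwa [hasDet_field_iff.1 hA], fun h => ⟨_, h, hasDet_field_iff.2 rfl⟩⟩

theorem isPMatrix_field {F : Type*} [Field F] {X Y : Type*} (A : Matrix X Y F) : IsPMatrix A :=
  fun _ _ _ => ⟨_, hasDet_field_iff.2 rfl⟩

/-! ### From `GF(3) ⊗ GF(5)` to the dyadic partial field -/

theorem snd_mem_of_mem_liftCarrier {x : LiftRing} (hx : x ∈ liftCarrier) :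
    x.2 ∈ ringCarrier ℚ {Units.mk0 (2 : ℚ) two_ne_zero} := by
  rcases mem_ringCarrier_singleton.1 hx with rfl | ⟨n, rfl | rfl⟩
  · exact Or.inl rfl
  · refine mem_ringCarrier_singleton.2 (Or.inr ⟨n, Or.inl ?_⟩)
    rw [liftTwo_zpow_snd, Units.val_zpow_eq_zpow_val, Units.val_mk0]
  · refine mem_ringCarrier_singleton.2 (Or.inr ⟨n, Or.inr ?_⟩)
    rw [Prod.snd_neg, liftTwo_zpow_snd, Units.val_zpow_eq_zpow_val, Units.val_mk0]

theorem snd_ne_zero_iff_of_mem_liftCarrier {x : LiftRing} (hx : x ∈ liftCarrier) :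
    x.2 ≠ 0 ↔ x.1 ≠ 0 := by
  rcases hx with rfl | ⟨g, _, rfl⟩
  · exact iff_of_false (fun h => h rfl) (fun h => h rfl)
  · exact iff_of_true (Units.map (RingHom.snd ResidueRing ℚ).toMonoidHom g).ne_zero
      (Units.map (RingHom.fst ResidueRing ℚ).toMonoidHom g).ne_zero

theorem isRepresentable_dyadic_of_residue [M.Finite]
    (h : IsRepresentable (DirectProduct (ZMod 3) (ZMod 5)) M) :
    IsRepresentable DyadicPartialField M := by
  classical
  obtain ⟨r, A, hA, hrank, hbase⟩ := h
  have : Fintype M.E := M.ground_finite.fintype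
  let val : DirectProduct (ZMod 3) (ZMod 5) → ResidueRing := fun x => (x.fst, x.snd)
  have hval := isRealization_directProduct (ZMod 3) (ZMod 5)
  have hminors : MinorsIn residueCarrier ((Finset.univ : Finset (Fin r)) : Set (Fin r))
      ((Finset.univ : Finset M.E) : Set M.E) (A.map val) := by
    intro n f g _ _
    by_cases hinj : Function.Injective f ∧ Function.Injective g
    · obtain ⟨d, hd⟩ := hA n ⟨f, hinj.1⟩ ⟨g, hinj.2⟩
      have hdet : ((A.map val).submatrix f g).det = (d.fst, d.snd) := hasDet_residue_iff.1 hd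
      rw [hdet]
      exact d.eq_zero_iff
    · rw [det_submatrix_eq_zero_of_not_injective _ f g hinj]
      exact isUnitCarrier_residueCarrier.zero_mem
  obtain ⟨B, hB, hBA⟩ := isLifting_liftCarrier.liftable _ _ _ _ rfl hminors
  have hBmem : ∀ x y, B x y ∈ liftCarrier := fun x y => hB.entry (by simp) (by simp)
  -- The rational components of the lift. Both projections are ring homomorphisms, and on
  -- `liftCarrier` one component vanishes exactly if the other does.
  let B' : Matrix (Fin r) M.E DyadicPartialField := Matrix.of fun x y =>
    ⟨(B x y).2, snd_mem_of_mem_liftCarrier (hBmem x y)⟩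
  have hdet : ∀ (n : ℕ) (f : Fin n ↪ Fin r) (g : Fin n ↪ M.E),
      (B.submatrix f g).det ∈ liftCarrier ∧
      (B.submatrix f g).det.1 = ((A.submatrix f g).map val).det ∧
      (B.submatrix f g).det.2 = ((B'.submatrix f g).map OfRing.val).det := by
    intro n f g
    refine ⟨hB n f g (by simp) (by simp), ?_, ?_⟩
    · have := RingHom.map_det (RingHom.fst ResidueRing ℚ) (B.submatrix f g)
      rw [RingHom.coe_fst] at this
      rw [this]
      congr 1
      ext1 i j
      exact hBA _ (by simp) _ (by simp)
    · have := RingHom.map_det (RingHom.snd ResidueRing ℚ) (B.submatrix f g)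
      rw [RingHom.coe_snd] at this
      rw [this]
      rfl
  refine isRepresentable_of_hasNonzeroDet_iff hrank hbase (A' := B') (fun n f g => ?_)
    fun n f g => ?_
  · obtain ⟨h1, _, h3⟩ := hdet n f g
    exact ⟨⟨_, snd_mem_of_mem_liftCarrier h1⟩, hasDet_dyadic_iff.2 h3.symm⟩
  · obtain ⟨h1, h2, h3⟩ := hdet n f g
    have h4 := snd_ne_zero_iff_of_mem_liftCarrier h1
    constructor
    · rintro ⟨d, hd0, hd⟩
      refine ⟨⟨_, snd_mem_of_mem_liftCarrier h1⟩, ?_, hasDet_dyadic_iff.2 h3.symm⟩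
      intro h0
      refine h4.2 ?_ (congrArg OfRing.val h0)
      rw [h2, hasDet_residue_iff.1 hd]
      exact fun h => hd0 (hval.injective h)
    · rintro ⟨d, hd0, hd⟩
      obtain ⟨d', hd'⟩ := hA n f g
      refine ⟨d', ?_, hd'⟩
      rintro rfl
      refine h4.1 ?_ (by rw [h2, hasDet_residue_iff.1 hd']; rfl)
      rw [h3, hasDet_dyadic_iff.1 hd]
      exact fun h => hd0 (OfRing.ext h)

/-! ### From the dyadic partial field to fields -/

theorem association_map {P Q : Type*} [PartialField P] [PartialField Q] {φ : P → Q}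
    (hφ : ∀ p q r, r ∈ padd p q → φ r ∈ padd (φ p) (φ q)) {S : Multiset P} {r : P}
    (h : Association padd S r) : Association padd (S.map φ) (φ r) := by
  induction h with
  | leaf p => exact .leaf _
  | node _ _ hr h₁ h₂ =>
    rw [Multiset.map_add]
    exact .node h₁ h₂ (hφ _ _ _ hr)

theorem HasDet.map {P Q : Type*} [PartialField P] [PartialField Q] (φ : P →*₀ Q)
    (hneg : ∀ p, φ (-p) = -φ p) (hφ : ∀ p q r, r ∈ padd p q → φ r ∈ padd (φ p) (φ q)) {n : ℕ}
    {A : Matrix (Fin n) (Fin n) P} {d : P} (h : HasDet A d) : HasDet (A.map φ) (φ d) := by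
  obtain ⟨Z, hZ⟩ := h
  refine ⟨Z.map φ, ?_⟩
  convert association_map hφ hZ using 1
  rw [Multiset.map_add, Multiset.map_add, Multiset.map_map, Multiset.map_map, Multiset.map_map]
  congr 1
  · refine Multiset.map_congr rfl fun σ _ => ?_
    simp only [Function.comp_apply, signed, Matrix.map_apply]
    split_ifs
    · rw [map_prod]
    · rw [hneg, map_prod]
  · congr 1
    exact Multiset.map_congr rfl fun z _ => (hneg z).symm

/-- Denominators divide powers of 2. This is needed because casting from ℚ respects sums and
products only when the denominators are nonzero in F. -/
theorem dyadic_den_ne_zero {F : Type*} [Field F] (h2 : (2 : F) ≠ 0) (p : DyadicPartialField) :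
    ((p.val.den : ℕ) : F) ≠ 0 := by
  have key : ∀ (m : ℤ) (k : ℕ), p.val = m / 2 ^ k → ((p.val.den : ℕ) : F) ≠ 0 := by
    intro m k hp h0
    have h1 : p.val = Rat.divInt m (2 ^ k : ℤ) := by
      rw [hp, Rat.divInt_eq_div]
      push_cast
      rfl
    have h3 : (p.val.den : ℤ) ∣ 2 ^ k := by
      rw [h1]
      exact Rat.den_dvd m _
    have h4 : p.val.den ∣ 2 ^ k := by exact_mod_cast h3
    obtain ⟨c, hc⟩ := h4
    have h5 : (2 : F) ^ k = (p.val.den : F) * c := by exact_mod_cast congrArg (Nat.cast (R := F)) hc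
    rw [h0, zero_mul] at h5
    exact pow_ne_zero k h2 h5
  have hpow : ∀ n : ℤ, ∃ (m : ℤ) (k : ℕ), (2 : ℚ) ^ n = m / 2 ^ k := by
    intro n
    refine ⟨2 ^ (n + (-n).toNat).toNat, (-n).toNat, ?_⟩
    rw [eq_div_iff (by positivity), ← zpow_natCast (2 : ℚ) (-n).toNat, ← zpow_add₀ two_ne_zero]
    have e : ((n + (-n).toNat).toNat : ℤ) = n + (-n).toNat := Int.toNat_of_nonneg (by omega)
    rw [Int.cast_pow, Int.cast_ofNat, ← zpow_natCast (2 : ℚ) (n + (-n).toNat).toNat, e]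
  rcases mem_ringCarrier_singleton.1 p.mem with h | ⟨n, h | h⟩
  · exact key 0 0 (by simp [h])
  · obtain ⟨m, k, hmk⟩ := hpow n
    rw [Units.val_zpow_eq_zpow_val, Units.val_mk0, hmk] at h
    exact key m k h
  · obtain ⟨m, k, hmk⟩ := hpow n
    rw [Units.val_zpow_eq_zpow_val, Units.val_mk0, hmk] at h
    exact key (-m) k (by rw [h]; push_cast; ring)

/-- The homomorphism from the dyadic partial field to a field of characteristic not two. -/
noncomputable def dyadicCast {F : Type*} [Field F] (h2 : (2 : F) ≠ 0) : DyadicPartialField →*₀ F where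
  toFun p := (p.val : F)
  map_zero' := Rat.cast_zero
  map_one' := Rat.cast_one
  map_mul' p q := Rat.cast_mul_of_ne_zero (dyadic_den_ne_zero h2 p) (dyadic_den_ne_zero h2 q)

theorem isRepresentable_of_dyadic (h : IsRepresentable DyadicPartialField M) (F : Type*) [Field F]
    (h2 : (2 : F) ≠ 0) : IsRepresentable F M := by
  obtain ⟨r, A, hA, hrank, hbase⟩ := h
  have hdet : ∀ (n : ℕ) (f : Fin n ↪ Fin r) (g : Fin n ↪ M.E) (d : DyadicPartialField),
      HasDet (A.submatrix f g) d →
      (((A.map (dyadicCast h2)).submatrix f g).det = dyadicCast h2 d) := fun n f g d hd => by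
    rw [← hasDet_field_iff]
    change HasDet ((A.submatrix f g).map (dyadicCast h2)) _
    refine hd.map (dyadicCast h2) (fun p => Rat.cast_neg p.val) (fun p q r hr => ?_)
    refine Part.mem_some_iff.2 ?_
    change ((r.val : ℚ) : F) = (p.val : F) + (q.val : F)
    rw [(isRealization_ofRing _).mem_padd.1 hr]
    exact Rat.cast_add_of_ne_zero (dyadic_den_ne_zero h2 p) (dyadic_den_ne_zero h2 q)
  refine isRepresentable_of_hasNonzeroDet_iff hrank hbase (A' := A.map (dyadicCast h2))
    (isPMatrix_field _) fun n f g => ?_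
  rw [hasNonzeroDet_field_iff]
  constructor
  · rintro ⟨d, hd0, hd⟩
    rw [hdet n f g d hd]
    exact (map_ne_zero _).2 hd0
  · intro h
    obtain ⟨d, hd⟩ := hA n f g
    rw [hdet n f g d hd, map_ne_zero] at h
    exact ⟨d, h, hd⟩

/-! ### From fields to `GF(3) ⊗ GF(5)` -/

theorem IsRepresentable.of_ringEquiv {F G : Type*} [Field F] [Field G] (e : F ≃+* G)
    (h : IsRepresentable F M) : IsRepresentable G M := by
  obtain ⟨r, A, hA, hrank, hbase⟩ := h
  refine isRepresentable_of_hasNonzeroDet_iff hrank hbase (A' := A.map e) (isPMatrix_field _)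
    fun n f g => ?_
  rw [hasNonzeroDet_field_iff, hasNonzeroDet_field_iff, Matrix.submatrix_map]
  have := RingHom.map_det e.toRingHom (A.submatrix f g)
  have h' : ((A.submatrix f g).map e).det = e (A.submatrix f g).det := this.symm
  rw [h', ne_eq, ne_eq, map_eq_zero_iff e e.injective]

theorem det_ne_zero_iff_range_mem_bases {F : Type*} [Field F] {E : Type*} {r : ℕ}
    {A : Matrix (Fin r) E F} {h : Fin r → E} :
    (A.submatrix id h).det ≠ 0 ↔ Function.Injective h ∧ Set.range h ∈ bases A := by
  constructor
  · intro hdet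
    have hinj : Function.Injective h := by
      by_contra hinj
      exact hdet (det_submatrix_eq_zero_of_not_injective A id h fun h => hinj h.2)
    exact ⟨hinj, ⟨h, hinj⟩, rfl, hasNonzeroDet_field_iff.2 hdet⟩
  · rintro ⟨hinj, g, hg, hdet⟩
    rw [hasNonzeroDet_field_iff] at hdet
    -- Two orderings of the same column set differ by σ, which affects only the sign.
    let σ : Equiv.Perm (Fin r) := (Equiv.ofInjective h hinj).trans
      ((Equiv.setCongr hg.symm).trans (Equiv.ofInjective g g.injective).symm)
    have hσ : h = g ∘ σ := by
      funext i
      have : Equiv.ofInjective g g.injective (σ i) =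
          Equiv.setCongr hg.symm (Equiv.ofInjective h hinj i) := by simp [σ]
      exact (congrArg Subtype.val this).symm
    have : A.submatrix id h = (A.submatrix id g).submatrix id σ := by
      rw [hσ]
      rfl
    rw [this, Matrix.det_permute']
    refine mul_ne_zero ?_ hdet
    rcases Int.units_eq_one_or (Equiv.Perm.sign σ) with h | h <;> simp [h]

open Classical in
/-- The columns `g'`, completed by those of the columns `g` that do not correspond to the rows
`f`. -/
noncomputable def completeColumns {E : Type*} {n r : ℕ} (f : Fin n → Fin r) (g' : Fin n → E)
    (g : Fin r → E) (i : Fin r) : E :=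
  if h : ∃ j, f j = i then g' h.choose else g i

/-- The added columns are unit vectors in the rows outside the range of f, so the matrix is block
triangular with an identity block. -/
theorem det_completeColumns {F : Type*} [Field F] {E : Type*} {n r : ℕ} {A : Matrix (Fin r) E F}
    {g : Fin r → E} (hg : A.submatrix id g = 1) {f : Fin n → Fin r} (hf : Function.Injective f)
    (g' : Fin n → E) :
    (A.submatrix id (completeColumns f g' g)).det = (A.submatrix f g').det := by
  classical
  have hcol : ∀ j, completeColumns f g' g (f j) = g' j := by
    intro j
    have h : ∃ j', f j' = f j := ⟨j, rfl⟩
    rw [completeColumns, dif_pos h, hf h.choose_spec]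
  have hcol' : ∀ i, (¬ ∃ j, f j = i) → completeColumns f g' g i = g i := by
    intro i hi
    rw [completeColumns, dif_neg hi]
  have hentry : ∀ i j, A i (g j) = if i = j then 1 else 0 := fun i j => by
    have := congrFun (congrFun hg i) j
    rwa [Matrix.one_apply] at this
  rw [Matrix.twoBlockTriangular_det' _ (fun i => ∃ j, f j = i)]
  · have h1 : (Matrix.toSquareBlockProp (A.submatrix id (completeColumns f g' g))
        fun i => ¬ ∃ j, f j = i) = 1 := by
      ext ⟨i, hi⟩ ⟨j, hj⟩
      simp [Matrix.toSquareBlockProp, Matrix.toBlock, hcol' j hj, hentry, Matrix.one_apply]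
    rw [h1, Matrix.det_one, mul_one]
    let e : Fin n ≃ {i // ∃ j, f j = i} := Equiv.ofInjective f hf
    rw [← Matrix.det_submatrix_equiv_self e]
    congr 1
    ext i j
    exact congrArg (A (f i)) (hcol j)
  · intro i hi j hj
    have hij : i ≠ j := by rintro rfl; exact hj hi
    simp [hcol' j hj, hentry, hij]

/-- A representation over a field in standard form with respect to a given base. -/
theorem exists_standard_form {F : Type*} [Field F] {r : ℕ} {A : Matrix (Fin r) M.E F}
    (hbase : ∀ B : Set M.E, M.IsBase (Subtype.val '' B) ↔ B ∈ bases A) {g : Fin r → M.E}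
    (hinj : Function.Injective g) (hg : M.IsBase (Subtype.val '' Set.range g)) :
    ∃ C : Matrix (Fin r) M.E F, C.submatrix id g = 1 ∧
      ∀ h : Fin r → M.E, (C.submatrix id h).det ≠ 0 ↔
        Function.Injective h ∧ M.IsBase (Subtype.val '' Set.range h) := by
  have hdet : (A.submatrix id g).det ≠ 0 :=
    det_ne_zero_iff_range_mem_bases.2 ⟨hinj, (hbase _).1 hg⟩
  have hunit : IsUnit (A.submatrix id g).det := isUnit_iff_ne_zero.2 hdet
  have hmul : ∀ h : Fin r → M.E, ((A.submatrix id g)⁻¹ * A).submatrix id h =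
      (A.submatrix id g)⁻¹ * A.submatrix id h := fun h => rfl
  refine ⟨(A.submatrix id g)⁻¹ * A, ?_, fun h => ?_⟩
  · rw [hmul, Matrix.nonsing_inv_mul _ hunit]
  · rw [hbase, ← det_ne_zero_iff_range_mem_bases, hmul, Matrix.det_mul, mul_ne_zero_iff]
    exact and_iff_right (Matrix.isUnit_nonsing_inv_det _ hunit).ne_zero

theorem isRepresentable_residue_of_fields (h₃ : IsRepresentable (ZMod 3) M)
    (h₅ : IsRepresentable (ZMod 5) M) : IsRepresentable (DirectProduct (ZMod 3) (ZMod 5)) M := by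
  classical
  obtain ⟨r, A₃, -, -, hb₃⟩ := h₃
  obtain ⟨r', A₅, -, -, hb₅⟩ := h₅
  obtain ⟨B, hB⟩ := M.exists_isBase
  obtain ⟨B, rfl⟩ : ∃ B' : Set M.E, Subtype.val '' B' = B :=
    ⟨Subtype.val ⁻¹' B, by rw [Subtype.image_preimage_coe, Set.inter_eq_right.2 hB.subset_ground]⟩
  obtain ⟨g, hg, -⟩ := (hb₃ B).1 hB
  obtain ⟨g', hg', -⟩ := (hb₅ B).1 hB
  -- Both numbers of rows equal the size of the base B.
  obtain rfl : r = r' := by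
    have h1 := Set.ncard_range_of_injective g.injective
    have h2 := Set.ncard_range_of_injective g'.injective
    rw [hg, Nat.card_eq_fintype_card, Fintype.card_fin] at h1
    rw [hg', Nat.card_eq_fintype_card, Fintype.card_fin] at h2
    rw [← h1, ← h2]
  rw [← hg] at hB
  obtain ⟨C₃, hC₃, hC₃'⟩ := exists_standard_form hb₃ g.injective hB
  obtain ⟨C₅, hC₅, hC₅'⟩ := exists_standard_form hb₅ g.injective hB
  -- Both minors complete to maximal minors with the same columns, whose vanishing is read off from
  -- M. Using the same ordering g in both standard forms is essential here.
  have hiff : ∀ (n : ℕ) (f : Fin n → Fin r) (k : Fin n → M.E), Function.Injective f →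
      ((C₃.submatrix f k).det ≠ 0 ↔ (C₅.submatrix f k).det ≠ 0) := fun n f k hf => by
    rw [← det_completeColumns hC₃ hf, ← det_completeColumns hC₅ hf, hC₃', hC₅']
  let C : Matrix (Fin r) M.E (DirectProduct (ZMod 3) (ZMod 5)) := Matrix.of fun x y =>
    ⟨C₃ x y, C₅ x y, by
      simpa using hiff 1 (fun _ => x) (fun _ => y) (Function.injective_of_subsingleton _)⟩
  have hdet : ∀ (n : ℕ) (f : Fin n → Fin r) (k : Fin n → M.E) (hf : Function.Injective f),
      HasDet (C.submatrix f k) ⟨(C₃.submatrix f k).det, (C₅.submatrix f k).det, hiff n f k hf⟩ := by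
    intro n f k hf
    refine hasDet_residue_iff.2 (Prod.ext ?_ ?_)
    · exact RingHom.map_det (RingHom.fst (ZMod 3) (ZMod 5)) _
    · exact RingHom.map_det (RingHom.snd (ZMod 3) (ZMod 5)) _
  have hne : ∀ k : Fin r → M.E, HasNonzeroDet (C.submatrix id k) ↔ (C₃.submatrix id k).det ≠ 0 := by
    intro k
    have hk := hdet r id k Function.injective_id
    constructor
    · rintro ⟨d, hd0, hd⟩ h0
      have h1 := (hasDet_residue_iff.1 hd).symm.trans (hasDet_residue_iff.1 hk)
      refine hd0 (DirectProduct.ext ((congrArg Prod.fst h1).trans h0) ?_)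
      exact d.eq_zero_iff.1 ((congrArg Prod.fst h1).trans h0)
    · intro h0
      exact ⟨_, fun h => h0 (congrArg DirectProduct.fst h), hk⟩
  refine ⟨r, C, fun n f k => ⟨_, hdet n f k f.injective⟩, ?_, fun B' => ?_⟩
  · exact rank_eq_of_hasNonzeroDet g ((hne g).2 (by rw [hC₃]; simp))
  · rw [hb₃]
    constructor
    · rintro ⟨k, rfl, hk⟩
      refine ⟨k, rfl, (hne k).2 ((hC₃' k).2 ⟨k.injective, (hb₃ _).2 ⟨k, rfl, hk⟩⟩)⟩
    · rintro ⟨k, rfl, hk⟩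
      exact (hb₃ _).1 ((hC₃' k).1 ((hne k).1 hk)).2

end Representations

theorem isRepresentable_zmod_of_forall {α : Type*} {M : Matroid α}
    (h : ∀ (F : Type v) [Field F], ringChar F ≠ 2 → IsRepresentable F M) (p : ℕ) [Fact p.Prime]
    (hp : p ≠ 2) : IsRepresentable (ZMod p) M := by
  -- The hypothesis concerns fields in universe v only, so the prime field is lifted there and
  -- brought back.
  refine (h (ULift.{v} (ZMod p)) ?_).of_ringEquiv ULift.ringEquiv
  exact fun h2 => hp ((ringChar.eq (ULift.{v} (ZMod p)) p).symm.trans h2)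

end PartialField

theorem mainTheorem8 {α : Type u} (M : Matroid α) [M.Finite] :
    List.TFAE [
      PartialField.IsRepresentable (PartialField.DirectProduct (ZMod 3) (ZMod 5)) M,
      PartialField.IsRepresentable DyadicPartialField M,
      ∀ (F : Type v) [Field F], ringChar F ≠ 2 → PartialField.IsRepresentable F M] := by
  tfae_have 1 → 2 := PartialField.isRepresentable_dyadic_of_residue
  tfae_have 2 → 3 := fun h F _ hF =>
    PartialField.isRepresentable_of_dyadic h F (Ring.two_ne_zero hF)
  tfae_have 3 → 1 := fun h => PartialField.isRepresentable_residue_of_fields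
    (PartialField.isRepresentable_zmod_of_forall h 3 (by norm_num))
    (PartialField.isRepresentable_zmod_of_forall h 5 (by norm_num))
  tfae_finish
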